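/- Let $M$ be a (Hausdorff) complex manifold of dimension $n$ and let $N\subset M$ be a divisor with normal crossings: near each point $o$ there are local coordinates $(x_1,\dots,x_n)$ vanishing at $o$ in which $N$ is given by $\prod_{i\in I}x_i=0$ for some (possibly empty) $I\subset\{1,\dots,n\}$. Let $\pi:T^*\langle M/N\rangle\to M$ be the logarithmic cotangent bundle, i.e. the vector bundle whose sheaf of sections is the sheaf of logarithmic $1$-forms with poles along $N$; for coordinates as above it has coordinates $(x,\xi)$, and its canonical $1$-form is $\theta=\sum_{i\in I}\xi_i\,dx_i/x_i+\sum_{i\notin I}\xi_i\,dx_i$. Let $L\subset M$ be a trivial center of $(M,N)$: a closed submanifold such that near each $o\in L$ there are coordinates vanishing at $o$ and index sets $J\subset I$ with $|J|\ge 2$, $N=\{\prod_{i\in I}x_i=0\}$ and $L=\{x_i=0 \text{ for all } i\in J\}$. Let $\rho:\widetilde M\to M$ be the blow up of $M$ along $L$, put $\widetilde N=\rho^{-1}(N)$, let $\widetilde\pi:T^*\langle\widetilde M/\widetilde N\rangle\to\widetilde M$ be the projection and $\widetilde\theta$ the canonical $1$-form, and let $\tau:X\to T^*\langle M/N\rangle$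 be the blow up of $T^*\langle M/N\rangle$ along $\pi^{-1}(L)$. (i) $\widetilde N$ is a divisor with normal crossings of $\widetilde M$. The manifold $X$ is a logarithmic symplectic manifold with poles along $\tau^{-1}(\pi^{-1}(N))$ for the $2$-form $d(\tau^*\theta)$; that is, $\tau^*\theta$ is a logarithmic $1$-form and the $n$-th exterior power of $d(\tau^*\theta)$ generates the logarithmic $2n$-forms. There is a biholomorphic map $\Phi:X\to T^*\langle\widetilde M/\widetilde N\rangle$ with $\Phi^*\widetilde\theta=\tau^*\theta$ and $\rho\circ\widetilde\pi\circ\Phi=\pi\circ\tau$, and the map $\tau\circ\Phi^{-1}:T^*\langle\widetilde M/\widetilde N\rangle\to T^*\langle M/N\rangle$ commutes with the multiplication by scalars in the fibres. (ii) Let $S\subset M$ be a hypersurface (a nowhere dense subset which near every point of $M$ is the zero set of one holomorphic function) that is natural, i.e. at no point of $S$ is the germ of $S$ an intersection of irreducible components of the germ of $N$. The conormal of $S$ in $T^*\langle M/N\rangle$ is the closure of the conormal bundle of the regular part of $S\setminus N$, and the proper inverse image of a set under a blow up is the closure of the inverse image of its part outside the center. Then the proper inverse image $\widetilde S$ of $S$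 under $\rho$ is a natural hypersurface of $(\widetilde M,\widetilde N)$, and $\Phi$ maps the proper inverse image under $\tau$ of the conormal of $S$ onto the conormal of $\widetilde S$ in $T^*\langle\widetilde M/\widetilde N\rangle$. -/

import Mathlib

open Set Topology
open scoped Manifold ContDiff


noncomputable section

/-! ### Gluing open subsets of `ℂ^κ` over a base

A `PatchFamily` consists of open subsets `dom i` of `ℂ^κ`, each with a map `base i` to a set `B` and,
off a subset `center` of `B`, a second map `fib i` to a set `Y`, such that the pair is injective on the
dense part of `dom i` lying off the center.  Two points of two patches are identified when
some biholomorphism between neighbourhoods of them respects these maps.  The result is a complex manifold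
with a projection to `B`. -/

/-- Patches to be glued over a base `B`. -/
structure PatchFamily (κ : Type) [Fintype κ] (B Y : Type*) where
  ι : Type*
  dom : ι → Set (κ → ℂ)
  base : ι → (κ → ℂ) → B
  fib : ι → (κ → ℂ) → Y
  center : Set B
  isOpen_dom : ∀ i, IsOpen (dom i)
  dense : ∀ i, dom i ⊆ closure (dom i ∩ {y | base i y ∉ center})
  inj : ∀ i, InjOn (fun y => (base i y, fib i y)) (dom i ∩ {y | base i y ∉ center})

namespace PatchFamily

variable {κ : Type} [Fintype κ] {B Y : Type*} (G : PatchFamily κ B Y)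

/-- `φ` is a biholomorphism from an open subset of the `i`-th patch onto an open subset of the
`j`-th one which respects the maps to `B` and (off the center) to `Y`. -/
structure IsTransition (i j : G.ι) (φ : OpenPartialHomeomorph (κ → ℂ) (κ → ℂ)) : Prop where
  holomorphic : φ ∈ contDiffGroupoid ω 𝓘(ℂ, κ → ℂ)
  source_subset : φ.source ⊆ G.dom i
  target_subset : φ.target ⊆ G.dom j
  base_eq : ∀ z ∈ φ.source, G.base j (φ z) = G.base i z
  fib_eq : ∀ z ∈ φ.source, G.base i z ∉ G.center → G.fib j (φ z) = G.fib i z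

variable {G} in
theorem IsTransition.refl (i : G.ι) :
    G.IsTransition i i (OpenPartialHomeomorph.ofSet (G.dom i) (G.isOpen_dom i)) :=
  ⟨ofSet_mem_contDiffGroupoid _, by simp, by simp, by simp, by simp⟩

variable {G} in
theorem IsTransition.symm {i j : G.ι} {φ : OpenPartialHomeomorph (κ → ℂ) (κ → ℂ)}
    (h : G.IsTransition i j φ) : G.IsTransition j i φ.symm := by
  refine ⟨(contDiffGroupoid ω 𝓘(ℂ, κ → ℂ)).symm h.holomorphic, h.target_subset, h.source_subset,
    fun z hz => ?_, fun z hz hc => ?_⟩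
  · have := h.base_eq _ (φ.map_target hz)
    rw [φ.right_inv hz] at this
    exact this.symm
  · have h1 := h.base_eq _ (φ.map_target hz)
    rw [φ.right_inv hz] at h1
    have := h.fib_eq _ (φ.map_target hz) (by rwa [← h1])
    rw [φ.right_inv hz] at this
    exact this.symm

variable {G} in
theorem IsTransition.trans {i j k : G.ι} {φ ψ : OpenPartialHomeomorph (κ → ℂ) (κ → ℂ)}
    (h : G.IsTransition i j φ) (h' : G.IsTransition j k ψ) : G.IsTransition i k (φ.trans ψ) := by
  refine ⟨(contDiffGroupoid ω 𝓘(ℂ, κ → ℂ)).trans h.holomorphic h'.holomorphic, fun z hz => ?_,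
    fun z hz => ?_, fun z hz => ?_, fun z hz hc => ?_⟩
  · rw [OpenPartialHomeomorph.trans_source] at hz
    exact h.source_subset hz.1
  · rw [OpenPartialHomeomorph.trans_target] at hz
    exact h'.target_subset hz.1
  · rw [OpenPartialHomeomorph.trans_source] at hz
    exact (h'.base_eq _ hz.2).trans (h.base_eq _ hz.1)
  · rw [OpenPartialHomeomorph.trans_source] at hz
    exact (h'.fib_eq _ hz.2 (by rwa [h.base_eq _ hz.1])).trans (h.fib_eq _ hz.1 hc)

/-- A transition from a patch to itself is the identity. -/
theorem IsTransition.eq_self {i : G.ι} {φ : OpenPartialHomeomorph (κ → ℂ) (κ → ℂ)}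
    (h : G.IsTransition i i φ) {y : κ → ℂ} (hy : y ∈ φ.source) : φ y = y := by
  have hcl : y ∈ closure (φ.source ∩ (G.dom i ∩ {y | G.base i y ∉ G.center})) :=
    φ.open_source.inter_closure ⟨hy, G.dense i (h.source_subset hy)⟩
  have hne : (𝓝[φ.source ∩ (G.dom i ∩ {y | G.base i y ∉ G.center})] y).NeBot :=
    mem_closure_iff_nhdsWithin_neBot.1 hcl
  have hEq : EqOn φ id (φ.source ∩ (G.dom i ∩ {y | G.base i y ∉ G.center})) := by
    intro z hz
    have hb := h.base_eq z hz.1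
    have hf := h.fib_eq z hz.1 hz.2.2
    refine G.inj i ⟨h.target_subset (φ.map_source hz.1), ?_⟩ hz.2 ?_
    · change G.base i (φ z) ∉ G.center
      rw [hb]; exact hz.2.2
    · simp only [id, hb, hf]
  have h1 : Filter.Tendsto φ (𝓝[φ.source ∩ (G.dom i ∩ {y | G.base i y ∉ G.center})] y) (𝓝 (φ y)) :=
    (φ.continuousAt hy).tendsto.mono_left nhdsWithin_le_nhds
  have h2 : Filter.Tendsto φ (𝓝[φ.source ∩ (G.dom i ∩ {y | G.base i y ∉ G.center})] y) (𝓝 y) :=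
    (Filter.tendsto_id.mono_left nhdsWithin_le_nhds).congr'
      (Filter.eventuallyEq_of_mem self_mem_nhdsWithin fun z hz => (hEq hz).symm)
  exact tendsto_nhds_unique h1 h2

/-- The identification of points of the patches. -/
def setoid : Setoid (Σ i : G.ι, G.dom i) where
  r p q := ∃ φ, G.IsTransition p.1 q.1 φ ∧ (p.2 : κ → ℂ) ∈ φ.source ∧ φ p.2 = q.2
  iseqv :=
    { refl := fun p => ⟨_, IsTransition.refl p.1, p.2.2, rfl⟩
      symm := by
        rintro p q ⟨φ, h, hs, he⟩
        refine ⟨φ.symm, h.symm, ?_, ?_⟩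
        · rw [← he]; exact φ.map_source hs
        · rw [← he]; exact φ.left_inv hs
      trans := by
        rintro p q r ⟨φ, h, hs, he⟩ ⟨ψ, h', hs', he'⟩
        refine ⟨φ.trans ψ, h.trans h', ?_, ?_⟩
        · rw [OpenPartialHomeomorph.trans_source]
          exact ⟨hs, by rw [mem_preimage, he]; exact hs'⟩
        · rw [OpenPartialHomeomorph.trans_apply, he, he'] }

/-- The manifold obtained by gluing the patches. -/
def Glued : Type _ := Quotient G.setoid

namespace Glued

/-- The point of the glued manifold with coordinates `y` in the patch `i`. -/
def mk (i : G.ι) (y : G.dom i) : G.Glued := Quotient.mk G.setoid ⟨i, y⟩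

theorem mk_eq_mk {i j : G.ι} {y : G.dom i} {z : G.dom j} :
    mk G i y = mk G j z ↔ ∃ φ, G.IsTransition i j φ ∧ (y : κ → ℂ) ∈ φ.source ∧ φ y = z :=
  Quotient.eq (r := G.setoid)

theorem mk_injective (i : G.ι) : Function.Injective (mk G i) := by
  intro y z h
  obtain ⟨φ, hφ, hy, he⟩ := (mk_eq_mk G).1 h
  exact Subtype.ext ((hφ.eq_self G hy).symm.trans he)

theorem exists_mk (x : G.Glued) : ∃ i y, mk G i y = x := by
  induction x using Quotient.inductionOn with
  | h p => exact ⟨p.1, p.2, rfl⟩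

/-- The projection to the base. -/
def proj : G.Glued → B :=
  Quotient.lift (fun p => G.base p.1 p.2) fun p q h => by
    obtain ⟨φ, hφ, hp, he⟩ := h
    rw [← he, hφ.base_eq _ hp]

open Classical in
/-- The value in `Y` of a point off the center (and a default value on it). -/
def val [Inhabited Y] : G.Glued → Y :=
  Quotient.lift (fun p => if G.base p.1 p.2 ∈ G.center then default else G.fib p.1 p.2)
    fun p q h => by
      obtain ⟨φ, hφ, hp, he⟩ := h
      rw [← he, hφ.base_eq _ hp]
      split_ifs with hc
      · rfl
      · exact (hφ.fib_eq _ hp hc).symm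

open Classical in
/-- The coordinates of the patch `i`; the point `x₀` only serves as a default value. -/
def chart (i : G.ι) (x₀ : G.Glued) : PartialEquiv G.Glued (κ → ℂ) where
  toFun x := if h : ∃ y, mk G i y = x then (h.choose : κ → ℂ) else 0
  invFun y := if h : y ∈ G.dom i then mk G i ⟨y, h⟩ else x₀
  source := range (mk G i)
  target := G.dom i
  map_source' := by
    rintro x h
    have h' : ∃ y, mk G i y = x := h
    rw [dif_pos h']
    exact h'.choose.2
  map_target' y hy := by
    rw [dif_pos hy]
    exact mem_range_self _
  left_inv' := by
    rintro x h
    have h' : ∃ y, mk G i y = x := h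
    rw [dif_pos h', dif_pos h'.choose.2]
    exact h'.choose_spec
  right_inv' y hy := by
    have h' : ∃ z, mk G i z = mk G i ⟨y, hy⟩ := ⟨_, rfl⟩
    rw [dif_pos hy, dif_pos h']
    exact congrArg Subtype.val (mk_injective G i h'.choose_spec)

open Classical in
theorem chart_mk {i : G.ι} {x₀ : G.Glued} (y : G.dom i) : chart G i x₀ (mk G i y) = y := by
  have h : ∃ z, mk G i z = mk G i y := ⟨y, rfl⟩
  change (if h : ∃ z, mk G i z = mk G i y then (h.choose : κ → ℂ) else 0) = y
  rw [dif_pos h]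
  exact congrArg Subtype.val (mk_injective G i h.choose_spec)

theorem chart_symm {i : G.ι} {x₀ : G.Glued} {y : κ → ℂ} (hy : y ∈ G.dom i) :
    (chart G i x₀).symm y = mk G i ⟨y, hy⟩ :=
  dif_pos hy

/-- Coordinate changes are locally transitions. -/
theorem exists_transition {i j : G.ι} {x₀ x₁ : G.Glued} {y : κ → ℂ}
    (hy : y ∈ ((chart G i x₀).symm.trans (chart G j x₁)).source) :
    ∃ φ, G.IsTransition i j φ ∧ y ∈ φ.source ∧
      φ.source ⊆ ((chart G i x₀).symm.trans (chart G j x₁)).source ∧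
      EqOn ((chart G i x₀).symm.trans (chart G j x₁)) φ φ.source := by
  rw [PartialEquiv.trans_source] at hy
  have hyi : y ∈ G.dom i := hy.1
  obtain ⟨z, hz⟩ : (chart G i x₀).symm y ∈ range (mk G j) := hy.2
  rw [chart_symm G hyi] at hz
  obtain ⟨φ, hφ, hs, -⟩ := (mk_eq_mk G).1 hz.symm
  have key : ∀ w (hw : w ∈ φ.source), (chart G i x₀).symm w =
      mk G j ⟨φ w, hφ.target_subset (φ.map_source hw)⟩ := fun w hw => by
    rw [chart_symm G (hφ.source_subset hw)]
    exact (mk_eq_mk G).2 ⟨φ, hφ, hw, rfl⟩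
  refine ⟨φ, hφ, hs, fun w hw => ?_, fun w hw => ?_⟩
  · rw [PartialEquiv.trans_source]
    refine ⟨hφ.source_subset hw, ?_⟩
    rw [mem_preimage, key w hw]
    exact mem_range_self _
  · rw [PartialEquiv.coe_trans, Function.comp_apply, key w hw, chart_mk]

/-- The atlas given by the patches. -/
def core : ChartedSpaceCore (κ → ℂ) G.Glued where
  atlas := range fun p : G.ι × G.Glued => chart G p.1 p.2
  chartAt x := chart G (exists_mk G x).choose x
  mem_chart_source x := (exists_mk G x).choose_spec
  chart_mem_atlas x := ⟨(_, x), rfl⟩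
  open_source := by
    rintro _ _ ⟨⟨i, x₀⟩, rfl⟩ ⟨⟨j, x₁⟩, rfl⟩
    rw [isOpen_iff_mem_nhds]
    intro y hy
    obtain ⟨φ, -, hs, hsub, -⟩ := exists_transition G hy
    exact Filter.mem_of_superset (φ.open_source.mem_nhds hs) hsub
  continuousOn_toFun := by
    rintro _ _ ⟨⟨i, x₀⟩, rfl⟩ ⟨⟨j, x₁⟩, rfl⟩ y hy
    obtain ⟨φ, -, hs, -, heq⟩ := exists_transition G hy
    exact ((φ.continuousAt hs).congr
      (Filter.eventuallyEq_of_mem (φ.open_source.mem_nhds hs) heq.symm)).continuousWithinAt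

instance : TopologicalSpace G.Glued := (core G).toTopologicalSpace

instance : ChartedSpace (κ → ℂ) G.Glued := (core G).toChartedSpace

instance : IsManifold 𝓘(ℂ, κ → ℂ) ω G.Glued := by
  refine isManifold_of_contDiffOn _ _ _ ?_
  rintro e e' he he'
  obtain ⟨c, hc, rfl⟩ : ∃ c, ∃ hc : c ∈ (core G).atlas, (core G).openPartialHomeomorph c hc = e := by
    have he1 : e ∈ ⋃ (c : PartialEquiv _ _) (hc : c ∈ (core G).atlas),
      {(core G).openPartialHomeomorph c hc} := he
    simp only [mem_iUnion, mem_singleton_iff] at he1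
    obtain ⟨c, hc, h⟩ := he1
    exact ⟨c, hc, h.symm⟩
  obtain ⟨c', hc', rfl⟩ :
      ∃ c, ∃ hc : c ∈ (core G).atlas, (core G).openPartialHomeomorph c hc = e' := by
    have he1 : e' ∈ ⋃ (c : PartialEquiv _ _) (hc : c ∈ (core G).atlas),
      {(core G).openPartialHomeomorph c hc} := he'
    simp only [mem_iUnion, mem_singleton_iff] at he1
    obtain ⟨c, hc, h⟩ := he1
    exact ⟨c, hc, h.symm⟩
  obtain ⟨⟨i, x₀⟩, rfl⟩ := hc
  obtain ⟨⟨j, x₁⟩, rfl⟩ := hc'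
  rintro y ⟨hy, -⟩
  obtain ⟨φ, hφ, hs, -, heq⟩ := exists_transition G (i := i) (j := j) (x₀ := x₀) (x₁ := x₁) hy
  have h1 : ContDiffOn ℂ ω φ φ.source := by
    have h2 := hφ.holomorphic
    rw [contDiffGroupoid, mem_groupoid_of_pregroupoid] at h2
    simpa [contDiffPregroupoid] using h2.1
  exact ((h1.contDiffAt (φ.open_source.mem_nhds hs)).congr_of_eventuallyEq
    (Filter.eventuallyEq_of_mem (φ.open_source.mem_nhds hs) heq)).contDiffWithinAt

end Glued

end PatchFamily

section Manifolds

variable (κ : Type) [Fintype κ] {M : Type*} [TopologicalSpace M] [ChartedSpace (κ → ℂ) M]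

/-- A system of holomorphic local coordinates on an open subset of the complex manifold `M`. -/
def IsCoordinateChart (e : OpenPartialHomeomorph M (κ → ℂ)) : Prop :=
  e ∈ IsManifold.maximalAtlas 𝓘(ℂ, κ → ℂ) ω M

variable {κ}

/-- In the coordinates `e`, the set `N` is given by `∏_{i ∈ K} x_i = 0`. -/
def IsCoordinateDivisor (e : OpenPartialHomeomorph M (κ → ℂ)) (K : Finset κ) (N : Set M) : Prop :=
  ∀ x ∈ e.source, x ∈ N ↔ ∏ i ∈ K, e x i = 0

/-- In the coordinates `e`, the set `L` is given by `x_i = 0`, `i ∈ J`. -/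
def IsCoordinateSubspace (e : OpenPartialHomeomorph M (κ → ℂ)) (J : Finset κ) (L : Set M) : Prop :=
  ∀ x ∈ e.source, x ∈ L ↔ ∀ i ∈ J, e x i = 0

variable (κ)

/-- `N` is a divisor with normal crossings: near every point `o` there are coordinates vanishing
at `o` in which `N` is given by the product of some of the coordinates. -/
def IsNormalCrossings (N : Set M) : Prop :=
  ∀ o : M, ∃ e : OpenPartialHomeomorph M (κ → ℂ), ∃ K : Finset κ,
    IsCoordinateChart κ e ∧ o ∈ e.source ∧ e o = 0 ∧ IsCoordinateDivisor e K N

/-- `L` is a trivial center of `(M, N)`: a closed submanifold of codimension at least two which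
near each of its points is an intersection of local irreducible components of `N`. -/
def IsTrivialCenter (N L : Set M) : Prop :=
  IsClosed L ∧ ∀ o ∈ L, ∃ e : OpenPartialHomeomorph M (κ → ℂ), ∃ I J : Finset κ,
    IsCoordinateChart κ e ∧ o ∈ e.source ∧ e o = 0 ∧ IsCoordinateDivisor e I N ∧
      IsCoordinateSubspace e J L ∧ J ⊆ I ∧ 2 ≤ J.card

/-- `S` is a (closed analytic) hypersurface: nowhere dense and locally the zero set of one
holomorphic function. -/
def IsHypersurface (S : Set M) : Prop :=
  interior S = ∅ ∧ ∀ o : M, ∃ U : Set M, IsOpen U ∧ o ∈ U ∧ ∃ f : M → ℂ,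
    ContMDiffOn 𝓘(ℂ, κ → ℂ) 𝓘(ℂ, ℂ) ω f U ∧ ∀ x ∈ U, x ∈ S ↔ f x = 0

/-- `S` is natural with respect to `(M, N)`: at no point of `S` is the germ of `S` an intersection
of irreducible components `x_i = 0`, `i ∈ K`, of the germ of `N`. -/
def IsNatural (N S : Set M) : Prop :=
  ∀ o ∈ S, ¬ ∃ e : OpenPartialHomeomorph M (κ → ℂ), ∃ K I : Finset κ,
    IsCoordinateChart κ e ∧ o ∈ e.source ∧ e o = 0 ∧ IsCoordinateDivisor e K N ∧
      I ⊆ K ∧ I.Nonempty ∧ IsCoordinateSubspace e I S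

/-- The covector `α` at `x` is conormal to `S`: near `x ∈ S` the set `S` is a submanifold, and `α`
vanishes on the tangent space of `S` at `x`. -/
def IsConormalCovector (S : Set M) (x : M) (α : TangentSpace 𝓘(ℂ, κ → ℂ) x →L[ℂ] ℂ) : Prop :=
  x ∈ S ∧ ∃ e : OpenPartialHomeomorph M (κ → ℂ), ∃ J : Finset κ,
    IsCoordinateChart κ e ∧ x ∈ e.source ∧ IsCoordinateSubspace e J S ∧
      ∀ v : TangentSpace 𝓘(ℂ, κ → ℂ) x,
        (∀ i ∈ J, (mfderiv 𝓘(ℂ, κ → ℂ) 𝓘(ℂ, κ → ℂ) e x v : κ → ℂ) i = 0) → α v = 0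

variable {κ}

/-- The proper inverse image of `S` under the blow up `ρ` with center `L`. -/
def properInverseImage {M' : Type*} [TopologicalSpace M'] (ρ : M' → M) (L S : Set M) : Set M' :=
  closure (ρ ⁻¹' (S \ L))

open Classical in
/-- The denominator of the `i`-th member `dx_i / x_i` (for `i ∈ K`) or `dx_i` (for `i ∉ K`) of the
frame of logarithmic one-forms with poles along `∏_{i ∈ K} x_i = 0`, at the point `u`. -/
def logDenominator (K : Finset κ) (u : κ → ℂ) (i : κ) : ℂ := if i ∈ K then u i else 1

/-- The one-form `∑_{i ∈ K} a_i dx_i / x_i + ∑_{i ∉ K} a_i dx_i` at the point `x`, where `x_i` are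
the coordinates `e`. -/
def logCovector (e : OpenPartialHomeomorph M (κ → ℂ)) (K : Finset κ) (a : κ → ℂ) (x : M) :
    TangentSpace 𝓘(ℂ, κ → ℂ) x →L[ℂ] ℂ :=
  (∑ i, (a i / logDenominator K (e x) i) • (ContinuousLinearMap.proj i : (κ → ℂ) →L[ℂ] ℂ)).comp
    (mfderiv 𝓘(ℂ, κ → ℂ) 𝓘(ℂ, κ → ℂ) e x)

open Classical in
/-- The derivative of `f` along the `k`-th logarithmic vector field `x_k ∂/∂x_k` (for `k ∈ K`) or
`∂/∂x_k` (for `k ∉ K`). -/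
def frameDeriv (K : Finset κ) (k : κ) (f : (κ → ℂ) → ℂ) (u : κ → ℂ) : ℂ :=
  logDenominator K u k * fderiv ℂ f u (Pi.single k 1)

open Classical in
/-- The one-form `θ` on `M ∖ N` is the potential of a logarithmic symplectic form `σ = dθ` with poles
along the normal crossings divisor `N`.  Locally `θ = ∑_i a_i ω_i` with `a_i` holomorphic (also along
`N`) and `ω_i` the logarithmic coordinate frame; then `dθ = ∑_{k<l} (D_k a_l - D_l a_k) ω_k ∧ ω_l`,
with `D_k` the dual frame of logarithmic vector fields.  The top exterior power of `dθ` generates the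
logarithmic forms of top degree if and only if the matrix of `dθ` is everywhere invertible. -/
def IsLogSymplecticPotential (κ : Type) [Fintype κ] {M : Type*} [TopologicalSpace M]
    [ChartedSpace (κ → ℂ) M] (N : Set M)
    (θ : ∀ x : M, TangentSpace 𝓘(ℂ, κ → ℂ) x →L[ℂ] ℂ) : Prop :=
  IsNormalCrossings κ N ∧
  ∀ o : M, ∃ e : OpenPartialHomeomorph M (κ → ℂ), ∃ K : Finset κ, ∃ a : κ → (κ → ℂ) → ℂ,
    IsCoordinateChart κ e ∧ o ∈ e.source ∧ IsCoordinateDivisor e K N ∧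
    (∀ i, AnalyticOnNhd ℂ (a i) e.target) ∧
    (∀ x ∈ e.source, x ∉ N → θ x = logCovector e K (fun i => a i (e x)) x) ∧
    ∀ u ∈ e.target,
      (Matrix.of fun k l => frameDeriv K k (a l) u - frameDeriv K l (a k) u).det ≠ 0

end Manifolds

/-! ### Blow ups -/

section BlowUp

variable (κ : Type) [Fintype κ] {M : Type*} [TopologicalSpace M] [ChartedSpace (κ → ℂ) M]

theorem subset_closure_inter_ne_zero {V : Set (κ → ℂ)} (hV : IsOpen V) (K : Finset κ) :
    V ⊆ closure (V ∩ {y | ∀ i ∈ K, y i ≠ 0}) := by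
  intro y hy
  have hc : Filter.Tendsto (fun t : ℂ => fun i => y i + t) (𝓝[≠] 0) (𝓝 y) := by
    have : Continuous fun t : ℂ => fun i => y i + t := by fun_prop
    have h := (this.tendsto 0).mono_left (nhdsWithin_le_nhds (s := {0}ᶜ))
    simpa using h
  refine mem_closure_of_tendsto hc ((hc.eventually (hV.mem_nhds hy)).and ?_)
  refine (Filter.eventually_all_finset K).2 fun i _ => ?_
  by_cases hi : y i = 0
  · filter_upwards [self_mem_nhdsWithin] with t ht
    simpa [hi] using ht
  · have : ContinuousAt (fun t : ℂ => y i + t) 0 := by fun_prop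
    exact (this.eventually_ne (by simpa using hi)).filter_mono nhdsWithin_le_nhds

open Classical in
/-- The map `ℂ^κ → ℂ^κ` which multiplies the coordinates with index in `J`, other than the `j`-th one,
by the `j`-th one.  If `x` are the coordinates of the image and `j ∈ J`, the coordinates of the source
are `x_j`, the quotients `x_i / x_j` for `i ∈ J`, `i ≠ j`, and `x_i` for `i ∉ J`. -/
def blowDown (J : Finset κ) (j : κ) (y : κ → ℂ) : κ → ℂ :=
  fun i => if i ∈ J ∧ i ≠ j then y i * y j else y i

theorem continuous_blowDown (J : Finset κ) (j : κ) : Continuous (blowDown κ J j) := by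
  refine continuous_pi fun i => ?_
  unfold blowDown
  split_ifs <;> fun_prop

variable {κ} in
/-- The coordinate systems from which the blow up along `L` is glued: coordinates on an open set that
does not meet `L`, and, for coordinates in which `L` is given by `x_i = 0` for `i ∈ J`, the affine
patch belonging to an index `j ∈ J`. -/
inductive BlowUpPatch (L : Set M) : Type _
  | off (e : OpenPartialHomeomorph M (κ → ℂ)) (he : IsCoordinateChart κ e)
      (hL : Disjoint e.source L) : BlowUpPatch L
  | along (e : OpenPartialHomeomorph M (κ → ℂ)) (he : IsCoordinateChart κ e) (J : Finset κ)
      (hL : IsCoordinateSubspace e J L) (j : κ) (hj : j ∈ J) : BlowUpPatch L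

namespace BlowUpPatch

variable {κ} {L : Set M}

/-- The coordinates of `M` from which the patch is made. -/
def chart : BlowUpPatch (κ := κ) L → OpenPartialHomeomorph M (κ → ℂ)
  | off e _ _ => e
  | along e _ _ _ _ _ => e

/-- The projection from the patch to `M`, written in coordinates. -/
def toCoord : BlowUpPatch (κ := κ) L → (κ → ℂ) → (κ → ℂ)
  | off _ _ _ => id
  | along _ _ J _ j _ => blowDown κ J j

theorem continuous_toCoord (P : BlowUpPatch (κ := κ) L) : Continuous P.toCoord := by
  cases P with
  | off e he hL => exact continuous_id
  | along e he J hL j hj => exact continuous_blowDown κ J j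

theorem isOpen_dom (P : BlowUpPatch (κ := κ) L) : IsOpen (P.toCoord ⁻¹' P.chart.target) :=
  P.chart.open_target.preimage P.continuous_toCoord

theorem along_mem_iff {e : OpenPartialHomeomorph M (κ → ℂ)} {J : Finset κ}
    (hL : IsCoordinateSubspace e J L) {j : κ} (hj : j ∈ J) {y : κ → ℂ}
    (hy : blowDown κ J j y ∈ e.target) : e.symm (blowDown κ J j y) ∈ L ↔ y j = 0 := by
  rw [hL _ (e.map_target hy), e.right_inv hy]
  refine ⟨fun h => by simpa [blowDown] using h j hj, fun h i hi => ?_⟩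
  by_cases hij : i = j
  · simp [blowDown, hij, h]
  · simp [blowDown, hi, hij, h]

end BlowUpPatch

/-- The affine patches of the blow up of `M` along `L`, with their projections to `M`. -/
def blowUpPatches (L : Set M) : PatchFamily κ M Unit where
  ι := BlowUpPatch (κ := κ) L
  dom P := P.toCoord ⁻¹' P.chart.target
  base P y := P.chart.symm (P.toCoord y)
  fib _ _ := ()
  center := L
  isOpen_dom P := P.isOpen_dom
  dense P := by
    cases P with
    | off e he hL =>
      intro y hy
      exact subset_closure ⟨hy, fun h => hL.le_bot ⟨e.map_target hy, h⟩⟩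
    | along e he J hL j hj =>
      refine (subset_closure_inter_ne_zero κ (BlowUpPatch.isOpen_dom (.along e he J hL j hj))
        {j}).trans (closure_mono ?_)
      rintro y ⟨hy, hne⟩
      exact ⟨hy, fun h => hne j (by simp) ((BlowUpPatch.along_mem_iff hL hj hy).1 h)⟩
  inj P := by
    cases P with
    | off e he hL =>
      rintro y ⟨hy, -⟩ z ⟨hz, -⟩ h
      exact e.symm.injOn hy hz (congrArg Prod.fst h)
    | along e he J hL j hj =>
      rintro y ⟨hy, hyL⟩ z ⟨hz, -⟩ h
      have hb : blowDown κ J j y = blowDown κ J j z := e.symm.injOn hy hz (congrArg Prod.fst h)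
      have hyj : y j ≠ 0 := fun h0 => hyL ((BlowUpPatch.along_mem_iff hL hj hy).2 h0)
      have hj' : y j = z j := by simpa [blowDown] using congrFun hb j
      funext i
      have hi := congrFun hb i
      by_cases hc : i ∈ J ∧ i ≠ j
      · simp only [blowDown, if_pos hc, ← hj'] at hi
        exact mul_right_cancel₀ hyj hi
      · simpa only [blowDown, if_neg hc] using hi

/-- The blow up of the complex manifold `M` along the closed submanifold `L`. -/
abbrev BlowUp (L : Set M) : Type _ := (blowUpPatches κ L).Glued

/-- The projection of the blow up of `M` along `L` to `M`. -/
def BlowUp.proj (L : Set M) : BlowUp κ L → M := PatchFamily.Glued.proj (blowUpPatches κ L)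

end BlowUp

/-! ### The logarithmic cotangent bundle -/

section LogCotangent

variable (κ : Type) [Fintype κ] {M : Type*} [TopologicalSpace M] [ChartedSpace (κ → ℂ) M]

variable {κ} in
/-- Coordinates in which `N` is given by the product of some of the coordinates. -/
structure LogChart (N : Set M) where
  chart : OpenPartialHomeomorph M (κ → ℂ)
  poles : Finset κ
  isChart : IsCoordinateChart κ chart
  divisor : IsCoordinateDivisor chart poles N

variable {κ} in
theorem logCovector_injective [IsManifold 𝓘(ℂ, κ → ℂ) ω M] {e : OpenPartialHomeomorph M (κ → ℂ)}
    (he : IsCoordinateChart κ e) {K : Finset κ} {x : M} (hx : x ∈ e.source)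
    (h0 : ∏ i ∈ K, e x i ≠ 0) : Function.Injective fun a : κ → ℂ => logCovector e K a x := by
  classical
  intro a b hab
  have hM1 : IsManifold 𝓘(ℂ, κ → ℂ) 1 M := IsManifold.of_le (n := ω) le_top
  have hd : e.MDifferentiable 𝓘(ℂ, κ → ℂ) 𝓘(ℂ, κ → ℂ) :=
    ⟨(contMDiffOn_of_mem_maximalAtlas he).mdifferentiableOn (by simp),
      (contMDiffOn_symm_of_mem_maximalAtlas he).mdifferentiableOn (by simp)⟩
  funext i
  obtain ⟨v, hv⟩ := hd.mfderiv_surjective hx (Pi.single i (1 : ℂ) : κ → ℂ)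
  have h1 := congrArg (fun α => α v) hab
  have hden : logDenominator K (e x) i ≠ 0 := by
    unfold logDenominator
    split_ifs with hi
    · exact Finset.prod_ne_zero_iff.1 h0 i hi
    · exact one_ne_zero
  have key : ∀ c : κ → ℂ, logCovector e K c x v = c i / logDenominator K (e x) i := by
    intro c
    have : logCovector e K c x v = (∑ k, (c k / logDenominator K (e x) k) •
        (ContinuousLinearMap.proj k : (κ → ℂ) →L[ℂ] ℂ)) (Pi.single i (1 : ℂ) : κ → ℂ) := by
      rw [← hv]; rfl
    rw [this]
    simp [Pi.single_apply]
  simp only [key] at h1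
  exact (div_left_inj' hden).1 h1

variable {κ} in
theorem LogChart.inj [IsManifold 𝓘(ℂ, κ → ℂ) ω M] {N : Set M} (c : LogChart (κ := κ) N)
    {u u' ξ ξ' : κ → ℂ} (hu : u ∈ c.chart.target) (hu' : u' ∈ c.chart.target)
    (hN : c.chart.symm u ∉ N) (h1 : c.chart.symm u = c.chart.symm u')
    (h2 : (logCovector c.chart c.poles ξ (c.chart.symm u) : (κ → ℂ) →L[ℂ] ℂ) =
      logCovector c.chart c.poles ξ' (c.chart.symm u')) : u = u' ∧ ξ = ξ' := by
  obtain rfl : u = u' := c.chart.symm.injOn hu hu' h1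
  have hx := c.chart.map_target hu
  exact ⟨rfl, logCovector_injective c.isChart hx (fun h0 => hN ((c.divisor _ hx).2 h0)) h2⟩

/-- The patches of the logarithmic cotangent bundle of `(M, N)`.  To coordinates `x` in which `N` is
given by `∏_{i ∈ K} x_i = 0` belongs the patch with coordinates `(x, ξ)`; off `N` its point `(x, ξ)` is
the covector `∑_{i ∈ K} ξ_i dx_i / x_i + ∑_{i ∉ K} ξ_i dx_i` at the point `x` of `M`. -/
def logCotangentPatches [IsManifold 𝓘(ℂ, κ → ℂ) ω M] (N : Set M) :
    PatchFamily (κ ⊕ κ) M ((κ → ℂ) →L[ℂ] ℂ) where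
  ι := LogChart (κ := κ) N
  dom c := {y | y ∘ Sum.inl ∈ c.chart.target}
  base c y := c.chart.symm (y ∘ Sum.inl)
  fib c y := logCovector c.chart c.poles (y ∘ Sum.inr) (c.chart.symm (y ∘ Sum.inl))
  center := N
  isOpen_dom c := c.chart.open_target.preimage (by fun_prop)
  dense c := by
    classical
    refine (subset_closure_inter_ne_zero (κ ⊕ κ)
      (c.chart.open_target.preimage (f := fun y : κ ⊕ κ → ℂ => y ∘ Sum.inl) (by fun_prop))
      (c.poles.image Sum.inl)).trans (closure_mono ?_)
    rintro y ⟨hy, hne⟩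
    refine ⟨hy, fun h => ?_⟩
    rw [c.divisor _ (c.chart.map_target hy), c.chart.right_inv hy, Finset.prod_eq_zero_iff] at h
    obtain ⟨i, hi, h⟩ := h
    exact hne (Sum.inl i) (Finset.mem_image_of_mem _ hi) h
  inj c := by
    rintro y ⟨hy, hyN⟩ z ⟨hz, -⟩ h
    obtain ⟨hu, hξ⟩ := c.inj hy hz hyN (Prod.mk.inj h).1 (Prod.mk.inj h).2
    funext k
    cases k with
    | inl i => exact congrFun hu i
    | inr i => exact congrFun hξ i

/-- The logarithmic cotangent bundle `T*⟨M/N⟩` of `M` along the normal crossings divisor `N`. -/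
abbrev LogCotangent [IsManifold 𝓘(ℂ, κ → ℂ) ω M] (N : Set M) : Type _ :=
  (logCotangentPatches κ N).Glued

namespace LogCotangent

variable [IsManifold 𝓘(ℂ, κ → ℂ) ω M] (N : Set M)

/-- The projection `T*⟨M/N⟩ → M`. -/
def proj : LogCotangent κ N → M := PatchFamily.Glued.proj (logCotangentPatches κ N)

/-- Off `N`, the points of `T*⟨M/N⟩` are the covectors of `M`. -/
def covector (p : LogCotangent κ N) : TangentSpace 𝓘(ℂ, κ → ℂ) (proj κ N p) →L[ℂ] ℂ :=
  PatchFamily.Glued.val (logCotangentPatches κ N) p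

/-- The canonical one-form of `T*⟨M/N⟩`, off its poles. -/
def canonicalForm (p : LogCotangent κ N) :
    TangentSpace 𝓘(ℂ, κ ⊕ κ → ℂ) p →L[ℂ] ℂ :=
  (covector κ N p).comp (mfderiv 𝓘(ℂ, κ ⊕ κ → ℂ) 𝓘(ℂ, κ → ℂ) (proj κ N) p)

/-- `q` is the multiple `t p` in the fibre of the vector bundle `T*⟨M/N⟩` that contains `p`. -/
def IsMultiple (t : ℂ) (p q : LogCotangent κ N) : Prop :=
  ∃ (c : LogChart (κ := κ) N) (y z : (logCotangentPatches κ N).dom c),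
    p = PatchFamily.Glued.mk (logCotangentPatches κ N) c y ∧
    q = PatchFamily.Glued.mk (logCotangentPatches κ N) c z ∧
    (∀ i, z.1 (Sum.inl i) = y.1 (Sum.inl i)) ∧ ∀ i, z.1 (Sum.inr i) = t * y.1 (Sum.inr i)

/-- The conormal of `S` relative to `N`, for a set `S` none of whose components lies in `N`: the
closure in `T*⟨M/N⟩` of the conormal bundle of the regular part of `S ∖ N`. -/
def conormal (S : Set M) : Set (LogCotangent κ N) :=
  closure {p | proj κ N p ∉ N ∧ IsConormalCovector κ S (proj κ N p) (covector κ N p)}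

end LogCotangent

end LogCotangent

/-- The pull back of a one-form. -/
def pullbackForm (κ κ' : Type) [Fintype κ] [Fintype κ'] {X X' : Type*} [TopologicalSpace X]
    [ChartedSpace (κ → ℂ) X] [TopologicalSpace X'] [ChartedSpace (κ' → ℂ) X'] (f : X' → X)
    (θ : ∀ x : X, TangentSpace 𝓘(ℂ, κ → ℂ) x →L[ℂ] ℂ) (x : X') :
    TangentSpace 𝓘(ℂ, κ' → ℂ) x →L[ℂ] ℂ :=
  (θ (f x)).comp (mfderiv 𝓘(ℂ, κ' → ℂ) 𝓘(ℂ, κ → ℂ) f x)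

end

/-!
Let `x = blowDown J j y` be the standard chart of the blow up, that is `x i = y i * y j` for
`i ∈ J \ {j}` and `x i = y i` otherwise.  Then `dx i / x i = dy i / y i + dy j / y j` for
`i ∈ J \ {j}`, so that the differential of `ρ` maps the logarithmic frames of `M` to combinations
of those of the blow up with constant coefficients `0` and `1` and determinant `1`.  In fibre
coordinates this is `η ↦ η - fibreShift η`, which changes the coordinate `j` only.  Hence the
logarithmic cotangent bundle of the blow up is the pull back of `T*⟨M/N⟩` under `ρ`, and so is the
blow up of `T*⟨M/N⟩` along `π⁻¹(L)`, as that center is a union of fibres.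

The local isomorphisms obtained in this way are determined by the covectors they carry over
`M \ N`, where `ρ` and `τ` are biholomorphic, so they agree by density and glue to `Φ`.  In the
logarithmic frame `dx i / x i` (`i ∈ I`), `dx i` (`i ∉ I`), `dξ i` the differential of the canonical
form of a logarithmic cotangent bundle has the constant matrix of the standard symplectic form; by
`Φ` this carries over to the blow up of `T*⟨M/N⟩`.

The equation of a hypersurface, pulled back by `blowDown J j`, is a power of the exceptional
coordinate `y j` times a holomorphic function that does not vanish identically on `y j = 0`; the
latter defines the proper inverse image.  Naturality and the conormals only have to be compared
off the center, respectively off `N`.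
-/

noncomputable section

/-! ### Division of analytic functions by a coordinate -/

section Division

variable {𝕜 E F : Type*} [NontriviallyNormedField 𝕜] [NormedAddCommGroup E] [NormedSpace 𝕜 E]
  [NormedAddCommGroup F] [NormedSpace 𝕜 F]

/-- The power series of the quotient of `f x - f (P x)` by `ℓ x`, where `p` is the power series of
`f` and `x - P x = ℓ x • v`.  It arises by replacing the arguments `P x` of `p (m + 1)` by `x` one
after the other. -/
def divisionSeries (p : FormalMultilinearSeries 𝕜 E F) (P : E →L[𝕜] E) (v : E) :
    FormalMultilinearSeries 𝕜 E F := fun m =>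
  ∑ k : Fin (m + 1), ((p (m + 1)).compContinuousLinearMap
    fun i => if i ≤ k then ContinuousLinearMap.id 𝕜 E else P).curryMid k v

theorem apply_sub_apply_eq_smul_divisionSeries (p : FormalMultilinearSeries 𝕜 E F)
    {P : E →L[𝕜] E} {v x : E} {t : 𝕜} (h : x - P x = t • v) (m : ℕ) :
    (p (m + 1) fun _ => x) - (p (m + 1) fun _ => P x) =
      t • divisionSeries p P v m fun _ => x := by
  have telescope := (p (m + 1)).toMultilinearMap.map_sub_map_piecewise
    (fun _ => x) (fun _ => P x) Finset.univ
  simp only [Finset.piecewise_univ, ContinuousMultilinearMap.coe_coe, Finset.mem_univ,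
    true_imp_iff, h] at telescope
  rw [telescope, divisionSeries, sum_apply, Finset.smul_sum]
  refine Finset.sum_congr rfl fun k _ => ?_
  have hupdate (u : E) : (fun i => if i < k then x else if k = i then u else P x) =
      Function.update (fun i => if i < k then x else P x) k u := by
    funext i
    rcases eq_or_ne i k with rfl | hi
    · simp
    · simp [hi, hi.symm]
  rw [hupdate, ← ContinuousMultilinearMap.coe_coe, MultilinearMap.map_update_smul, ← hupdate]
  simp only [ContinuousMultilinearMap.coe_coe, ContinuousMultilinearMap.curryMid_apply,
    ContinuousMultilinearMap.compContinuousLinearMap_apply]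
  congr 2
  funext i
  rcases eq_or_ne i k with rfl | hi
  · simp
  · obtain ⟨i, rfl⟩ := Fin.exists_succAbove_eq hi
    by_cases hlt : k.succAbove i < k <;> simp [hi.symm, hi.le_iff_lt, hlt]

theorem norm_divisionSeries_le (p : FormalMultilinearSeries 𝕜 E F) (P : E →L[𝕜] E) (v : E)
    (m : ℕ) :
    ‖divisionSeries p P v m‖ ≤ (m + 1) * (‖p (m + 1)‖ * (‖P‖ + 1) ^ (m + 1) * ‖v‖) := by
  refine (norm_sum_le_of_le (n := fun _ => ‖p (m + 1)‖ * (‖P‖ + 1) ^ (m + 1) * ‖v‖) _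
    fun k _ => (ContinuousLinearMap.le_opNorm _ _).trans ?_).trans (by simp)
  gcongr
  rw [ContinuousMultilinearMap.norm_curryMid]
  refine (ContinuousMultilinearMap.norm_compContinuousLinearMap_le _ _).trans ?_
  gcongr
  refine (Finset.prod_le_prod (g := fun _ => ‖P‖ + 1) (fun _ _ => norm_nonneg _)
    fun i _ => ?_).trans (by simp)
  split_ifs
  · exact ContinuousLinearMap.norm_id_le.trans (by simp)
  · simp

theorem radius_divisionSeries_pos {p : FormalMultilinearSeries 𝕜 E F} (hp : 0 < p.radius)
    (P : E →L[𝕜] E) (v : E) : 0 < (divisionSeries p P v).radius := by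
  obtain ⟨C, a, -, ha, hpa⟩ := p.le_mul_pow_of_radius_pos hp
  set D : ℝ := ‖P‖ + 1
  set s : ℝ := 1 / (2 * a * D)
  have hs : 0 < s := by positivity
  have hscale : 2 * a * D * s = 1 := mul_one_div_cancel (by positivity)
  suffices (s.toNNReal : ENNReal) ≤ (divisionSeries p P v).radius from
    lt_of_lt_of_le (by simpa using hs) this
  refine (divisionSeries p P v).le_radius_of_bound (C * a * D * ‖v‖) fun m => ?_
  rw [Real.coe_toNNReal s hs.le]
  have htwo : (m + 1 : ℝ) ≤ 2 ^ m := by exact_mod_cast Nat.lt_two_pow_self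
  calc ‖divisionSeries p P v m‖ * s ^ m
      ≤ (m + 1) * (‖p (m + 1)‖ * D ^ (m + 1) * ‖v‖) * s ^ m := by
        gcongr; exact norm_divisionSeries_le p P v m
    _ ≤ 2 ^ m * (C * a ^ (m + 1) * D ^ (m + 1) * ‖v‖) * s ^ m := by gcongr; exact hpa _
    _ = (2 * a * D * s) ^ m * (C * a * D * ‖v‖) := by simp only [mul_pow, pow_succ]; ring
    _ = C * a * D * ‖v‖ := by rw [hscale, one_pow, one_mul]

theorem exists_analyticAt_sub_eq_smul [CompleteSpace F] {f : E → F} (hf : AnalyticAt 𝕜 f 0)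
    {P : E →L[𝕜] E} {ℓ : E → 𝕜} {v : E} (hP : ∀ x, x - P x = ℓ x • v) :
    ∃ g : E → F, AnalyticAt 𝕜 g 0 ∧ ∀ᶠ x in 𝓝 0, f x - f (P x) = ℓ x • g x := by
  obtain ⟨p, r, hp⟩ := hf
  have hrad := radius_divisionSeries_pos (hp.r_pos.trans_le hp.r_le) P v
  have hq := (divisionSeries p P v).hasFPowerSeriesOnBall hrad
  refine ⟨(divisionSeries p P v).sum, hq.analyticAt, ?_⟩
  have hP0 : ∀ᶠ x in 𝓝 (0 : E), P x ∈ Metric.eball (0 : E) r :=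
    P.continuous.tendsto' 0 0 (map_zero P) (Metric.eball_mem_nhds _ hp.r_pos)
  filter_upwards [Metric.eball_mem_nhds _ hp.r_pos, hP0, Metric.eball_mem_nhds _ hrad]
    with x hx hPx hqx
  have hdiff := (hp.hasSum hx).sub (hp.hasSum hPx)
  simp only [zero_add] at hdiff
  have htail : HasSum (fun n => (p (n + 1) fun _ => x) - (p (n + 1) fun _ => P x))
      (f x - f (P x)) := by
    refine (hasSum_nat_add_iff (f := fun n => (p n fun _ => x) - (p n fun _ => P x)) 1).2 ?_
    have hzeroth : (p 0 fun _ => x) = p 0 fun _ => P x := congrArg (p 0) (Subsingleton.elim _ _)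
    simpa [hzeroth] using hdiff
  simp only [apply_sub_apply_eq_smul_divisionSeries p (hP x)] at htail
  exact htail.unique (by simpa using (hq.hasSum hqx).const_smul (ℓ x))

theorem exists_analyticAt_eq_coord_smul [CompleteSpace F] {κ : Type*} [Fintype κ]
    {f : (κ → 𝕜) → F} {a : κ → 𝕜} (hf : AnalyticAt 𝕜 f a) {i : κ} (hi : a i = 0)
    (h0 : ∀ᶠ x in 𝓝 a, x i = 0 → f x = 0) :
    ∃ g : (κ → 𝕜) → F, AnalyticAt 𝕜 g a ∧ ∀ᶠ x in 𝓝 a, f x = x i • g x := by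
  classical
  let P : (κ → 𝕜) →L[𝕜] (κ → 𝕜) := ContinuousLinearMap.id 𝕜 _ -
    (ContinuousLinearMap.proj i : (κ → 𝕜) →L[𝕜] 𝕜).smulRight (Pi.single i (1 : 𝕜))
  have hf' : AnalyticAt 𝕜 (fun x => f (x + a)) 0 :=
    AnalyticAt.fun_comp (g := f) (by simpa using hf) (by fun_prop)
  obtain ⟨g, hg, hfg⟩ := exists_analyticAt_sub_eq_smul hf' (P := P) (ℓ := fun x => x i)
    (v := Pi.single i 1) fun x => by simp [P]
  refine ⟨fun x => g (x - a), AnalyticAt.fun_comp (by simpa using hg) (by fun_prop), ?_⟩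
  have htranslate : Filter.Tendsto (fun x : κ → 𝕜 => x - a) (𝓝 a) (𝓝 0) :=
    (continuous_id.sub continuous_const).tendsto' a 0 (sub_self a)
  have hproject : Filter.Tendsto (fun x : κ → 𝕜 => P (x - a) + a) (𝓝 a) (𝓝 a) :=
    (by fun_prop : Continuous fun x : κ → 𝕜 => P (x - a) + a).tendsto' a a (by simp)
  filter_upwards [htranslate.eventually hfg, hproject.eventually h0] with x hx hx0
  have hzero : f (P (x - a) + a) = 0 := hx0 (by simp [P, hi])
  simpa only [hzero, sub_add_cancel, sub_zero, Pi.sub_apply, hi] using hx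

end Division

/-! ### Zeros of holomorphic functions near a coordinate hyperplane -/

section Zeros

theorem exists_eq_zero_of_norm_lt_of_forall_frontier_le_norm {E : Type*} [NormedAddCommGroup E]
    [NormedSpace ℂ E] [Nontrivial E] {f : E → ℂ} {U : Set E} (hU : Bornology.IsBounded U)
    (hf : DiffContOnCl ℂ f U) {c : E} (hc : c ∈ closure U) {m : ℝ} (hcm : ‖f c‖ < m)
    (hm : ∀ z ∈ frontier U, m ≤ ‖f z‖) : ∃ z ∈ closure U, f z = 0 := by
  by_contra! hne
  have hmpos : 0 < m := (norm_nonneg _).trans_lt hcm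
  have hinv : ‖(f c)⁻¹‖ ≤ m⁻¹ :=
    Complex.norm_le_of_forall_mem_frontier_norm_le hU (hf.inv hne)
      (fun z hz => by simpa using inv_anti₀ hmpos (hm z hz)) hc
  rw [norm_inv, inv_le_inv₀ (norm_pos_iff.2 (hne c hc)) hmpos] at hinv
  exact hcm.not_ge hinv

/-- Compare the value at the zero with the minimum on the boundary. -/
theorem eventually_exists_eq_zero {X E : Type*} [TopologicalSpace X] [NormedAddCommGroup E]
    [NormedSpace ℂ E] [ProperSpace E] [Nontrivial E] {G : X → E → ℂ} {x₀ : X} {U : Set E}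
    (hU : Bornology.IsBounded U) (hd : ∀ᶠ x in 𝓝 x₀, DiffContOnCl ℂ (G x) U)
    (hG : ∀ t ∈ closure U, ContinuousAt (Function.uncurry G) (x₀, t)) {c : E}
    (hc : c ∈ closure U) (h0 : G x₀ c = 0) (hne : ∀ t ∈ frontier U, G x₀ t ≠ 0) :
    ∀ᶠ x in 𝓝 x₀, ∃ t ∈ closure U, G x t = 0 := by
  have hslice : ∀ t ∈ closure U, ContinuousAt (G x₀) t := fun t ht =>
    (hG t ht).comp (f := fun t => (x₀, t)) (by fun_prop)
  have hcpt : IsCompact (frontier U) :=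
    hU.isCompact_closure.of_isClosed_subset isClosed_frontier frontier_subset_closure
  obtain ⟨m, hm0, hm⟩ := hcpt.exists_forall_le' (f := fun t => ‖G x₀ t‖)
    (fun t ht => (hslice t (frontier_subset_closure ht)).norm.continuousWithinAt)
    (fun t ht => norm_pos_iff.2 (hne t ht))
  have hboundary : ∀ᶠ x in 𝓝 x₀, ∀ t ∈ frontier U, m / 2 < ‖G x t‖ :=
    hcpt.eventually_forall_of_forall_eventually fun t ht =>
      (hG t (frontier_subset_closure ht)).norm.eventually
        (lt_mem_nhds ((half_lt_self hm0).trans_le (hm t ht)))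
  have hcenter : ∀ᶠ x in 𝓝 x₀, ‖G x c‖ < m / 2 :=
    ((hG c hc).comp (f := fun x => (x, c)) (by fun_prop)).norm.eventually
      (gt_mem_nhds (by simpa [h0] using hm0))
  filter_upwards [hd, hboundary, hcenter] with x hdx hbx hcx
  exact exists_eq_zero_of_norm_lt_of_forall_frontier_le_norm hU hdx hc hcx fun t ht => (hbx t ht).le

theorem dist_update_le_max {ι : Type*} [Fintype ι] [DecidableEq ι] {π : ι → Type*}
    [∀ i, PseudoMetricSpace (π i)] (x z : ∀ i, π i) (j : ι) (t : π j) :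
    dist (Function.update x j t) z ≤ max (dist x z) (dist t (z j)) := by
  refine (dist_pi_le_iff (le_max_of_le_left dist_nonneg)).2 fun i => ?_
  rcases eq_or_ne i j with rfl | hi
  · simp
  · simpa [hi] using Or.inl (dist_le_pi_dist x z i)

variable {κ : Type*} [Fintype κ]

theorem eventually_eq_zero_of_coord_eq_zero {h : (κ → ℂ) → ℂ} {z : κ → ℂ}
    (hh : AnalyticAt ℂ h z) {j : κ} (hj : z j = 0) (hz : h z = 0)
    (h0 : ∀ᶠ x in 𝓝 z, h x = 0 → x j = 0) : ∀ᶠ x in 𝓝 z, x j = 0 → h x = 0 := by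
  classical
  obtain ⟨r, hr, hball⟩ := Metric.nhds_basis_closedBall.eventually_iff.1
    (hh.eventually_analyticAt.and h0)
  have hmem : ∀ x ∈ Metric.closedBall z r, ∀ t ∈ Metric.closedBall (0 : ℂ) r,
      Function.update x j t ∈ Metric.closedBall z r := fun x hx t ht =>
    (dist_update_le_max x z j t).trans (max_le hx (by rwa [hj]))
  have hz' : z ∈ Metric.closedBall z r := Metric.mem_closedBall_self hr.le
  have hpersist : ∀ᶠ x in 𝓝 z,
      ∃ t ∈ closure (Metric.ball (0 : ℂ) r), h (Function.update x j t) = 0 := by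
    refine eventually_exists_eq_zero (c := 0) (G := fun x t => h (Function.update x j t))
      Metric.isBounded_ball ?_ ?_ (subset_closure (Metric.mem_ball_self hr)) ?_ ?_
    · filter_upwards [Metric.closedBall_mem_nhds z hr] with x hx
      refine DifferentiableOn.diffContOnCl fun t ht => DifferentiableAt.differentiableWithinAt ?_
      exact (hball (hmem x hx t (Metric.closure_ball_subset_closedBall ht))).1.differentiableAt.comp
        t (hasDerivAt_update x j t).differentiableAt
    · intro t ht
      exact ContinuousAt.comp' (f := fun p : (κ → ℂ) × ℂ => Function.update p.1 j p.2)
        (hball (hmem z hz' t (Metric.closure_ball_subset_closedBall ht))).1.continuousAt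
        (continuous_fst.update j continuous_snd).continuousAt
    · have hupdate : Function.update z j 0 = z := by rw [← hj, Function.update_eq_self]
      rwa [hupdate]
    · intro t ht hzero
      rw [frontier_ball _ hr.ne'] at ht
      have ht0 := (hball (hmem z hz' t (Metric.sphere_subset_closedBall ht))).2 hzero
      rw [Function.update_self] at ht0
      exact hr.ne' (by simpa [ht0] using ht.symm)
  filter_upwards [hpersist, Metric.closedBall_mem_nhds z hr] with x ⟨t, ht, hxt⟩ hx hxj
  have ht0 := (hball (hmem x hx t (Metric.closure_ball_subset_closedBall ht))).2 hxt
  rw [Function.update_self] at ht0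
  have hupdate : Function.update x j 0 = x := by rw [← hxj, Function.update_eq_self]
  rwa [ht0, hupdate] at hxt

theorem eventually_eq_zero_of_mem_hyperplane {h : (κ → ℂ) → ℂ} {y x : κ → ℂ} {r : ℝ}
    (hh : AnalyticOnNhd ℂ h (Metric.ball y r)) {j : κ} (hj : y j = 0) (hx : x ∈ Metric.ball y r)
    (hxj : x j = 0) (h0 : ∀ᶠ w in 𝓝 x, w j = 0 → h w = 0) :
    ∀ᶠ w in 𝓝 y, w j = 0 → h w = 0 := by
  classical
  have hr : 0 < r := Metric.pos_of_mem_ball hx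
  have hupdate {w : κ → ℂ} (hw : w j = 0) : Function.update w j 0 = w := by
    rw [← hw, Function.update_eq_self]
  have hproj (w : κ → ℂ) : AnalyticAt ℂ (fun w : κ → ℂ => Function.update w j 0) w := by
    refine analyticAt_pi_iff.2 fun i => ?_
    rcases eq_or_ne i j with rfl | hi
    · simpa using analyticAt_const
    · simp only [Function.update_of_ne hi]
      exact (ContinuousLinearMap.proj i : (κ → ℂ) →L[ℂ] ℂ).analyticAt w
  have hanalytic : AnalyticOnNhd ℂ (fun w => h (Function.update w j 0)) (Metric.ball y r) :=
    fun w hw => AnalyticAt.fun_comp (g := h) (hh _ ((dist_update_le_max w y j 0).trans_lt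
      (max_lt hw (by simpa [hj] using hr)))) (hproj w)
  have hlocal : (fun w => h (Function.update w j 0)) =ᶠ[𝓝 x] 0 := by
    have htend := (hproj x).continuousAt.tendsto
    rw [hupdate hxj] at htend
    filter_upwards [htend.eventually h0] with w hw
    exact hw (by simp)
  have hzero := hanalytic.eqOn_zero_of_preconnected_of_eventuallyEq_zero
    (convex_ball y r).isPreconnected hx hlocal
  filter_upwards [Metric.ball_mem_nhds y hr] with w hw hwj
  simpa [hupdate hwj] using hzero hw

theorem exists_frequently_line_ne_zero {E : Type*} [NormedAddCommGroup E] [NormedSpace ℂ E]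
    {F : E → ℂ} {y : E} (hF : AnalyticAt ℂ F y) (hne : ∃ᶠ x in 𝓝 y, F x ≠ 0) {D : Set E}
    (hD : Dense D) : ∃ p ∈ D, ∃ᶠ t in 𝓝 (0 : ℂ), F (y + t • (p - y)) ≠ 0 := by
  obtain ⟨r, hr, hball⟩ := Metric.nhds_basis_ball.eventually_iff.1 hF.eventually_analyticAt
  have hopen : IsOpen (Metric.ball y r ∩ F ⁻¹' {0}ᶜ) :=
    ContinuousOn.isOpen_inter_preimage (fun x hx => (hball hx).continuousAt.continuousWithinAt)
      Metric.isOpen_ball isOpen_compl_singleton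
  obtain ⟨x, hx, hx0⟩ := (hne.and_eventually (Metric.ball_mem_nhds y hr)).exists
  obtain ⟨p, ⟨hp, hp0⟩, hpD⟩ := hD.inter_open_nonempty _ hopen ⟨x, hx0, hx⟩
  refine ⟨p, hpD, fun hzero => hp0 ?_⟩
  have hconvex : Convex ℝ {t : ℂ | y + t • (p - y) ∈ Metric.ball y r} := by
    simpa [Set.preimage] using (convex_ball (0 : E) r).linear_preimage
      ((LinearMap.toSpanSingleton ℂ E (p - y)).restrictScalars ℝ)
  have hline : AnalyticOnNhd ℂ (fun t : ℂ => F (y + t • (p - y)))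
      {t : ℂ | y + t • (p - y) ∈ Metric.ball y r} :=
    fun t ht => AnalyticAt.fun_comp (g := F) (hball ht) (by fun_prop)
  simpa using hline.eqOn_zero_of_preconnected_of_eventuallyEq_zero hconvex.isPreconnected
    (z₀ := 0) (by simpa using hr) (hzero.mono fun t => not_not.1) (x := 1)
    (by simpa [dist_eq_norm] using hp)

/-- Dividing by `x_j` lowers the order of vanishing along the line, which is finite. -/
theorem exists_eq_coord_pow_smul_of_analyticOrderAt_line {𝕜 E : Type*} [NontriviallyNormedField 𝕜]
    [NormedAddCommGroup E] [NormedSpace 𝕜 E] [CompleteSpace E] {y v : κ → 𝕜} {j : κ}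
    (hj : y j = 0) (hv : v j ≠ 0) {N : ℕ} {F : (κ → 𝕜) → E} (hF : AnalyticAt 𝕜 F y)
    (hN : analyticOrderAt (fun t : 𝕜 => F (y + t • v)) 0 = N) :
    ∃ (m : ℕ) (h : (κ → 𝕜) → E), AnalyticAt 𝕜 h y ∧ (∀ᶠ x in 𝓝 y, F x = x j ^ m • h x) ∧
      ∃ᶠ x in 𝓝 y, x j = 0 ∧ h x ≠ 0 := by
  induction N using Nat.strong_induction_on generalizing F with
  | _ N ih =>
    by_cases hnz : ∃ᶠ x in 𝓝 y, x j = 0 ∧ F x ≠ 0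
    · exact ⟨0, F, hF, by simp, hnz⟩
    obtain ⟨g, hg, hFg⟩ := exists_analyticAt_eq_coord_smul hF hj (by simpa using hnz)
    have hline : Filter.Tendsto (fun t : 𝕜 => y + t • v) (𝓝 0) (𝓝 y) :=
      (by fun_prop : Continuous fun t : 𝕜 => y + t • v).tendsto' 0 y (by simp)
    have hcoord : analyticOrderAt (fun t : 𝕜 => t * v j) 0 = (1 : ℕ) :=
      (by fun_prop : AnalyticAt 𝕜 (fun t : 𝕜 => t * v j) 0).analyticOrderAt_eq_natCast.2
        ⟨fun _ => v j, analyticAt_const, hv, by simp⟩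
    have hquotient : AnalyticAt 𝕜 (fun t : 𝕜 => g (y + t • v)) 0 :=
      AnalyticAt.fun_comp (g := g) (by simpa using hg) (by fun_prop)
    have horder : (N : ℕ∞) = 1 + analyticOrderAt (fun t : 𝕜 => g (y + t • v)) 0 := by
      rw [← hN, ← Nat.cast_one (R := ℕ∞), ← hcoord,
        ← analyticOrderAt_smul (by fun_prop) hquotient]
      refine analyticOrderAt_congr ?_
      filter_upwards [hline.eventually hFg] with t ht
      simpa [hj] using ht
    have hfinite : analyticOrderAt (fun t : 𝕜 => g (y + t • v)) 0 ≠ ⊤ := fun htop => by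
      simp [htop] at horder
    obtain ⟨K, hK⟩ := ENat.ne_top_iff_exists.1 hfinite
    have hNK : N = 1 + K := by rw [← hK] at horder; exact_mod_cast horder
    obtain ⟨m, h, hh, hgh, hnz'⟩ := ih K (by lia) hg hK.symm
    refine ⟨m + 1, h, hh, ?_, hnz'⟩
    filter_upwards [hFg, hgh] with x hFx hgx
    rw [hFx, hgx, smul_smul, pow_succ']

theorem exists_eq_coord_pow_mul {F : (κ → ℂ) → ℂ} {y : κ → ℂ} (hF : AnalyticAt ℂ F y)
    {j : κ} (hj : y j = 0) (hne : ∃ᶠ x in 𝓝 y, F x ≠ 0) :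
    ∃ (m : ℕ) (h : (κ → ℂ) → ℂ), AnalyticAt ℂ h y ∧ (∀ᶠ x in 𝓝 y, F x = x j ^ m * h x) ∧
      ∃ᶠ x in 𝓝 y, x j = 0 ∧ h x ≠ 0 := by
  have hdense : Dense {p : κ → ℂ | p j ≠ 0} :=
    (dense_compl_singleton (0 : ℂ)).preimage (isOpenMap_eval j)
  obtain ⟨p, hp, hline⟩ := exists_frequently_line_ne_zero hF hne hdense
  obtain ⟨N, hN⟩ := ENat.ne_top_iff_exists.1 (mt analyticOrderAt_eq_top.1
    (fun h => hline (by simpa using h)))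
  exact exists_eq_coord_pow_smul_of_analyticOrderAt_line hj (v := p - y) (by simpa [hj] using hp)
    hF hN.symm

theorem exists_zero_iff_mem_closure {F : (κ → ℂ) → ℂ} {y : κ → ℂ} (hF : AnalyticAt ℂ F y) {j : κ}
    (hj : y j = 0) (hne : ∃ᶠ x in 𝓝 y, F x ≠ 0) {W : Set (κ → ℂ)} (hW : W ∈ 𝓝 y) :
    ∃ (V : Set (κ → ℂ)) (h : (κ → ℂ) → ℂ), IsOpen V ∧ y ∈ V ∧ V ⊆ W ∧ AnalyticOnNhd ℂ h V ∧
      ∀ x ∈ V, h x = 0 ↔ x ∈ closure {w | w ∈ V ∧ w j ≠ 0 ∧ F w = 0} := by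
  obtain ⟨m, h, hh, hFh, hnz⟩ := exists_eq_coord_pow_mul hF hj hne
  obtain ⟨r, hr, hball⟩ := Metric.nhds_basis_ball.eventually_iff.1
    ((hh.eventually_analyticAt.and hFh).and hW)
  have hzero : ∀ w ∈ Metric.ball y r, w j ≠ 0 → (F w = 0 ↔ h w = 0) := fun w hw hwj => by
    rw [(hball hw).1.2, mul_eq_zero, or_iff_right (pow_ne_zero m hwj)]
  refine ⟨Metric.ball y r, h, Metric.isOpen_ball, Metric.mem_ball_self hr, fun x hx => (hball hx).2,
    fun x hx => (hball hx).1.1, fun x hx => ⟨fun hx0 => ?_, fun hxc => ?_⟩⟩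
  · by_contra hcl
    have hnear : ∀ᶠ w in 𝓝 x, h w = 0 → w j = 0 := by
      filter_upwards [Metric.isOpen_ball.mem_nhds hx, isClosed_closure.isOpen_compl.mem_nhds hcl]
        with w hw hwc hw0
      by_contra hwj
      exact hwc (subset_closure ⟨hw, hwj, (hzero w hw hwj).2 hw0⟩)
    have hxj : x j = 0 := hnear.self_of_nhds hx0
    refine hnz ?_
    filter_upwards [eventually_eq_zero_of_mem_hyperplane (fun w hw => (hball hw).1.1) hj hx hxj
      (eventually_eq_zero_of_coord_eq_zero (hball hx).1.1 hxj hx0 hnear)] with w hw hw'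
    exact hw'.2 (hw hw'.1)
  · have himage : h '' {w | w ∈ Metric.ball y r ∧ w j ≠ 0 ∧ F w = 0} ⊆ {0} := by
      rintro _ ⟨w, ⟨hw, hwj, hw0⟩, rfl⟩
      exact (hzero w hw hwj).1 hw0
    simpa using closure_mono himage
      ((hball hx).1.1.continuousAt.continuousWithinAt.mem_closure_image hxc)

end Zeros

/-! ### Coordinates of glued manifolds -/

theorem mem_contDiffGroupoid_of_contDiffOn {𝕜 E : Type*} [NontriviallyNormedField 𝕜]
    [NormedAddCommGroup E] [NormedSpace 𝕜 E] {n : WithTop ℕ∞} {φ : OpenPartialHomeomorph E E}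
    (h : ContDiffOn 𝕜 n φ φ.source) (h' : ContDiffOn 𝕜 n φ.symm φ.target) :
    φ ∈ contDiffGroupoid n 𝓘(𝕜, E) := by
  rw [contDiffGroupoid, mem_groupoid_of_pregroupoid]
  simpa [contDiffPregroupoid] using And.intro h h'

theorem exists_openPartialHomeomorph_of_eventually_inverse {X Y : Type*} [TopologicalSpace X]
    [TopologicalSpace Y] {f : X → Y} {g : Y → X} {x : X} (hf : ∀ᶠ w in 𝓝 x, ContinuousAt f w)
    (hg : ∀ᶠ w in 𝓝 (f x), ContinuousAt g w) (hgf : ∀ᶠ w in 𝓝 x, g (f w) = w)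
    (hfg : ∀ᶠ w in 𝓝 (f x), f (g w) = w) {s : Set X} (hs : s ∈ 𝓝 x) {t : Set Y}
    (ht : t ∈ 𝓝 (f x)) :
    ∃ φ : OpenPartialHomeomorph X Y,
      ⇑φ = f ∧ ⇑φ.symm = g ∧ x ∈ φ.source ∧ φ.source ⊆ s ∧ φ.target ⊆ t := by
  obtain ⟨U, hU, hUo, hxU⟩ := eventually_nhds_iff.1 ((hf.and hgf).and hs)
  obtain ⟨V, hV, hVo, hxV⟩ := eventually_nhds_iff.1 ((hg.and hfg).and ht)
  have hfU : ContinuousOn f U := fun w hw => (hU w hw).1.1.continuousWithinAt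
  have hgV : ContinuousOn g V := fun w hw => (hV w hw).1.1.continuousWithinAt
  let φ : OpenPartialHomeomorph X Y :=
    { toFun := f
      invFun := g
      source := U ∩ f ⁻¹' V
      target := V ∩ g ⁻¹' U
      map_source' := fun w hw => ⟨hw.2, by rw [mem_preimage, (hU w hw.1).1.2]; exact hw.1⟩
      map_target' := fun w hw => ⟨hw.2, by rw [mem_preimage, (hV w hw.1).1.2]; exact hw.1⟩
      left_inv' := fun w hw => (hU w hw.1).1.2
      right_inv' := fun w hw => (hV w hw.1).1.2
      open_source := hfU.isOpen_inter_preimage hUo hVo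
      open_target := hgV.isOpen_inter_preimage hVo hUo
      continuousOn_toFun := hfU.mono inter_subset_left
      continuousOn_invFun := hgV.mono inter_subset_left }
  exact ⟨φ, rfl, rfl, ⟨hxU, hxV⟩, fun w hw => (hU w hw.1).2, fun w hw => (hV w hw.1).2⟩

namespace PatchFamily

variable {κ : Type} [Fintype κ] {B Y : Type*} (G : PatchFamily κ B Y)

/-- `F` is, near the point `y` of the `i`-th patch, a holomorphic map to the `j`-th patch which
respects the maps to `B` and (off the center) to `Y`.  Unlike an `IsTransition`, it is not required
to be invertible. -/
structure IsMorphismAt (i j : G.ι) (F : (κ → ℂ) → (κ → ℂ)) (y : κ → ℂ) : Prop where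
  analyticAt : AnalyticAt ℂ F y
  mem_dom : F y ∈ G.dom j
  base_eq : ∀ᶠ w in 𝓝 y, G.base j (F w) = G.base i w
  fib_eq : ∀ᶠ w in 𝓝 y, G.base i w ∉ G.center → G.fib j (F w) = G.fib i w

namespace IsMorphismAt

variable {G} {i j k : G.ι} {F F' : (κ → ℂ) → (κ → ℂ)} {y : κ → ℂ}

theorem comp (hF' : G.IsMorphismAt j k F' (F y)) (hF : G.IsMorphismAt i j F y) :
    G.IsMorphismAt i k (F' ∘ F) y where
  analyticAt := hF'.analyticAt.comp hF.analyticAt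
  mem_dom := hF'.mem_dom
  base_eq := by
    filter_upwards [hF.base_eq, hF.analyticAt.continuousAt.eventually hF'.base_eq] with w h h'
    exact h'.trans h
  fib_eq := by
    filter_upwards [hF.base_eq, hF.fib_eq, hF.analyticAt.continuousAt.eventually hF'.fib_eq]
      with w hb h h' hc
    exact (h' (by rwa [hb])).trans (h hc)

theorem eventually (hF : G.IsMorphismAt i j F y) : ∀ᶠ w in 𝓝 y, G.IsMorphismAt i j F w := by
  filter_upwards [hF.analyticAt.eventually_analyticAt,
    hF.analyticAt.continuousAt.eventually ((G.isOpen_dom j).mem_nhds hF.mem_dom),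
    hF.base_eq.eventually_nhds, hF.fib_eq.eventually_nhds] with w h₁ h₂ h₃ h₄
  exact ⟨h₁, h₂, h₃, h₄⟩

theorem eventually_eq_self (hF : G.IsMorphismAt i i F y) (hy : y ∈ G.dom i) :
    ∀ᶠ w in 𝓝 y, F w = w := by
  obtain ⟨U, hU, hUo, hyU⟩ := eventually_nhds_iff.1
    (hF.eventually.and ((G.isOpen_dom i).mem_nhds hy))
  have hoff : EqOn F id (U ∩ (G.dom i ∩ {y | G.base i y ∉ G.center})) := by
    rintro z ⟨hzU, hz⟩
    have hFz := (hU z hzU).1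
    have hbase := hFz.base_eq.self_of_nhds
    have hfib := hFz.fib_eq.self_of_nhds hz.2
    exact G.inj i ⟨hFz.mem_dom, by rw [mem_ofPred_eq, hbase]; exact hz.2⟩ hz
      (by simp only [hbase, hfib, id])
  have hclosure : EqOn F id U := hoff.of_subset_closure
    (fun w hw => (hU w hw).1.analyticAt.continuousAt.continuousWithinAt) continuousOn_id
    inter_subset_left fun w hw => hUo.inter_closure ⟨hw, G.dense i (hU w hw).2⟩
  exact Filter.eventually_of_mem (hUo.mem_nhds hyU) hclosure

end IsMorphismAt

namespace Glued

theorem mk_eq_mk_of_isMorphismAt {i j : G.ι} {y : κ → ℂ} (hy : y ∈ G.dom i)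
    {F F' : (κ → ℂ) → (κ → ℂ)} (hF : G.IsMorphismAt i j F y)
    (hF' : G.IsMorphismAt j i F' (F y)) : mk G i ⟨y, hy⟩ = mk G j ⟨F y, hF.mem_dom⟩ := by
  have hleft : ∀ᶠ w in 𝓝 y, F' (F w) = w := (hF'.comp hF).eventually_eq_self hy
  have hFy : F' (F y) = y := hleft.self_of_nhds
  have hright : ∀ᶠ w in 𝓝 (F y), F (F' w) = w :=
    IsMorphismAt.eventually_eq_self (IsMorphismAt.comp (by rwa [hFy]) hF') hF.mem_dom
  obtain ⟨φ, rfl, rfl, hyφ, hsource, htarget⟩ :=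
    exists_openPartialHomeomorph_of_eventually_inverse
      (hF.eventually.mono fun w hw => hw.analyticAt.continuousAt)
      (hF'.eventually.mono fun w hw => hw.analyticAt.continuousAt) hleft hright
      (hF.eventually.and ((G.isOpen_dom i).mem_nhds hy))
      (hF'.eventually.and ((G.isOpen_dom j).mem_nhds hF.mem_dom))
  refine (mk_eq_mk G).2 ⟨φ, ⟨mem_contDiffGroupoid_of_contDiffOn ?_ ?_, fun w hw => (hsource hw).2,
    fun w hw => (htarget hw).2, fun w hw => (hsource hw).1.base_eq.self_of_nhds,
    fun w hw => (hsource hw).1.fib_eq.self_of_nhds⟩, hyφ, rfl⟩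
  · exact fun w hw => (hsource hw).1.analyticAt.contDiffAt.contDiffWithinAt
  · exact fun w hw => (htarget hw).1.analyticAt.contDiffAt.contDiffWithinAt

/-- The coordinates of the patch `i` as a chart of the glued manifold; the point `x₀` only serves as
a default value. -/
def patchChart (i : G.ι) (x₀ : G.Glued) : OpenPartialHomeomorph G.Glued (κ → ℂ) :=
  (core G).openPartialHomeomorph (chart G i x₀) ⟨(i, x₀), rfl⟩

variable {i : G.ι} {x₀ : G.Glued}

@[simp] theorem patchChart_mk (y : G.dom i) : patchChart G i x₀ (mk G i y) = y := chart_mk G y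

theorem patchChart_symm {y : κ → ℂ} (hy : y ∈ G.dom i) :
    (patchChart G i x₀).symm y = mk G i ⟨y, hy⟩ := chart_symm G hy

theorem mk_mem_patchChart_source (y : G.dom i) : mk G i y ∈ (patchChart G i x₀).source :=
  mem_range_self y

theorem isCoordinateChart_patchChart : IsCoordinateChart κ (patchChart G i x₀) := by
  refine IsManifold.subset_maximalAtlas (I := 𝓘(ℂ, κ → ℂ)) (n := ω) ?_
  change patchChart G i x₀ ∈ ⋃ (c : PartialEquiv _ _) (hc : c ∈ (core G).atlas),
      {(core G).openPartialHomeomorph c hc}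
  simp only [mem_iUnion, mem_singleton_iff]
  exact ⟨chart G i x₀, ⟨(i, x₀), rfl⟩, rfl⟩

theorem tendsto_patchChart (y : G.dom i) :
    Filter.Tendsto (patchChart G i x₀) (𝓝 (mk G i y)) (𝓝 (y : κ → ℂ)) := by
  have hc := (patchChart G i x₀).continuousAt (mk_mem_patchChart_source G y)
  rwa [ContinuousAt, patchChart_mk] at hc

@[simp] theorem proj_mk (y : G.dom i) : proj G (mk G i y) = G.base i y := rfl

theorem val_mk [Inhabited Y] (y : G.dom i) (h : G.base i y ∉ G.center) :
    val G (mk G i y) = G.fib i y := if_neg h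

theorem eventually_proj_eq (y : G.dom i) :
    ∀ᶠ x in 𝓝 (mk G i y), proj G x = G.base i (patchChart G i x₀ x) := by
  filter_upwards [(patchChart G i x₀).open_source.mem_nhds (mk_mem_patchChart_source G y)]
  rintro _ ⟨z, rfl⟩
  rw [patchChart_mk, proj_mk]

theorem dense_proj_notMem_center : Dense {x : G.Glued | proj G x ∉ G.center} := by
  intro x
  obtain ⟨i, y, rfl⟩ := exists_mk G x
  have hc : ContinuousAt (patchChart G i (mk G i y)).symm y :=
    (patchChart G i (mk G i y)).continuousAt_symm y.2
  have himage := hc.continuousWithinAt.mem_closure_image (G.dense i y.2)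
  rw [patchChart_symm G y.2] at himage
  refine closure_mono ?_ himage
  rintro _ ⟨w, ⟨hw, hwc⟩, rfl⟩
  rw [patchChart_symm G hw]
  exact hwc

end Glued

end PatchFamily

/-! ### Local biholomorphisms and coordinates -/

section Biholomorphism

variable {κ : Type} [Fintype κ]
  {X : Type*} [TopologicalSpace X] [ChartedSpace (κ → ℂ) X]
  {X' : Type*} [TopologicalSpace X'] [ChartedSpace (κ → ℂ) X']

variable (κ) in
/-- `φ` is a biholomorphism from an open subset of `X` onto an open subset of `X'`. -/
def IsBiholomorphic (φ : OpenPartialHomeomorph X X') : Prop :=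
  ContMDiffOn 𝓘(ℂ, κ → ℂ) 𝓘(ℂ, κ → ℂ) ω φ φ.source ∧
    ContMDiffOn 𝓘(ℂ, κ → ℂ) 𝓘(ℂ, κ → ℂ) ω φ.symm φ.target

namespace IsBiholomorphic

variable {φ : OpenPartialHomeomorph X X'}

theorem symm (h : IsBiholomorphic κ φ) : IsBiholomorphic κ φ.symm := ⟨h.2, h.1⟩

theorem trans {X'' : Type*} [TopologicalSpace X''] [ChartedSpace (κ → ℂ) X'']
    {ψ : OpenPartialHomeomorph X' X''} (h : IsBiholomorphic κ φ) (h' : IsBiholomorphic κ ψ) :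
    IsBiholomorphic κ (φ.trans ψ) := by
  constructor
  · rw [OpenPartialHomeomorph.trans_source]
    exact h'.1.comp (h.1.mono inter_subset_left) inter_subset_right
  · rw [OpenPartialHomeomorph.trans_target]
    exact h.2.comp (h'.2.mono inter_subset_left) inter_subset_right

theorem restrOpen (h : IsBiholomorphic κ φ) {s : Set X} (hs : IsOpen s) :
    IsBiholomorphic κ (φ.restrOpen s hs) :=
  ⟨h.1.mono inter_subset_left, h.2.mono inter_subset_left⟩

theorem of_diffeomorph (Φ : X ≃ₘ^ω⟮𝓘(ℂ, κ → ℂ), 𝓘(ℂ, κ → ℂ)⟯ X') :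
    IsBiholomorphic κ Φ.toHomeomorph.toOpenPartialHomeomorph :=
  ⟨Φ.contMDiff.contMDiffOn, Φ.symm.contMDiff.contMDiffOn⟩

theorem mdifferentiableAt (h : IsBiholomorphic κ φ) {x : X} (hx : x ∈ φ.source) :
    MDifferentiableAt 𝓘(ℂ, κ → ℂ) 𝓘(ℂ, κ → ℂ) φ x :=
  (h.1.contMDiffAt (φ.open_source.mem_nhds hx)).mdifferentiableAt (by simp)

end IsBiholomorphic

theorem isCoordinateChart_iff [IsManifold 𝓘(ℂ, κ → ℂ) ω X]
    {e : OpenPartialHomeomorph X (κ → ℂ)} : IsCoordinateChart κ e ↔ IsBiholomorphic κ e :=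
  IsManifold.mem_maximalAtlas_iff_contMDiffOn e

section Charts

variable {φ : OpenPartialHomeomorph X X'}

theorem IsBiholomorphic.mfderiv_symm_comp (h : IsBiholomorphic κ φ) {x : X} (hx : x ∈ φ.source) :
    (mfderiv 𝓘(ℂ, κ → ℂ) 𝓘(ℂ, κ → ℂ) φ x).comp
      (mfderiv 𝓘(ℂ, κ → ℂ) 𝓘(ℂ, κ → ℂ) φ.symm (φ x)) = ContinuousLinearMap.id ℂ _ := by
  have hφ : MDifferentiableAt 𝓘(ℂ, κ → ℂ) 𝓘(ℂ, κ → ℂ) φ (φ.symm (φ x)) :=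
    h.mdifferentiableAt (by rwa [φ.left_inv hx])
  have hchain := mfderiv_comp (φ x) hφ (h.symm.mdifferentiableAt (φ.map_source hx))
  have hid : mfderiv 𝓘(ℂ, κ → ℂ) 𝓘(ℂ, κ → ℂ) (φ ∘ φ.symm) (φ x) =
      mfderiv 𝓘(ℂ, κ → ℂ) 𝓘(ℂ, κ → ℂ) id (φ x) := by
    refine Filter.EventuallyEq.mfderiv_eq ?_
    filter_upwards [φ.open_target.mem_nhds (φ.map_source hx)] with z hz
    exact φ.right_inv hz
  rw [hid, mfderiv_id, φ.left_inv hx] at hchain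
  exact hchain.symm

variable [IsManifold 𝓘(ℂ, κ → ℂ) ω X']

theorem IsBiholomorphic.mfderiv_trans (h : IsBiholomorphic κ φ)
    {e : OpenPartialHomeomorph X' (κ → ℂ)} (he : IsCoordinateChart κ e) {x : X}
    (hx : x ∈ φ.source) (hx' : φ x ∈ e.source) :
    mfderiv 𝓘(ℂ, κ → ℂ) 𝓘(ℂ, κ → ℂ) (φ.trans e) x =
      (mfderiv 𝓘(ℂ, κ → ℂ) 𝓘(ℂ, κ → ℂ) e (φ x)).comp
        (mfderiv 𝓘(ℂ, κ → ℂ) 𝓘(ℂ, κ → ℂ) φ x) := by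
  rw [OpenPartialHomeomorph.coe_trans]
  exact mfderiv_comp x ((isCoordinateChart_iff.1 he).mdifferentiableAt hx') (h.mdifferentiableAt hx)

theorem IsBiholomorphic.logCovector_trans (h : IsBiholomorphic κ φ)
    {e : OpenPartialHomeomorph X' (κ → ℂ)} (he : IsCoordinateChart κ e) {x : X}
    (hx : x ∈ φ.source) (hx' : φ x ∈ e.source) (K : Finset κ) (a : κ → ℂ) :
    logCovector (φ.trans e) K a x = (logCovector e K a (φ x)).comp
        (mfderiv 𝓘(ℂ, κ → ℂ) 𝓘(ℂ, κ → ℂ) φ x) := by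
  unfold logCovector
  rw [h.mfderiv_trans he hx hx']
  rfl

variable [IsManifold 𝓘(ℂ, κ → ℂ) ω X]

theorem IsBiholomorphic.isCoordinateChart_trans (h : IsBiholomorphic κ φ)
    {e : OpenPartialHomeomorph X' (κ → ℂ)} (he : IsCoordinateChart κ e) :
    IsCoordinateChart κ (φ.trans e) :=
  isCoordinateChart_iff.2 (h.trans (isCoordinateChart_iff.1 he))

theorem IsBiholomorphic.isConormalCovector_comp (h : IsBiholomorphic κ φ) {x : X}
    (hx : x ∈ φ.source) {S : Set X} {S' : Set X'} (hS : ∀ z ∈ φ.source, z ∈ S ↔ φ z ∈ S')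
    {β : TangentSpace 𝓘(ℂ, κ → ℂ) (φ x) →L[ℂ] ℂ} (hβ : IsConormalCovector κ S' (φ x) β) :
    IsConormalCovector κ S x (β.comp (mfderiv 𝓘(ℂ, κ → ℂ) 𝓘(ℂ, κ → ℂ) φ x)) := by
  obtain ⟨hmem, e, J, he, hxe, hJ, hker⟩ := hβ
  refine ⟨(hS x hx).2 hmem, φ.trans e, J, h.isCoordinateChart_trans he, ⟨hx, hxe⟩, ?_, ?_⟩
  · rintro z ⟨hz, hz'⟩
    rw [hS z hz]
    exact hJ _ hz'
  · intro v hv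
    refine hker _ fun i hi => ?_
    have hvi := hv i hi
    rw [h.mfderiv_trans he hx hxe] at hvi
    exact hvi

theorem IsBiholomorphic.isConormalCovector_comp_iff (h : IsBiholomorphic κ φ) {x : X}
    (hx : x ∈ φ.source) {S : Set X} {S' : Set X'} (hS : ∀ z ∈ φ.source, z ∈ S ↔ φ z ∈ S')
    {β : TangentSpace 𝓘(ℂ, κ → ℂ) (φ x) →L[ℂ] ℂ} :
    IsConormalCovector κ S x (β.comp (mfderiv 𝓘(ℂ, κ → ℂ) 𝓘(ℂ, κ → ℂ) φ x)) ↔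
      IsConormalCovector κ S' (φ x) β := by
  refine ⟨fun hα => ?_, h.isConormalCovector_comp hx hS⟩
  have htransport : ∀ w, w = x → IsConormalCovector κ S w
      (ContinuousLinearMap.comp (M₂ := κ → ℂ) β
        (mfderiv 𝓘(ℂ, κ → ℂ) 𝓘(ℂ, κ → ℂ) φ x : (κ → ℂ) →L[ℂ] (κ → ℂ))) := by
    rintro w rfl
    exact hα
  have hS' : ∀ z ∈ φ.symm.source, z ∈ S' ↔ φ.symm z ∈ S := fun z hz => by
    rw [hS _ (φ.map_target hz), φ.right_inv hz]
  have hsymm := h.symm.isConormalCovector_comp (φ.map_source hx) hS'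
    (htransport _ (φ.left_inv hx))
  convert hsymm using 1
  ext v
  exact congrArg β (DFunLike.congr_fun (h.mfderiv_symm_comp hx) v).symm

theorem IsNormalCrossings.preimage_diffeomorph (Φ : X ≃ₘ^ω⟮𝓘(ℂ, κ → ℂ), 𝓘(ℂ, κ → ℂ)⟯ X')
    {N : Set X'} (hN : IsNormalCrossings κ N) : IsNormalCrossings κ (Φ ⁻¹' N) := by
  intro o
  obtain ⟨e, K, he, ho, h0, hK⟩ := hN (Φ o)
  refine ⟨Φ.toHomeomorph.toOpenPartialHomeomorph.trans e, K,
    (IsBiholomorphic.of_diffeomorph Φ).isCoordinateChart_trans he, ⟨trivial, ho⟩, h0, ?_⟩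
  rintro z ⟨-, hz⟩
  exact hK _ hz

theorem IsLogSymplecticPotential.pullback (Φ : X ≃ₘ^ω⟮𝓘(ℂ, κ → ℂ), 𝓘(ℂ, κ → ℂ)⟯ X')
    {N : Set X'} {θ : ∀ x : X', TangentSpace 𝓘(ℂ, κ → ℂ) x →L[ℂ] ℂ}
    (h : IsLogSymplecticPotential κ N θ) {θ' : ∀ x : X, TangentSpace 𝓘(ℂ, κ → ℂ) x →L[ℂ] ℂ}
    (hθ : ∀ x, Φ x ∉ N → θ' x = pullbackForm κ κ Φ θ x) :
    IsLogSymplecticPotential κ (Φ ⁻¹' N) θ' := by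
  refine ⟨IsNormalCrossings.preimage_diffeomorph Φ h.1, fun o => ?_⟩
  obtain ⟨e, K, a, he, ho, hK, ha, hc, hd⟩ := h.2 (Φ o)
  have hb := IsBiholomorphic.of_diffeomorph Φ
  refine ⟨Φ.toHomeomorph.toOpenPartialHomeomorph.trans e, K, a, hb.isCoordinateChart_trans he,
    ⟨trivial, ho⟩, ?_, ?_, ?_, ?_⟩
  · rintro z ⟨-, hz⟩
    exact hK _ hz
  · intro i z hz
    exact ha i z hz.1
  · rintro x ⟨hx0, hx⟩ hxN
    rw [hb.logCovector_trans he hx0 hx, hθ x hxN, pullbackForm, hc (Φ x) hx hxN]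
    rfl
  · intro u hu
    exact hd u hu.1

theorem IsCoordinateChart.analyticAt_comp_symm {e e' : OpenPartialHomeomorph X (κ → ℂ)}
    (he : IsCoordinateChart κ e) (he' : IsCoordinateChart κ e') {u : κ → ℂ} (hu : u ∈ e.target)
    (hu' : e.symm u ∈ e'.source) : AnalyticAt ℂ (fun w => e' (e.symm w)) u := by
  rw [isCoordinateChart_iff] at he he'
  exact (contMDiffAt_iff_contDiffAt.1 ((he.symm.trans he').1.contMDiffAt
    ((e.symm.trans e').open_source.mem_nhds ⟨hu, hu'⟩))).analyticAt

theorem IsCoordinateChart.analyticAt_comp_symm_of_contMDiffAt {e : OpenPartialHomeomorph X (κ → ℂ)}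
    (he : IsCoordinateChart κ e) {u : κ → ℂ} (hu : u ∈ e.target) {f : X → ℂ}
    (hf : ContMDiffAt 𝓘(ℂ, κ → ℂ) 𝓘(ℂ, ℂ) ω f (e.symm u)) :
    AnalyticAt ℂ (fun w => f (e.symm w)) u := by
  rw [isCoordinateChart_iff] at he
  exact (contMDiffAt_iff_contDiffAt.1
    (hf.comp u (he.2.contMDiffAt (e.open_target.mem_nhds hu)))).analyticAt

theorem IsCoordinateChart.mfderiv_eq_fderiv_comp {e e' : OpenPartialHomeomorph X (κ → ℂ)}
    (he : IsCoordinateChart κ e) (he' : IsCoordinateChart κ e') {x : X} (hx : x ∈ e.source)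
    (hx' : x ∈ e'.source) :
    mfderiv 𝓘(ℂ, κ → ℂ) 𝓘(ℂ, κ → ℂ) e' x =
      (fderiv ℂ (fun w => e' (e.symm w)) (e x)).comp
        (mfderiv 𝓘(ℂ, κ → ℂ) 𝓘(ℂ, κ → ℂ) e x) := by
  have ha := he.analyticAt_comp_symm he' (e.map_source hx) (by rwa [e.left_inv hx])
  have hfactor : mfderiv 𝓘(ℂ, κ → ℂ) 𝓘(ℂ, κ → ℂ) e' x =
      mfderiv 𝓘(ℂ, κ → ℂ) 𝓘(ℂ, κ → ℂ) ((fun w => e' (e.symm w)) ∘ e) x := by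
    refine Filter.EventuallyEq.mfderiv_eq ?_
    filter_upwards [e.open_source.mem_nhds hx] with z hz
    simp [e.left_inv hz]
  rw [hfactor, ← mfderiv_eq_fderiv]
  exact mfderiv_comp x ha.differentiableAt.mdifferentiableAt
    ((isCoordinateChart_iff.1 he).mdifferentiableAt hx)

theorem IsCoordinateChart.exists_centered {e : OpenPartialHomeomorph X (κ → ℂ)}
    (he : IsCoordinateChart κ e) {o : X} (ho : o ∈ e.source) {W : Set X} (hW : W ∈ 𝓝 o) :
    ∃ e' : OpenPartialHomeomorph X (κ → ℂ), IsCoordinateChart κ e' ∧ o ∈ e'.source ∧ e' o = 0 ∧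
      e'.source ⊆ e.source ∩ W ∧ (∀ x i, e' x i = e x i - e o i) ∧
      ∀ x ∈ e'.source, ∀ i, e o i ≠ 0 → e x i ≠ 0 := by
  have hev : ∀ᶠ x in 𝓝 o, ∀ i, e o i ≠ 0 → e x i ≠ 0 := by
    rw [Filter.eventually_all]
    intro i
    by_cases hi : e o i = 0
    · simp [hi]
    · have hc : ContinuousAt (fun x => e x i) o :=
        (continuous_apply i).continuousAt.comp (e.continuousAt ho)
      filter_upwards [hc.eventually_ne hi] with x hx _ using hx
  obtain ⟨V, hV, hVo, hoV⟩ := eventually_nhds_iff.1 (hev.and hW)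
  let T : OpenPartialHomeomorph (κ → ℂ) (κ → ℂ) :=
    (Homeomorph.subRight (e o)).toOpenPartialHomeomorph
  have hT : IsBiholomorphic κ T :=
    ⟨(contMDiff_iff_contDiff.2 (contDiff_id.sub contDiff_const)).contMDiffOn,
      (contMDiff_iff_contDiff.2 (contDiff_id.add contDiff_const)).contMDiffOn⟩
  refine ⟨(e.restrOpen V hVo).trans T,
    isCoordinateChart_iff.2 (((isCoordinateChart_iff.1 he).restrOpen hVo).trans hT),
    ⟨⟨ho, hoV⟩, trivial⟩, ?_, fun x hx => ⟨hx.1.1, (hV x hx.1.2).2⟩, fun x i => rfl,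
    fun x hx => (hV x hx.1.2).1⟩
  exact sub_self (e o)

theorem IsCoordinateDivisor.exists_centered {e : OpenPartialHomeomorph X (κ → ℂ)}
    (he : IsCoordinateChart κ e) {K : Finset κ} {N : Set X} (hK : IsCoordinateDivisor e K N) {o : X}
    (ho : o ∈ e.source) {W : Set X} (hW : W ∈ 𝓝 o) :
    ∃ e' : OpenPartialHomeomorph X (κ → ℂ), ∃ K' ⊆ K, IsCoordinateChart κ e' ∧ o ∈ e'.source ∧
      e' o = 0 ∧ e'.source ⊆ e.source ∩ W ∧ IsCoordinateDivisor e' K' N ∧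
      (∀ i ∈ K, e o i = 0 → i ∈ K') ∧ ∀ x i, e o i = 0 → e' x i = e x i := by
  classical
  obtain ⟨e', he', ho', h0, hsub, hval, hne⟩ := he.exists_centered ho hW
  refine ⟨e', K.filter fun i => e o i = 0, Finset.filter_subset _ _, he', ho', h0, hsub,
    fun x hx => ?_, fun i hi h => Finset.mem_filter.2 ⟨hi, h⟩,
    fun x i hi => by rw [hval, hi, sub_zero]⟩
  rw [hK x (hsub hx).1, Finset.prod_eq_zero_iff, Finset.prod_eq_zero_iff]
  constructor
  · rintro ⟨i, hi, h⟩
    have hoi : e o i = 0 := by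
      by_contra h'
      exact hne x hx i h' h
    exact ⟨i, Finset.mem_filter.2 ⟨hi, hoi⟩, by rw [hval, h, hoi, sub_zero]⟩
  · rintro ⟨i, hi, h⟩
    rw [Finset.mem_filter] at hi
    exact ⟨i, hi.1, by rwa [hval, hi.2, sub_zero] at h⟩

end Charts

end Biholomorphism

theorem PatchFamily.Glued.contMDiff_proj {κ κ' : Type} [Fintype κ] [Fintype κ'] {B Y : Type*}
    [TopologicalSpace B] [ChartedSpace (κ' → ℂ) B] {G : PatchFamily κ B Y}
    (hG : ∀ i, ∀ y ∈ G.dom i, ContMDiffAt 𝓘(ℂ, κ → ℂ) 𝓘(ℂ, κ' → ℂ) ω (G.base i) y) :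
    ContMDiff 𝓘(ℂ, κ → ℂ) 𝓘(ℂ, κ' → ℂ) ω (proj G) := by
  intro x
  obtain ⟨i, y, rfl⟩ := exists_mk G x
  let e := patchChart G i (mk G i y)
  have he : ContMDiffAt 𝓘(ℂ, κ → ℂ) 𝓘(ℂ, κ → ℂ) ω e (mk G i y) :=
    (isCoordinateChart_iff.1 (isCoordinateChart_patchChart G)).1.contMDiffAt
      (e.open_source.mem_nhds (mk_mem_patchChart_source G y))
  have hbase : ContMDiffAt 𝓘(ℂ, κ → ℂ) 𝓘(ℂ, κ' → ℂ) ω (G.base i) (e (mk G i y)) := by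
    rw [patchChart_mk]
    exact hG i y y.2
  exact (hbase.comp _ he).congr_of_eventuallyEq (eventually_proj_eq G y)

/-! ### Coordinates of blow ups -/

theorem exists_eventually_norm_le_mul_sum_coord {𝕜 κ F : Type*} [NontriviallyNormedField 𝕜]
    [Finite κ] [NormedAddCommGroup F] [NormedSpace 𝕜 F] {f : (κ → 𝕜) → F}
    {f' : (κ → 𝕜) →L[𝕜] F} {a : κ → 𝕜} (hf : HasStrictFDerivAt f f' a) {J : Finset κ}
    (ha : ∀ k ∈ J, a k = 0) (h0 : ∀ᶠ v in 𝓝 a, (∀ k ∈ J, v k = 0) → f v = 0) :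
    ∃ C : ℝ, ∀ᶠ v in 𝓝 a, ‖f v‖ ≤ C * ∑ k ∈ J, ‖v k‖ := by
  classical
  cases nonempty_fintype κ
  obtain ⟨C, s, hs, hlip⟩ := hf.exists_lipschitzOnWith
  let Z : (κ → 𝕜) → (κ → 𝕜) := fun v k => if k ∈ J then 0 else v k
  have hZa : Z a = a := funext fun k => by
    by_cases hk : k ∈ J <;> simp [Z, hk, ha]
  have hZc : Continuous Z := continuous_pi fun k => by
    by_cases hk : k ∈ J <;> simp only [Z, hk, if_true, if_false] <;> fun_prop
  have hZ : Filter.Tendsto Z (𝓝 a) (𝓝 a) := by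
    simpa only [hZa] using hZc.tendsto a
  refine ⟨C, ?_⟩
  filter_upwards [hs, hZ.eventually hs, hZ.eventually h0] with v hv hZv hZv0
  have hdist : dist v (Z v) ≤ ∑ k ∈ J, ‖v k‖ := by
    refine (dist_pi_le_iff (by positivity)).2 fun k => ?_
    by_cases hk : k ∈ J
    · simpa [Z, hk] using
        Finset.single_le_sum (f := fun k => ‖v k‖) (fun _ _ => norm_nonneg _) hk
    · simp only [Z, hk, if_false, dist_self]
      positivity
  calc ‖f v‖ = dist (f v) (f (Z v)) := by
        rw [hZv0 fun k hk => by simp [Z, hk], dist_zero_right]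
    _ ≤ C * dist v (Z v) := hlip.dist_le_mul _ hv _ hZv
    _ ≤ C * ∑ k ∈ J, ‖v k‖ := by gcongr

theorem frequently_coord_ne_zero {κ : Type} [Finite κ] (j : κ) (y : κ → ℂ) :
    ∃ᶠ w in 𝓝 y, w j ≠ 0 := by
  cases nonempty_fintype κ
  have hcl := subset_closure_inter_ne_zero κ isOpen_univ {j} (mem_univ y)
  exact (mem_closure_iff_frequently.1 hcl).mono fun w hw => hw.2 j (Finset.mem_singleton_self j)

@[simp] theorem blowDown_self {κ : Type} (J : Finset κ) (j : κ) (y : κ → ℂ) :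
    blowDown κ J j y j = y j := by
  simp [blowDown]

theorem blowDown_of_mem {κ : Type} {J : Finset κ} {i j : κ} {y : κ → ℂ} (hi : i ∈ J) (hij : i ≠ j) :
    blowDown κ J j y i = y i * y j := if_pos ⟨hi, hij⟩

theorem blowDown_of_not {κ : Type} {J : Finset κ} {i j : κ} {y : κ → ℂ} (hi : ¬ (i ∈ J ∧ i ≠ j)) :
    blowDown κ J j y i = y i := if_neg hi

section ExceptionalQuotient

variable {κ : Type} [Fintype κ] {M : Type*} [TopologicalSpace M]
  {e e' : OpenPartialHomeomorph M (κ → ℂ)} {J J' : Finset κ} {j j' : κ}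

/-- Near the point `y` of the affine patch with index `j` of the coordinates `e`, the function `u k`
is the quotient of the `k`-th coordinate of `e'` by the equation `y_j` of the exceptional divisor.
The value of `u k` at `y` is a homogeneous coordinate of the fibre of the blow up. -/
def IsExceptionalQuotient (e : OpenPartialHomeomorph M (κ → ℂ)) (J : Finset κ) (j : κ)
    (e' : OpenPartialHomeomorph M (κ → ℂ)) (J' : Finset κ) (y : κ → ℂ)
    (u : κ → (κ → ℂ) → ℂ) : Prop :=
  ∀ k ∈ J', AnalyticAt ℂ (u k) y ∧
    ∀ᶠ w in 𝓝 y, e' (e.symm (blowDown κ J j w)) k = w j * u k w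

theorem IsExceptionalQuotient.mul_eq_one_of_frequently {α : Type*} {l : Filter α} {f g : α → κ → ℂ}
    (hj : j ∈ J) (hj' : j' ∈ J') {y z : κ → ℂ} (hy : blowDown κ J j y ∈ e.target)
    (hz : blowDown κ J' j' z ∈ e'.target) {u u' : κ → (κ → ℂ) → ℂ}
    (hu : IsExceptionalQuotient e J j e' J' y u) (hu' : IsExceptionalQuotient e' J' j' e J z u')
    (hf : Filter.Tendsto f l (𝓝 y)) (hg : Filter.Tendsto g l (𝓝 z))
    (hfg : ∃ᶠ q in l, e.symm (blowDown κ J j (f q)) = e'.symm (blowDown κ J' j' (g q)) ∧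
      f q j ≠ 0) : u j' y * u' j z = 1 := by
  have hlim : Filter.Tendsto (fun q => u j' (f q) * u' j (g q)) l (𝓝 (u j' y * u' j z)) :=
    ((hu j' hj').1.continuousAt.tendsto.comp hf).mul ((hu' j hj).1.continuousAt.tendsto.comp hg)
  have hft : ∀ᶠ q in l, blowDown κ J j (f q) ∈ e.target := hf.eventually
    ((continuous_blowDown κ J j).continuousAt.eventually (e.open_target.mem_nhds hy))
  have hgt : ∀ᶠ q in l, blowDown κ J' j' (g q) ∈ e'.target := hg.eventually
    ((continuous_blowDown κ J' j').continuousAt.eventually (e'.open_target.mem_nhds hz))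
  refine tendsto_nhds_unique_of_frequently_eq hlim tendsto_const_nhds ?_
  refine (hfg.and_eventually ((hf.eventually (hu j' hj').2).and
    ((hg.eventually (hu' j hj).2).and (hft.and hgt)))).mono ?_
  rintro q ⟨⟨hb, hqj⟩, hq, hq', hqt, hqt'⟩
  rw [hb, e'.right_inv hqt', blowDown_self] at hq
  rw [← hb, e.right_inv hqt, blowDown_self, hq] at hq'
  apply mul_left_cancel₀ hqj
  rw [← mul_assoc, ← hq', mul_one]

end ExceptionalQuotient

section BlowUpCoordinates

variable {κ : Type} [Fintype κ] {M : Type*} [TopologicalSpace M] [ChartedSpace (κ → ℂ) M]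
  {L : Set M}

theorem analyticAt_coord (i : κ) (y : κ → ℂ) : AnalyticAt ℂ (fun w : κ → ℂ => w i) y :=
  (ContinuousLinearMap.proj i : (κ → ℂ) →L[ℂ] ℂ).analyticAt y

theorem analyticAt_blowDown (J : Finset κ) (j : κ) (y : κ → ℂ) :
    AnalyticAt ℂ (blowDown κ J j) y := by
  rw [analyticAt_pi_iff]
  intro i
  unfold blowDown
  split_ifs
  · exact (analyticAt_coord i y).mul (analyticAt_coord j y)
  · exact analyticAt_coord i y

namespace BlowUpPatch

theorem isChart (P : BlowUpPatch (κ := κ) L) : IsCoordinateChart κ P.chart := by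
  cases P <;> assumption

theorem analyticAt_toCoord (P : BlowUpPatch (κ := κ) L) (y : κ → ℂ) :
    AnalyticAt ℂ P.toCoord y := by
  cases P with
  | off e he hL => exact analyticAt_id
  | along e he J hL j hj => exact analyticAt_blowDown J j y

open Classical in
/-- The inverse of `toCoord` off the exceptional divisor, where no denominator vanishes. -/
def ofCoord : BlowUpPatch (κ := κ) L → (κ → ℂ) → (κ → ℂ)
  | off _ _ _ => id
  | along _ _ J _ j _ => fun x i => if i ∈ J ∧ i ≠ j then x i / x j else x i

section OffCenter

variable (P : BlowUpPatch (κ := κ) L) {y : κ → ℂ}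

theorem ofCoord_toCoord (hy : P.toCoord y ∈ P.chart.target)
    (hyL : P.chart.symm (P.toCoord y) ∉ L) : P.ofCoord (P.toCoord y) = y := by
  cases P with
  | off e he hL => rfl
  | along e he J hL j hj =>
    have hyj : y j ≠ 0 := fun h => hyL ((along_mem_iff hL hj hy).2 h)
    funext i
    by_cases hi : i ∈ J ∧ i ≠ j
    · simp [ofCoord, toCoord, blowDown, hi, hyj]
    · simp only [ofCoord, toCoord, blowDown, if_neg hi]

theorem analyticAt_ofCoord (hy : P.toCoord y ∈ P.chart.target)
    (hyL : P.chart.symm (P.toCoord y) ∉ L) : AnalyticAt ℂ P.ofCoord (P.toCoord y) := by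
  cases P with
  | off e he hL => exact analyticAt_id
  | along e he J hL j hj =>
    have hyj : y j ≠ 0 := fun h => hyL ((along_mem_iff hL hj hy).2 h)
    rw [analyticAt_pi_iff]
    intro i
    by_cases hi : i ∈ J ∧ i ≠ j
    · simp only [ofCoord, if_pos hi]
      exact (analyticAt_coord i _).div (analyticAt_coord j _) (by simpa [toCoord] using hyj)
    · simp only [ofCoord, if_neg hi]
      exact analyticAt_coord i _

theorem eventually_toCoord_ofCoord (hy : P.toCoord y ∈ P.chart.target)
    (hyL : P.chart.symm (P.toCoord y) ∉ L) :
    ∀ᶠ x in 𝓝 (P.toCoord y), P.toCoord (P.ofCoord x) = x := by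
  cases P with
  | off e he hL => exact .of_forall fun _ => rfl
  | along e he J hL j hj =>
    have hyj : y j ≠ 0 := fun h => hyL ((along_mem_iff hL hj hy).2 h)
    have hc : ContinuousAt (fun x : κ → ℂ => x j) (blowDown κ J j y) :=
      (continuous_apply j).continuousAt
    filter_upwards [hc.eventually_ne (by simpa using hyj)] with x hx
    funext i
    by_cases hi : i ∈ J ∧ i ≠ j
    · simp [toCoord, ofCoord, blowDown, hi, hx]
    · simp only [toCoord, ofCoord, blowDown, if_neg hi]

end OffCenter

theorem eventually_base_mem (P : BlowUpPatch (κ := κ) L) {y : κ → ℂ}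
    (hy : P.toCoord y ∈ P.chart.target) {s : Set M} (hs : s ∈ 𝓝 (P.chart.symm (P.toCoord y))) :
    ∀ᶠ w in 𝓝 y, P.toCoord w ∈ P.chart.target ∧ P.chart.symm (P.toCoord w) ∈ s := by
  have hbase : ContinuousAt (fun w => P.chart.symm (P.toCoord w)) y :=
    (P.chart.continuousAt_symm hy).comp' P.continuous_toCoord.continuousAt
  exact (P.isOpen_dom.eventually_mem hy).and (hbase.eventually hs)

variable [IsManifold 𝓘(ℂ, κ → ℂ) ω M]

theorem analyticAt_chart_base (P : BlowUpPatch (κ := κ) L) {y : κ → ℂ}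
    (hy : P.toCoord y ∈ P.chart.target) {e' : OpenPartialHomeomorph M (κ → ℂ)}
    (he' : IsCoordinateChart κ e') (hb : P.chart.symm (P.toCoord y) ∈ e'.source) :
    AnalyticAt ℂ (fun w => e' (P.chart.symm (P.toCoord w))) y :=
  (P.isChart.analyticAt_comp_symm he' hy hb).fun_comp (P.analyticAt_toCoord y)

theorem exists_isMorphismAt_of_notMem (P P' : BlowUpPatch (κ := κ) L) {y y' : κ → ℂ}
    (hy : P.toCoord y ∈ P.chart.target) (hy' : P'.toCoord y' ∈ P'.chart.target)
    (hb : P.chart.symm (P.toCoord y) = P'.chart.symm (P'.toCoord y'))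
    (hL : P'.chart.symm (P'.toCoord y') ∉ L) :
    ∃ F, (blowUpPatches κ L).IsMorphismAt P P' F y ∧ F y = y' := by
  have hbs : P.chart.symm (P.toCoord y) ∈ P'.chart.source := by
    rw [hb]
    exact P'.chart.map_target hy'
  have hval : P'.chart (P.chart.symm (P.toCoord y)) = P'.toCoord y' := by
    rw [hb, P'.chart.right_inv hy']
  have hanalytic := P.analyticAt_chart_base hy P'.isChart hbs
  have htendsto := hanalytic.continuousAt.tendsto
  rw [hval] at htendsto
  have hFy : P'.ofCoord (P'.chart (P.chart.symm (P.toCoord y))) = y' := by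
    rw [hval, P'.ofCoord_toCoord hy' hL]
  refine ⟨fun w => P'.ofCoord (P'.chart (P.chart.symm (P.toCoord w))),
    ⟨AnalyticAt.fun_comp (by rw [hval]; exact P'.analyticAt_ofCoord hy' hL) hanalytic,
      by rw [hFy]; exact hy', ?_, .of_forall fun _ _ => rfl⟩, hFy⟩
  filter_upwards [htendsto.eventually (P'.eventually_toCoord_ofCoord hy' hL),
    P.eventually_base_mem hy (P'.chart.open_source.mem_nhds hbs)] with w hw hws
  exact (congrArg P'.chart.symm hw).trans (P'.chart.left_inv hws.2)

end BlowUpPatch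

variable [IsManifold 𝓘(ℂ, κ → ℂ) ω M]

open PatchFamily

theorem BlowUp.mk_eq_mk_of_notMem {P P' : BlowUpPatch (κ := κ) L}
    (y : (blowUpPatches κ L).dom P) (y' : (blowUpPatches κ L).dom P')
    (hb : P.chart.symm (P.toCoord y) = P'.chart.symm (P'.toCoord y'))
    (hL : P.chart.symm (P.toCoord y) ∉ L) :
    Glued.mk (blowUpPatches κ L) P y = Glued.mk (blowUpPatches κ L) P' y' := by
  obtain ⟨F, hF, hFy⟩ := P.exists_isMorphismAt_of_notMem P' y.2 y'.2 hb (hb ▸ hL)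
  obtain ⟨F', hF', -⟩ := P'.exists_isMorphismAt_of_notMem P y'.2 y.2 hb.symm hL
  obtain ⟨y', hy'⟩ := y'
  subst hFy
  exact Glued.mk_eq_mk_of_isMorphismAt _ y.2 hF hF'

theorem BlowUp.eq_of_proj_eq {x x' : BlowUp κ L} (h : BlowUp.proj κ L x = BlowUp.proj κ L x')
    (hL : BlowUp.proj κ L x ∉ L) : x = x' := by
  obtain ⟨P, y, rfl⟩ := Glued.exists_mk _ x
  obtain ⟨P', y', rfl⟩ := Glued.exists_mk _ x'
  exact BlowUp.mk_eq_mk_of_notMem y y' h hL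

section Along

variable {e e' : OpenPartialHomeomorph M (κ → ℂ)} {J J' : Finset κ} {j j' : κ}

theorem exists_isExceptionalQuotient (he : IsCoordinateChart κ e)
    (hL : IsCoordinateSubspace e J L) (hj : j ∈ J) (he' : IsCoordinateChart κ e')
    (hL' : IsCoordinateSubspace e' J' L) {y : κ → ℂ} (hy : blowDown κ J j y ∈ e.target)
    (hyj : y j = 0) (hb : e.symm (blowDown κ J j y) ∈ e'.source) :
    ∃ u, IsExceptionalQuotient e J j e' J' y u := by
  let P : BlowUpPatch (κ := κ) L := .along e he J hL j hj
  have hquotient : ∀ k ∈ J', ∃ u : (κ → ℂ) → ℂ, AnalyticAt ℂ u y ∧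
      ∀ᶠ w in 𝓝 y, e' (e.symm (blowDown κ J j w)) k = w j * u w := fun k hk => by
    refine exists_analyticAt_eq_coord_smul
      (analyticAt_pi_iff.1 (P.analyticAt_chart_base hy he' hb) k) hyj ?_
    filter_upwards [P.eventually_base_mem hy (e'.open_source.mem_nhds hb)] with w hw hwj
    exact (hL' _ hw.2).1 ((BlowUpPatch.along_mem_iff hL hj hw.1).2 hwj) k hk
  choose! u hu using hquotient
  exact ⟨u, hu⟩

namespace IsExceptionalQuotient

/-- The equation `y_j` of the exceptional divisor is one of the coordinates `e`, hence bounded by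
the coordinates `e'` with index in `J'`, since it vanishes on their common zero set `L`. -/
theorem exists_ne_zero (he : IsCoordinateChart κ e) (hL : IsCoordinateSubspace e J L) (hj : j ∈ J)
    (he' : IsCoordinateChart κ e') (hL' : IsCoordinateSubspace e' J' L) {y : κ → ℂ}
    (hy : blowDown κ J j y ∈ e.target) (hyj : y j = 0)
    (hb : e.symm (blowDown κ J j y) ∈ e'.source) {u : κ → (κ → ℂ) → ℂ}
    (hu : IsExceptionalQuotient e J j e' J' y u) : ∃ k ∈ J', u k y ≠ 0 := by
  by_contra! hzero
  let P : BlowUpPatch (κ := κ) L := .along e he J hL j hj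
  have hsource : e'.symm (e' (e.symm (blowDown κ J j y))) ∈ e.source := by
    rw [e'.left_inv hb]
    exact e.map_target hy
  have hvanish : ∀ᶠ v in 𝓝 (e' (e.symm (blowDown κ J j y))),
      (∀ k ∈ J', v k = 0) → e (e'.symm v) j = 0 := by
    filter_upwards [e'.open_target.mem_nhds (e'.map_source hb),
      (e'.continuousAt_symm (e'.map_source hb)).eventually (e.open_source.mem_nhds hsource)]
      with v hvt hvs hv
    refine (hL _ hvs).1 ((hL' _ (e'.map_target hvt)).2 ?_) j hj
    rwa [e'.right_inv hvt]
  have hanalytic := he'.analyticAt_comp_symm he (e'.map_source hb) hsource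
  obtain ⟨C, hC⟩ := exists_eventually_norm_le_mul_sum_coord
    (analyticAt_pi_iff.1 hanalytic j).hasStrictFDerivAt
    ((hL' _ hb).1 ((BlowUpPatch.along_mem_iff hL hj hy).2 hyj)) hvanish
  have hbound : ∀ᶠ w in 𝓝 y, w j ≠ 0 → 1 ≤ C * ∑ k ∈ J', ‖u k w‖ := by
    filter_upwards [(P.analyticAt_chart_base hy he' hb).continuousAt.eventually hC,
      (Filter.eventually_all_finset J').2 fun k hk => (hu k hk).2,
      P.eventually_base_mem hy (e'.open_source.mem_nhds hb)] with w hw hq hmem hwj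
    have hwt : blowDown κ J j w ∈ e.target := hmem.1
    have hws : e.symm (blowDown κ J j w) ∈ e'.source := hmem.2
    refine le_of_mul_le_mul_left ?_ (norm_pos_iff.2 hwj)
    calc ‖w j‖ * 1 = ‖e (e'.symm (e' (e.symm (blowDown κ J j w)))) j‖ := by
          rw [e'.left_inv hws, e.right_inv hwt, blowDown_self, mul_one]
      _ ≤ C * ∑ k ∈ J', ‖e' (e.symm (blowDown κ J j w)) k‖ := hw
      _ = ‖w j‖ * (C * ∑ k ∈ J', ‖u k w‖) := by
          rw [Finset.sum_congr rfl fun k hk => by rw [hq k hk, norm_mul], ← Finset.mul_sum]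
          ring
  have hlim : Filter.Tendsto (fun w => C * ∑ k ∈ J', ‖u k w‖) (𝓝 y) (𝓝 0) := by
    have hsum : C * ∑ k ∈ J', ‖u k y‖ = 0 := by
      rw [Finset.sum_eq_zero fun k hk => by rw [hzero k hk, norm_zero], mul_zero]
    rw [← hsum]
    exact (tendsto_finsetSum _ fun k hk => (hu k hk).1.continuousAt.norm.tendsto).const_mul _
  obtain ⟨w, hwj, hw, hlt⟩ := ((frequently_coord_ne_zero j y).and_eventually
    (hbound.and (hlim.eventually (gt_mem_nhds one_pos)))).exists
  exact (hw hwj).not_gt hlt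

theorem exists_isMorphismAt (he : IsCoordinateChart κ e)
    (hL : IsCoordinateSubspace e J L) (hj : j ∈ J) (he' : IsCoordinateChart κ e')
    (hL' : IsCoordinateSubspace e' J' L) (hj' : j' ∈ J') {y : κ → ℂ}
    (hy : blowDown κ J j y ∈ e.target) (hb : e.symm (blowDown κ J j y) ∈ e'.source)
    {u : κ → (κ → ℂ) → ℂ} (hu : IsExceptionalQuotient e J j e' J' y u) (hne : u j' y ≠ 0) :
    ∃ F, (blowUpPatches κ L).IsMorphismAt (.along e he J hL j hj) (.along e' he' J' hL' j' hj')
      F y := by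
  classical
  let P : BlowUpPatch (κ := κ) L := .along e he J hL j hj
  let F : (κ → ℂ) → (κ → ℂ) := fun w i =>
    if i ∈ J' ∧ i ≠ j' then u i w / u j' w else e' (e.symm (blowDown κ J j w)) i
  have hbase : ∀ᶠ w in 𝓝 y, blowDown κ J' j' (F w) = e' (e.symm (blowDown κ J j w)) := by
    filter_upwards [(Filter.eventually_all_finset J').2 fun k hk => (hu k hk).2,
      (hu j' hj').1.continuousAt.eventually_ne hne] with w hq hw
    funext i
    by_cases hi : i ∈ J' ∧ i ≠ j'
    · have hjj : ¬ (j' ∈ J' ∧ j' ≠ j') := fun h => h.2 rfl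
      rw [blowDown_of_mem hi.1 hi.2]
      simp only [F, if_pos hi, if_neg hjj]
      rw [hq i hi.1, hq j' hj']
      field_simp
    · rw [blowDown_of_not hi]
      simp only [F, if_neg hi]
  refine ⟨F, analyticAt_pi_iff.2 fun i => ?_, ?_, ?_, .of_forall fun _ _ => rfl⟩
  · by_cases hi : i ∈ J' ∧ i ≠ j'
    · simp only [if_pos hi]
      exact (hu i hi.1).1.div (hu j' hj').1 hne
    · simp only [if_neg hi]
      exact analyticAt_pi_iff.1 (P.analyticAt_chart_base hy he' hb) i
  · change blowDown κ J' j' (F y) ∈ e'.target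
    rw [hbase.self_of_nhds]
    exact e'.map_source hb
  · filter_upwards [hbase, P.eventually_base_mem hy (e'.open_source.mem_nhds hb)] with w hw hws
    exact (congrArg e'.symm hw).trans (e'.left_inv hws.2)

theorem exists_mk_eq (he : IsCoordinateChart κ e)
    (hL : IsCoordinateSubspace e J L) (hj : j ∈ J) (he' : IsCoordinateChart κ e')
    (hL' : IsCoordinateSubspace e' J' L) (hj' : j' ∈ J')
    (y : (blowUpPatches κ L).dom (.along e he J hL j hj)) (hyj : y.1 j = 0)
    (hb : e.symm (blowDown κ J j y) ∈ e'.source)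
    {u : κ → (κ → ℂ) → ℂ} (hu : IsExceptionalQuotient e J j e' J' y u) (hne : u j' y ≠ 0) :
    ∃ z : (blowUpPatches κ L).dom (.along e' he' J' hL' j' hj'),
      Glued.mk (blowUpPatches κ L) (.along e he J hL j hj) y =
        Glued.mk (blowUpPatches κ L) (.along e' he' J' hL' j' hj') z := by
  obtain ⟨F, hF⟩ := hu.exists_isMorphismAt he hL hj he' hL' hj' y.2 hb hne
  have hFb : e'.symm (blowDown κ J' j' (F y)) = e.symm (blowDown κ J j y) :=
    hF.base_eq.self_of_nhds
  have hFs : e'.symm (blowDown κ J' j' (F y)) ∈ e.source := by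
    rw [hFb]
    exact e.map_target y.2
  have hFj : F y j' = 0 := (BlowUpPatch.along_mem_iff hL' hj' hF.mem_dom).1 (by
    rw [hFb]
    exact (BlowUpPatch.along_mem_iff hL hj y.2).2 hyj)
  obtain ⟨u', hu'⟩ := exists_isExceptionalQuotient he' hL' hj' he hL hF.mem_dom hFj hFs
  have hmul : u j' y * u' j (F y) = 1 :=
    hu.mul_eq_one_of_frequently hj hj' y.2 hF.mem_dom hu' Filter.tendsto_id
      hF.analyticAt.continuousAt.tendsto
      ((hF.base_eq.and_frequently (frequently_coord_ne_zero j y.1)).mono fun w hw =>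
        ⟨hw.1.symm, hw.2⟩)
  obtain ⟨F', hF'⟩ := hu'.exists_isMorphismAt he' hL' hj' he hL hj hF.mem_dom hFs
    (right_ne_zero_of_mul (hmul ▸ one_ne_zero))
  exact ⟨_, Glued.mk_eq_mk_of_isMorphismAt _ y.2 hF hF'⟩

end IsExceptionalQuotient

end Along

end BlowUpCoordinates

/-! ### The blow up as a manifold -/

theorem frequently_nhds_inf_nhds_mem_of_dense {X : Type*} [TopologicalSpace X] {D : Set X}
    (hD : Dense D) (x x' : X) [(𝓝 x ⊓ 𝓝 x').NeBot] : ∃ᶠ z in 𝓝 x ⊓ 𝓝 x', z ∈ D := by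
  refine Filter.frequently_iff.2 fun hA => ?_
  obtain ⟨⟨U, V⟩, ⟨⟨hxU, hU⟩, hxV, hV⟩, hUV⟩ :=
    ((nhds_basis_opens x).inf (nhds_basis_opens x')).mem_iff.1 hA
  have hne : (U ∩ V).Nonempty := Filter.nonempty_of_mem
    (Filter.inter_mem_inf (hU.mem_nhds hxU) (hV.mem_nhds hxV))
  obtain ⟨z, hz, hzD⟩ := hD.inter_open_nonempty _ (hU.inter hV) hne
  exact ⟨z, hUV hz, hzD⟩

section BlowUpManifold

open PatchFamily

variable {κ : Type} [Fintype κ] {M : Type*} [TopologicalSpace M] [ChartedSpace (κ → ℂ) M]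
  {L : Set M}

theorem BlowUp.dense_proj_notMem : Dense {x : BlowUp κ L | BlowUp.proj κ L x ∉ L} :=
  Glued.dense_proj_notMem_center (blowUpPatches κ L)

namespace BlowUpPatch

variable (P : BlowUpPatch (κ := κ) L)

/-- The point of the blow up with coordinates `y` in the affine patch `P`. -/
def point {y : κ → ℂ} (hy : P.toCoord y ∈ P.chart.target) : BlowUp κ L :=
  Glued.mk (blowUpPatches κ L) P ⟨y, hy⟩

/-- The coordinates of the affine patch `P`; the value of the inverse outside its target is the
arbitrary point `x₀`. -/
def affineChart (x₀ : BlowUp κ L) : OpenPartialHomeomorph (BlowUp κ L) (κ → ℂ) :=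
  Glued.patchChart (blowUpPatches κ L) P x₀

theorem isCoordinateChart_affineChart (x₀ : BlowUp κ L) : IsCoordinateChart κ (P.affineChart x₀) :=
  Glued.isCoordinateChart_patchChart _

variable {P} {x₀ : BlowUp κ L}

theorem proj_point {y : κ → ℂ} (hy : P.toCoord y ∈ P.chart.target) :
    BlowUp.proj κ L (P.point hy) = P.chart.symm (P.toCoord y) := rfl

theorem mem_affineChart_source {x : BlowUp κ L} :
    x ∈ (P.affineChart x₀).source ↔ ∃ (y : κ → ℂ) (hy : P.toCoord y ∈ P.chart.target),
      x = P.point hy := by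
  constructor
  · rintro ⟨y, rfl⟩
    exact ⟨y, y.2, rfl⟩
  · rintro ⟨y, hy, rfl⟩
    exact ⟨⟨y, hy⟩, rfl⟩

theorem affineChart_point {y : κ → ℂ} (hy : P.toCoord y ∈ P.chart.target) :
    P.affineChart x₀ (P.point hy) = y :=
  Glued.patchChart_mk (blowUpPatches κ L) _

theorem affineChart_symm {y : κ → ℂ} (hy : P.toCoord y ∈ P.chart.target) :
    (P.affineChart x₀).symm y = P.point hy :=
  Glued.patchChart_symm (blowUpPatches κ L) hy

theorem point_mem_affineChart_source {y : κ → ℂ} (hy : P.toCoord y ∈ P.chart.target) :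
    P.point hy ∈ (P.affineChart x₀).source := mem_affineChart_source.2 ⟨y, hy, rfl⟩

theorem chart_proj {x : BlowUp κ L} (hx : x ∈ (P.affineChart x₀).source) :
    P.chart (BlowUp.proj κ L x) = P.toCoord (P.affineChart x₀ x) := by
  obtain ⟨y, hy, rfl⟩ := mem_affineChart_source.1 hx
  rw [proj_point, affineChart_point, P.chart.right_inv hy]

theorem proj_mem_source {x : BlowUp κ L} (hx : x ∈ (P.affineChart x₀).source) :
    BlowUp.proj κ L x ∈ P.chart.source := by
  obtain ⟨y, hy, rfl⟩ := mem_affineChart_source.1 hx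
  exact P.chart.map_target hy

theorem proj_eq_symm {x : BlowUp κ L} (hx : x ∈ (P.affineChart x₀).source) :
    BlowUp.proj κ L x = P.chart.symm (P.toCoord (P.affineChart x₀ x)) :=
  (P.chart.left_inv (proj_mem_source hx)).symm.trans (congrArg P.chart.symm (chart_proj hx))

end BlowUpPatch

variable [IsManifold 𝓘(ℂ, κ → ℂ) ω M]

theorem BlowUp.contMDiff_proj :
    ContMDiff 𝓘(ℂ, κ → ℂ) 𝓘(ℂ, κ → ℂ) ω (BlowUp.proj κ L) :=
  Glued.contMDiff_proj (G := blowUpPatches κ L) fun P y hy =>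
    ((isCoordinateChart_iff.1 P.isChart).2.contMDiffAt (P.chart.open_target.mem_nhds hy)).comp y
      (contMDiffAt_iff_contDiffAt.2 (P.analyticAt_toCoord y).contDiffAt)

theorem BlowUp.continuous_proj : Continuous (BlowUp.proj κ L) := BlowUp.contMDiff_proj.continuous

theorem BlowUp.exists_mk_off {x : BlowUp κ L} (hx : BlowUp.proj κ L x ∉ L)
    {e : OpenPartialHomeomorph M (κ → ℂ)} (he : IsCoordinateChart κ e)
    (hxe : BlowUp.proj κ L x ∈ e.source) (hL : Disjoint e.source L) :
    ∃ (y : κ → ℂ) (hy : y ∈ e.target),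
      x = Glued.mk (blowUpPatches κ L) (.off e he hL) ⟨y, hy⟩ := by
  refine ⟨e (BlowUp.proj κ L x), e.map_source hxe, BlowUp.eq_of_proj_eq ?_ hx⟩
  exact (e.left_inv hxe).symm

theorem BlowUp.exists_mk_along {x : BlowUp κ L} (hx : BlowUp.proj κ L x ∈ L)
    {e : OpenPartialHomeomorph M (κ → ℂ)} (he : IsCoordinateChart κ e)
    (hxe : BlowUp.proj κ L x ∈ e.source) {J : Finset κ} (hL : IsCoordinateSubspace e J L) :
    ∃ (j : κ) (hj : j ∈ J) (y : κ → ℂ) (hy : blowDown κ J j y ∈ e.target),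
      x = Glued.mk (blowUpPatches κ L) (.along e he J hL j hj) ⟨y, hy⟩ := by
  obtain ⟨P, y, rfl⟩ := Glued.exists_mk _ x
  cases P with
  | off e' he' hL' => exact absurd hx fun h => hL'.le_bot ⟨e'.map_target y.2, h⟩
  | along e' he' J' hL' j' hj' =>
    have hyj := (BlowUpPatch.along_mem_iff hL' hj' y.2).1 hx
    obtain ⟨u, hu⟩ := exists_isExceptionalQuotient he' hL' hj' he hL y.2 hyj hxe
    obtain ⟨j, hj, hne⟩ := hu.exists_ne_zero he' hL' hj' he hL y.2 hyj hxe
    obtain ⟨z, hz⟩ := hu.exists_mk_eq he' hL' hj' he hL hj y hyj hxe hne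
    exact ⟨j, hj, z, z.2, hz⟩

/-- The coordinates of the points near both `mk y` and `mk z` converge to `y` and to `z`, so the
exceptional quotients at `y` and at `z` are inverse to each other: `z` lies in the range of the
coordinate change from the first patch to the second, and coordinates have unique limits. -/
theorem BlowUp.mk_eq_mk_of_neBot_nhds_inf {e e' : OpenPartialHomeomorph M (κ → ℂ)}
    {J J' : Finset κ} {j j' : κ} (he : IsCoordinateChart κ e) (hL : IsCoordinateSubspace e J L)
    (hj : j ∈ J) (he' : IsCoordinateChart κ e') (hL' : IsCoordinateSubspace e' J' L) (hj' : j' ∈ J')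
    (y : (blowUpPatches κ L).dom (.along e he J hL j hj))
    (z : (blowUpPatches κ L).dom (.along e' he' J' hL' j' hj'))
    (hb : e.symm (blowDown κ J j y) = e'.symm (blowDown κ J' j' z))
    (hmem : e.symm (blowDown κ J j y) ∈ L)
    (hne : (𝓝 (Glued.mk (blowUpPatches κ L) (.along e he J hL j hj) y) ⊓
      𝓝 (Glued.mk (blowUpPatches κ L) (.along e' he' J' hL' j' hj') z)).NeBot) :
    Glued.mk (blowUpPatches κ L) (.along e he J hL j hj) y =
      Glued.mk (blowUpPatches κ L) (.along e' he' J' hL' j' hj') z := by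
  have hyj := (BlowUpPatch.along_mem_iff hL hj y.2).1 hmem
  have hzj := (BlowUpPatch.along_mem_iff hL' hj' z.2).1 (hb ▸ hmem)
  have hbe' : e.symm (blowDown κ J j y) ∈ e'.source := hb ▸ e'.map_target z.2
  have hbe : e'.symm (blowDown κ J' j' z) ∈ e.source := hb ▸ e.map_target y.2
  obtain ⟨u, hu⟩ := exists_isExceptionalQuotient he hL hj he' hL' y.2 hyj hbe'
  obtain ⟨u', hu'⟩ := exists_isExceptionalQuotient he' hL' hj' he hL z.2 hzj hbe
  let x₀ := Glued.mk (blowUpPatches κ L) (.along e he J hL j hj) y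
  let c := Glued.patchChart (blowUpPatches κ L) (.along e he J hL j hj) x₀
  let c' := Glued.patchChart (blowUpPatches κ L) (.along e' he' J' hL' j' hj') x₀
  have hc : Filter.Tendsto c (𝓝 x₀) (𝓝 y.1) := Glued.tendsto_patchChart (blowUpPatches κ L) y
  have hc' := Glued.tendsto_patchChart (blowUpPatches κ L) (x₀ := x₀) z
  have hmul : u j' y * u' j z = 1 := by
    refine hu.mul_eq_one_of_frequently hj hj' y.2 z.2 hu' (hc.mono_left inf_le_left)
      (hc'.mono_left inf_le_right) ?_
    have hnear : ∀ᶠ q in 𝓝 x₀, q ∈ c.source ∧ BlowUp.proj κ L q = e.symm (blowDown κ J j (c q)) :=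
      (c.open_source.eventually_mem (Glued.mk_mem_patchChart_source _ y)).and
        (Glued.eventually_proj_eq (blowUpPatches κ L) y)
    have hnear' := Glued.eventually_proj_eq (blowUpPatches κ L) (x₀ := x₀) z
    refine ((frequently_nhds_inf_nhds_mem_of_dense BlowUp.dense_proj_notMem _ _).and_eventually
      ((hnear.filter_mono inf_le_left).and (hnear'.filter_mono inf_le_right))).mono ?_
    rintro q ⟨hq, ⟨hqs, hqy⟩, hqz⟩
    refine ⟨hqy.symm.trans hqz, fun h0 => hq ?_⟩
    exact hqy ▸ (BlowUpPatch.along_mem_iff hL hj (c.map_source hqs)).2 h0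
  obtain ⟨z', hz'⟩ := hu.exists_mk_eq he hL hj he' hL' hj' y hyj hbe'
    (left_ne_zero_of_mul (hmul ▸ one_ne_zero))
  have hcz : Filter.Tendsto c' (𝓝 x₀) (𝓝 z'.1) := by
    rw [show x₀ = _ from hz']
    exact Glued.tendsto_patchChart (blowUpPatches κ L) z'
  rw [hz', Subtype.ext (tendsto_nhds_unique (hcz.mono_left inf_le_left)
    (hc'.mono_left inf_le_right))]

theorem BlowUp.t2Space [T2Space M] : T2Space (BlowUp κ L) := by
  rw [t2_iff_nhds]
  intro x x' hne
  have hproj : BlowUp.proj κ L x = BlowUp.proj κ L x' :=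
    tendsto_nhds_unique ((BlowUp.continuous_proj.tendsto x).mono_left (inf_le_left (b := 𝓝 x')))
      ((BlowUp.continuous_proj.tendsto x').mono_left inf_le_right)
  by_cases hL : BlowUp.proj κ L x ∈ L
  swap
  · exact BlowUp.eq_of_proj_eq hproj hL
  obtain ⟨P, y, rfl⟩ := Glued.exists_mk _ x
  obtain ⟨P', z, rfl⟩ := Glued.exists_mk _ x'
  cases P with
  | off e he h => exact absurd hL (h.notMem_of_mem_left (e.map_target y.2))
  | along e he J hJ j hj =>
    cases P' with
    | off e' he' h => exact absurd (hproj.subst hL) (h.notMem_of_mem_left (e'.map_target z.2))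
    | along e' he' J' hJ' j' hj' =>
      exact BlowUp.mk_eq_mk_of_neBot_nhds_inf he hJ hj he' hJ' hj' y z hproj hL hne

theorem BlowUp.exists_isBiholomorphic (hLc : IsClosed L) {x : BlowUp κ L}
    (hx : BlowUp.proj κ L x ∉ L) :
    ∃ φ : OpenPartialHomeomorph (BlowUp κ L) M, IsBiholomorphic κ φ ∧ x ∈ φ.source ∧
      (∀ z ∈ φ.source, BlowUp.proj κ L z ∉ L) ∧ ∀ z ∈ φ.source, φ z = BlowUp.proj κ L z := by
  set b := BlowUp.proj κ L x
  let e := (chartAt (κ → ℂ) b).restrOpen Lᶜ hLc.isOpen_compl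
  have he : IsCoordinateChart κ e := isCoordinateChart_iff.2
    ((isCoordinateChart_iff.1 (IsManifold.chart_mem_maximalAtlas b)).restrOpen hLc.isOpen_compl)
  have hbe : b ∈ e.source := ⟨mem_chart_source _ b, hx⟩
  have hd : Disjoint e.source L := Set.disjoint_left.2 fun z hz => hz.2
  obtain ⟨y, hyd, hy⟩ := BlowUp.exists_mk_off hx he hbe hd
  set c := Glued.patchChart (blowUpPatches κ L) (.off e he hd) x
  have hcb : IsBiholomorphic κ c :=
    isCoordinateChart_iff.1 (Glued.isCoordinateChart_patchChart (blowUpPatches κ L))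
  have hval : ∀ z ∈ c.source, c.trans e.symm z = BlowUp.proj κ L z := by
    rintro _ ⟨w, rfl⟩
    exact congrArg e.symm (Glued.patchChart_mk (blowUpPatches κ L) (x₀ := x) w)
  refine ⟨c.trans e.symm, hcb.trans (isCoordinateChart_iff.1 he).symm, ?_, ?_, ?_⟩
  · have hxs : x ∈ c.source := ⟨⟨y, hyd⟩, hy.symm⟩
    exact ⟨hxs, c.map_source hxs⟩
  · rintro z ⟨hz, hz'⟩
    rw [← hval z hz]
    exact fun h => hd.le_bot ⟨e.map_target hz', h⟩
  · rintro z ⟨hz, -⟩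
    exact hval z hz

namespace BlowUpPatch

variable {P : BlowUpPatch (κ := κ) L} {x₀ : BlowUp κ L}

theorem mfderiv_chart_comp_mfderiv_proj {x : BlowUp κ L} (hx : x ∈ (P.affineChart x₀).source) :
    (mfderiv 𝓘(ℂ, κ → ℂ) 𝓘(ℂ, κ → ℂ) P.chart (BlowUp.proj κ L x)).comp
      (mfderiv 𝓘(ℂ, κ → ℂ) 𝓘(ℂ, κ → ℂ) (BlowUp.proj κ L) x) =
    (fderiv ℂ P.toCoord (P.affineChart x₀ x)).comp
      (mfderiv 𝓘(ℂ, κ → ℂ) 𝓘(ℂ, κ → ℂ) (P.affineChart x₀) x) := by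
  have hchart := (isCoordinateChart_iff.1 P.isChart).mdifferentiableAt (proj_mem_source hx)
  have hproj : MDifferentiableAt 𝓘(ℂ, κ → ℂ) 𝓘(ℂ, κ → ℂ) (BlowUp.proj κ L) x :=
    BlowUp.contMDiff_proj.mdifferentiableAt (by simp)
  have haffine :=
    (isCoordinateChart_iff.1 (P.isCoordinateChart_affineChart x₀)).mdifferentiableAt hx
  rw [← mfderiv_comp x hchart hproj]
  have hlocal : (P.chart ∘ BlowUp.proj κ L) =ᶠ[𝓝 x] (P.toCoord ∘ P.affineChart x₀) := by
    filter_upwards [(P.affineChart x₀).open_source.mem_nhds hx] with z hz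
    exact chart_proj hz
  rw [hlocal.mfderiv_eq, ← mfderiv_eq_fderiv]
  exact mfderiv_comp (I' := 𝓘(ℂ, κ → ℂ)) x
    (P.analyticAt_toCoord _).differentiableAt.mdifferentiableAt haffine

end BlowUpPatch

end BlowUpManifold

/-! ### Coordinate changes of logarithmic cotangent bundles -/

theorem mem_closure_coord_eq_zero_and_ne_zero {κ : Type} [Finite κ] (K : Finset κ) {i : κ}
    {w : κ → ℂ} (hw : w i = 0) :
    w ∈ closure {z : κ → ℂ | z i = 0 ∧ ∀ l ∈ K, l ≠ i → z l ≠ 0} := by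
  classical
  cases nonempty_fintype κ
  have hcl := subset_closure_inter_ne_zero κ isOpen_univ (K.erase i) (mem_univ w)
  have hmaps : MapsTo (fun z : κ → ℂ => Function.update z i 0)
      (univ ∩ {z | ∀ l ∈ K.erase i, z l ≠ 0}) {z | z i = 0 ∧ ∀ l ∈ K, l ≠ i → z l ≠ 0} := by
    rintro z ⟨-, hz⟩
    refine ⟨Function.update_self .., fun l hl hli => ?_⟩
    simpa only [Function.update_of_ne hli] using hz l (Finset.mem_erase.2 ⟨hli, hl⟩)
  have hupdate : Function.update w i 0 = w := by rw [← hw, Function.update_eq_self]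
  have hmem := map_mem_closure (continuous_id.update i continuous_const) hcl hmaps
  rwa [id, hupdate] at hmem

theorem continuousLinearMap_apply_eq_sum {𝕜 κ F : Type*} [NontriviallyNormedField 𝕜] [Fintype κ]
    [DecidableEq κ] [NormedAddCommGroup F] [NormedSpace 𝕜 F] (T : (κ → 𝕜) →L[𝕜] F) (v : κ → 𝕜) :
    T v = ∑ k, v k • T (Pi.single k 1) := by
  conv_lhs => rw [pi_eq_sum_univ' v]
  simp only [map_sum, map_smul]

section LogCotangentCoordinates

variable {κ : Type} [Fintype κ] {M : Type*} [TopologicalSpace M] [ChartedSpace (κ → ℂ) M]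

theorem logCovector_apply (e : OpenPartialHomeomorph M (κ → ℂ)) (K : Finset κ) (a : κ → ℂ) (x : M)
    (v : TangentSpace 𝓘(ℂ, κ → ℂ) x) : logCovector e K a x v =
      ∑ i, a i / logDenominator K (e x) i *
        (mfderiv 𝓘(ℂ, κ → ℂ) 𝓘(ℂ, κ → ℂ) e x v : κ → ℂ) i := by
  have hsum : ∀ b V : κ → ℂ, (∑ i, b i • (ContinuousLinearMap.proj i : (κ → ℂ) →L[ℂ] ℂ)) V =
      ∑ i, b i * V i := fun b V => by simp
  exact hsum _ _

theorem analyticAt_logDenominator (K : Finset κ) (i : κ) (u : κ → ℂ) :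
    AnalyticAt ℂ (fun w => logDenominator K w i) u := by
  unfold logDenominator
  by_cases hi : i ∈ K
  · simpa only [if_pos hi] using analyticAt_coord i u
  · simpa only [if_neg hi] using analyticAt_const

namespace LogChart

variable {N : Set M}

theorem logDenominator_ne_zero (c : LogChart (κ := κ) N) {x : M} (hx : x ∈ c.chart.source)
    (hN : x ∉ N) (i : κ) : logDenominator c.poles (c.chart x) i ≠ 0 := by
  unfold logDenominator
  split_ifs with hi
  · exact fun h => hN ((c.divisor x hx).2 (Finset.prod_eq_zero hi h))
  · exact one_ne_zero

theorem eventually_coord_eq_zero_of_mem (c : LogChart (κ := κ) N) {w : κ → ℂ}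
    (hw : w ∈ c.chart.target) {i : κ} (hgen : ∀ l ∈ c.poles, l ≠ i → w l ≠ 0) :
    ∀ᶠ z in 𝓝 w, c.chart.symm z ∈ N → z i = 0 := by
  have hne : ∀ᶠ z in 𝓝 w, ∀ l ∈ c.poles, l ≠ i → z l ≠ 0 := by
    refine (Filter.eventually_all_finset _).2 fun l hl => ?_
    by_cases hli : l = i
    · simp [hli]
    · filter_upwards [(continuous_apply l).continuousAt.eventually_ne (hgen l hl hli)] with z hz _
      exact hz
  filter_upwards [hne, c.chart.open_target.mem_nhds hw] with z hz hzt hzN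
  rw [c.divisor _ (c.chart.map_target hzt), c.chart.right_inv hzt,
    Finset.prod_eq_zero_iff] at hzN
  obtain ⟨l, hl, hzl⟩ := hzN
  by_cases hli : l = i
  · rwa [hli] at hzl
  · exact absurd hzl (hz l hl hli)

variable (c c' : LogChart (κ := κ) N)

/-- The derivative of the `i`-th coordinate of `c` along the `k`-th logarithmic vector field of
`c'`, in the coordinates `c`. -/
def logDerivative (k i : κ) (w : κ → ℂ) : ℂ :=
  logDenominator c'.poles (c'.chart (c.chart.symm w)) k *
    fderiv ℂ (fun v => c.chart (c'.chart.symm v)) (c'.chart (c.chart.symm w)) (by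
      classical exact Pi.single k 1) i

variable [IsManifold 𝓘(ℂ, κ → ℂ) ω M] {c c'}

theorem analyticAt_logDerivative {u : κ → ℂ} (hu : u ∈ c.chart.target)
    (hu' : c.chart.symm u ∈ c'.chart.source) (k i : κ) :
    AnalyticAt ℂ (logDerivative c c' k i) u := by
  classical
  have hchange := c.isChart.analyticAt_comp_symm c'.isChart hu hu'
  have hinverse := c'.isChart.analyticAt_comp_symm c.isChart (c'.chart.map_source hu')
    (by rw [c'.chart.left_inv hu']; exact c.chart.map_target hu)
  have hderiv := AnalyticAt.fun_comp (g := fderiv ℂ fun v => c.chart (c'.chart.symm v))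
    (f := fun w => c'.chart (c.chart.symm w)) hinverse.fderiv hchange
  have hevaluation := ((ContinuousLinearMap.proj i : (κ → ℂ) →L[ℂ] ℂ).comp
    (ContinuousLinearMap.apply ℂ (κ → ℂ) (Pi.single k (1 : ℂ) : κ → ℂ))).analyticAt
      (fderiv ℂ (fun v => c.chart (c'.chart.symm v)) (c'.chart (c.chart.symm u)))
  exact (AnalyticAt.fun_comp (f := fun w => c'.chart (c.chart.symm w))
    (analyticAt_logDenominator c'.poles k _) hchange).mul (AnalyticAt.fun_comp (f := fun w =>
      fderiv ℂ (fun v => c.chart (c'.chart.symm v)) (c'.chart (c.chart.symm w))) hevaluation hderiv)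

/-- Logarithmic vector fields are tangent to the divisor: at a point of a single component `w_i = 0`
of `N`, moving along any coordinate of `c'` other than the equation of that component stays
in `N`. -/
theorem logDerivative_eq_zero_of_generic {w : κ → ℂ} (hw : w ∈ c.chart.target)
    (hw' : c.chart.symm w ∈ c'.chart.source) {i : κ} (hi : i ∈ c.poles) (hwi : w i = 0)
    (hgen : ∀ l ∈ c.poles, l ≠ i → w l ≠ 0) (k : κ) : logDerivative c c' k i w = 0 := by
  classical
  set v := c'.chart (c.chart.symm w) with hv
  have hvt : v ∈ c'.chart.target := c'.chart.map_source hw'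
  have hvs : c'.chart.symm v = c.chart.symm w := c'.chart.left_inv hw'
  have hvc : c'.chart.symm v ∈ c.chart.source := hvs ▸ c.chart.map_target hw
  have hxN : c.chart.symm w ∈ N := by
    rw [c.divisor _ (c.chart.map_target hw), c.chart.right_inv hw]
    exact Finset.prod_eq_zero hi hwi
  rw [c'.divisor _ hw', Finset.prod_eq_zero_iff] at hxN
  obtain ⟨l, hl, hvl⟩ : ∃ l ∈ c'.poles, v l = 0 := hxN
  by_cases hkl : k = l
  · subst hkl
    rw [logDerivative, ← hv, logDenominator, if_pos hl, hvl, zero_mul]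
  have hinverse := c'.isChart.analyticAt_comp_symm c.isChart hvt hvc
  have hcoord : ∀ᶠ z in 𝓝 v, c'.chart.symm z ∈ N → c.chart (c'.chart.symm z) i = 0 := by
    have hvw : c.chart (c'.chart.symm v) = w := by rw [hvs, c.chart.right_inv hw]
    filter_upwards [hinverse.continuousAt.eventually
        (hvw ▸ c.eventually_coord_eq_zero_of_mem hw hgen),
      (c'.chart.continuousAt_symm hvt).eventually (c.chart.open_source.mem_nhds hvc)] with z hz hzs
    rwa [c.chart.left_inv hzs] at hz
  have hderiv := hasDerivAt_pi.1
    (hinverse.differentiableAt.hasFDerivAt.hasLineDerivAt (Pi.single k (1 : ℂ) : κ → ℂ)) i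
  have hline : Filter.Tendsto (fun t : ℂ => v + t • (Pi.single k (1 : ℂ) : κ → ℂ)) (𝓝 0) (𝓝 v) :=
    Continuous.tendsto' (by fun_prop) _ _ (by simp)
  have hconst : (fun t : ℂ => c.chart (c'.chart.symm (v + t • (Pi.single k (1 : ℂ) : κ → ℂ))) i)
      =ᶠ[𝓝 0] fun _ => 0 := by
    filter_upwards [hline.eventually (c'.chart.open_target.mem_nhds hvt),
      hline.eventually hcoord] with t ht htN
    refine htN ((c'.divisor _ (c'.chart.map_target ht)).2 (Finset.prod_eq_zero hl ?_))
    simp [c'.chart.right_inv ht, hvl, Ne.symm hkl]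
  have hzero : fderiv ℂ (fun v => c.chart (c'.chart.symm v)) v (Pi.single k 1) i = 0 :=
    (hconst.hasDerivAt_iff.1 hderiv).unique (hasDerivAt_const 0 0)
  rw [logDerivative, ← hv, hzero, mul_zero]

theorem logDerivative_eq_zero {w : κ → ℂ} (hw : w ∈ c.chart.target)
    (hw' : c.chart.symm w ∈ c'.chart.source) {i : κ} (hi : i ∈ c.poles) (hwi : w i = 0) (k : κ) :
    logDerivative c c' k i w = 0 := by
  have hgen := mem_closure_iff_frequently.1
    (mem_closure_coord_eq_zero_and_ne_zero c.poles (i := i) hwi)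
  have hdom : ∀ᶠ z in 𝓝 w, z ∈ c.chart.target ∧ c.chart.symm z ∈ c'.chart.source :=
    (c.chart.open_target.eventually_mem hw).and
      ((c.chart.continuousAt_symm hw).eventually (c'.chart.open_source.mem_nhds hw'))
  refine tendsto_nhds_unique_of_frequently_eq
    (analyticAt_logDerivative hw hw' k i).continuousAt.tendsto tendsto_const_nhds
    ((hgen.and_eventually hdom).mono ?_)
  rintro z ⟨⟨hzi, hz⟩, hzt, hzs⟩
  exact logDerivative_eq_zero_of_generic hzt hzs hi hzi hz k

theorem exists_logDerivative_eq_mul {u : κ → ℂ} (hu : u ∈ c.chart.target)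
    (hu' : c.chart.symm u ∈ c'.chart.source) (k i : κ) :
    ∃ m : (κ → ℂ) → ℂ, AnalyticAt ℂ m u ∧
      ∀ᶠ w in 𝓝 u, logDerivative c c' k i w = logDenominator c.poles w i * m w := by
  have hanalytic := analyticAt_logDerivative hu hu' k i
  by_cases hi : i ∈ c.poles
  swap
  · exact ⟨_, hanalytic, by simp [logDenominator, hi]⟩
  simp only [logDenominator, if_pos hi]
  by_cases hui : u i = 0
  · refine exists_analyticAt_eq_coord_smul hanalytic hui ?_
    filter_upwards [c.chart.open_target.mem_nhds hu,
      (c.chart.continuousAt_symm hu).eventually (c'.chart.open_source.mem_nhds hu')]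
      with w hw hw' hwi
    exact logDerivative_eq_zero hw hw' hi hwi k
  · refine ⟨fun w => logDerivative c c' k i w / w i,
      hanalytic.div (analyticAt_coord i u) hui, ?_⟩
    filter_upwards [(continuous_apply i).continuousAt.eventually_ne hui] with w hw
    rw [mul_div_cancel₀ _ hw]

theorem logCovector_sum_mul_eq {w : κ → ℂ} (hw : w ∈ c.chart.target)
    (hw' : c.chart.symm w ∈ c'.chart.source) (hN : c.chart.symm w ∉ N) {m : κ → κ → ℂ}
    (hm : ∀ k i, logDerivative c c' k i w = logDenominator c.poles w i * m k i) (ξ : κ → ℂ) :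
    logCovector c'.chart c'.poles (fun k => ∑ i, ξ i * m k i) (c.chart.symm w) =
      logCovector c.chart c.poles ξ (c.chart.symm w) := by
  classical
  ext v
  rw [logCovector_apply, logCovector_apply,
    c'.isChart.mfderiv_eq_fderiv_comp c.isChart hw' (c.chart.map_target hw), c.chart.right_inv hw]
  set V : κ → ℂ := mfderiv 𝓘(ℂ, κ → ℂ) 𝓘(ℂ, κ → ℂ) c'.chart (c.chart.symm w) v
  set T := fderiv ℂ (fun v => c.chart (c'.chart.symm v)) (c'.chart (c.chart.symm w))
  have hD : ∀ i, logDenominator c.poles w i ≠ 0 := fun i => by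
    simpa only [c.chart.right_inv hw] using
      c.logDenominator_ne_zero (c.chart.map_target hw) hN i
  have hD' := c'.logDenominator_ne_zero hw' hN
  have hTV : ∀ i, T V i = ∑ k, V k * T (Pi.single k 1) i := fun i => by
    simp [continuousLinearMap_apply_eq_sum T V]
  change _ = ∑ i, ξ i / logDenominator c.poles w i * T V i
  simp_rw [hTV, Finset.mul_sum, Finset.sum_div, Finset.sum_mul]
  rw [Finset.sum_comm]
  refine Finset.sum_congr rfl fun i _ => Finset.sum_congr rfl fun k _ => ?_
  have hmki : logDenominator c'.poles (c'.chart (c.chart.symm w)) k * T (Pi.single k 1) i =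
    logDenominator c.poles w i * m k i := hm k i
  have := hD i
  have := hD' k
  field_simp
  linear_combination (-1 : ℂ) * V k * ξ i * hmki

theorem exists_transition_matrix {u : κ → ℂ} (hu : u ∈ c.chart.target)
    (hu' : c.chart.symm u ∈ c'.chart.source) :
    ∃ m : κ → κ → (κ → ℂ) → ℂ, (∀ k i, AnalyticAt ℂ (m k i) u) ∧
      ∀ᶠ w in 𝓝 u, c.chart.symm w ∉ N → ∀ ξ : κ → ℂ,
        logCovector c'.chart c'.poles (fun k => ∑ i, ξ i * m k i w) (c.chart.symm w) =
          logCovector c.chart c.poles ξ (c.chart.symm w) := by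
  choose m hm hquotient using fun k i => exists_logDerivative_eq_mul hu hu' k i
  refine ⟨m, hm, ?_⟩
  filter_upwards [Filter.eventually_all.2 fun k => Filter.eventually_all.2 (hquotient k),
    c.chart.open_target.mem_nhds hu,
    (c.chart.continuousAt_symm hu).eventually (c'.chart.open_source.mem_nhds hu')]
    with w hmw hw hw' hN ξ
  exact logCovector_sum_mul_eq hw hw' hN hmw ξ

end LogChart

end LogCotangentCoordinates

/-! ### The logarithmic cotangent bundle as a manifold -/

theorem IsNormalCrossings.exists_logChart {κ : Type} [Fintype κ] {M : Type*} [TopologicalSpace M]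
    [ChartedSpace (κ → ℂ) M] {N : Set M} (hN : IsNormalCrossings κ N) (o : M) :
    ∃ c : LogChart (κ := κ) N, o ∈ c.chart.source := by
  obtain ⟨e, K, he, ho, -, hK⟩ := hN o
  exact ⟨⟨e, K, he, hK⟩, ho⟩

theorem logDenominator_map_inl {κ κ' : Type} (K : Finset κ)
    (w : κ ⊕ κ' → ℂ) (i : κ) :
    logDenominator (K.map Function.Embedding.inl) w (Sum.inl i) =
      logDenominator K (w ∘ Sum.inl) i := by
  by_cases hi : i ∈ K <;> simp [logDenominator, hi]

/-- In the frame `dx_i / x_i`, `dξ_i`, the differential of `∑ ξ_i dx_i / x_i` is the standard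
symplectic form. -/
theorem frameDeriv_sub_frameDeriv_eq_J {κ : Type} [Finite κ] [DecidableEq κ] (K : Finset κ)
    (u : κ ⊕ κ → ℂ) :
    let a : κ ⊕ κ → (κ ⊕ κ → ℂ) → ℂ := Sum.elim (fun i w => w (Sum.inr i)) 0
    (Matrix.of fun k l => frameDeriv (K.map Function.Embedding.inl) k (a l) u -
      frameDeriv (K.map Function.Embedding.inl) l (a k) u) = Matrix.J κ ℂ := by
  cases nonempty_fintype κ
  intro a
  have hfiber (i : κ) : fderiv ℂ (a (Sum.inl i)) u = ContinuousLinearMap.proj (Sum.inr i) :=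
    (ContinuousLinearMap.proj (Sum.inr i) : (κ ⊕ κ → ℂ) →L[ℂ] ℂ).fderiv
  have hzero (i : κ) : fderiv ℂ (a (Sum.inr i)) u = 0 := fderiv_const_apply 0
  ext (k | k) (l | l) <;>
    simp [frameDeriv, hfiber, hzero, Matrix.J, logDenominator, Matrix.one_apply, Pi.single_apply,
      eq_comm]

section LogCotangentManifold

open PatchFamily

variable {κ : Type} [Fintype κ] {M : Type*} [TopologicalSpace M] [ChartedSpace (κ → ℂ) M]
  [IsManifold 𝓘(ℂ, κ → ℂ) ω M] {N : Set M}

namespace LogChart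

/-- The point of the logarithmic cotangent bundle with coordinates `(u, ξ)` over the logarithmic
chart `c`. -/
def point (c : LogChart (κ := κ) N) {u : κ → ℂ} (hu : u ∈ c.chart.target) (ξ : κ → ℂ) :
    LogCotangent κ N :=
  Glued.mk (logCotangentPatches κ N) c ⟨Sum.elim u ξ, hu⟩

theorem mk_eq_point (c : LogChart (κ := κ) N) (y : (logCotangentPatches κ N).dom c) :
    Glued.mk (logCotangentPatches κ N) c y = c.point (u := y.1 ∘ Sum.inl) y.2 (y.1 ∘ Sum.inr) := by
  unfold point
  congr 1
  exact Subtype.ext (by simp only [Sum.elim_comp_inl_inr])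

theorem point_congr (c : LogChart (κ := κ) N) {u u' : κ → ℂ} (hu : u ∈ c.chart.target)
    (hu' : u' ∈ c.chart.target) {ξ ξ' : κ → ℂ} (h : u = u') (h' : ξ = ξ') :
    c.point hu ξ = c.point hu' ξ' := by
  subst h h'
  rfl

theorem covector_point (c : LogChart (κ := κ) N) {u : κ → ℂ} (hu : u ∈ c.chart.target) (ξ : κ → ℂ)
    (hN : c.chart.symm u ∉ N) :
    LogCotangent.covector κ N (c.point hu ξ) = logCovector c.chart c.poles ξ (c.chart.symm u) :=
  Glued.val_mk (logCotangentPatches κ N) (i := c) ⟨Sum.elim u ξ, hu⟩ hN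

theorem exists_isMorphismAt (c c' : LogChart (κ := κ) N) {u : κ → ℂ} (hu : u ∈ c.chart.target)
    (hu' : c.chart.symm u ∈ c'.chart.source) :
    ∃ m : κ → κ → (κ → ℂ) → ℂ, ∀ ξ : κ → ℂ,
      (logCotangentPatches κ N).IsMorphismAt c c'
        (fun w => Sum.elim (c'.chart (c.chart.symm (w ∘ Sum.inl)))
          fun k => ∑ i, w (Sum.inr i) * m k i (w ∘ Sum.inl)) (Sum.elim u ξ) := by
  obtain ⟨m, hm, hcovector⟩ := exists_transition_matrix hu hu'
  refine ⟨m, fun ξ => ?_⟩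
  have hinl : AnalyticAt ℂ (fun w : κ ⊕ κ → ℂ => w ∘ Sum.inl) (Sum.elim u ξ) :=
    analyticAt_pi_iff.2 fun i => analyticAt_coord (Sum.inl i) _
  have htendsto : Filter.Tendsto (fun w : κ ⊕ κ → ℂ => w ∘ Sum.inl) (𝓝 (Sum.elim u ξ)) (𝓝 u) :=
    hinl.continuousAt
  have hbase : ∀ᶠ w in 𝓝 (Sum.elim u ξ),
      c'.chart.symm (c'.chart (c.chart.symm (w ∘ Sum.inl))) = c.chart.symm (w ∘ Sum.inl) := by
    filter_upwards [htendsto.eventually ((c.chart.continuousAt_symm hu).eventually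
      (c'.chart.open_source.eventually_mem hu'))] with w hw
    exact c'.chart.left_inv hw
  refine ⟨analyticAt_pi_iff.2 ?_, c'.chart.map_source hu', hbase, ?_⟩
  · rintro (k | k)
    · exact analyticAt_pi_iff.1 (AnalyticAt.fun_comp (f := fun w : κ ⊕ κ → ℂ => w ∘ Sum.inl)
        (x := Sum.elim u ξ) (g := fun v => c'.chart (c.chart.symm v))
        (c.isChart.analyticAt_comp_symm c'.isChart hu hu') hinl) k
    · exact Finset.analyticAt_fun_sum _ fun i _ => (analyticAt_coord (Sum.inr i) _).mul
        (AnalyticAt.fun_comp (g := m k i) (f := fun w : κ ⊕ κ → ℂ => w ∘ Sum.inl) (hm k i) hinl)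
  · filter_upwards [htendsto.eventually hcovector, hbase] with w hw hb hN
    have htransport : ∀ x, x = c.chart.symm (w ∘ Sum.inl) →
        (logCovector c'.chart c'.poles (fun k => ∑ i, w (Sum.inr i) * m k i (w ∘ Sum.inl)) x :
          (κ → ℂ) →L[ℂ] ℂ) =
        logCovector c.chart c.poles (w ∘ Sum.inr) (c.chart.symm (w ∘ Sum.inl)) := by
      rintro x rfl
      exact hw hN (w ∘ Sum.inr)
    exact htransport _ hb

theorem exists_point_eq (c c' : LogChart (κ := κ) N) {u : κ → ℂ} (hu : u ∈ c.chart.target)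
    (hu' : c.chart.symm u ∈ c'.chart.source) :
    ∃ A : κ → κ → ℂ, ∀ ξ : κ → ℂ, c.point hu ξ =
      c'.point (c'.chart.map_source hu') (fun k => ∑ i, ξ i * A k i) := by
  have hus : c'.chart.symm (c'.chart (c.chart.symm u)) ∈ c.chart.source := by
    rw [c'.chart.left_inv hu']
    exact c.chart.map_target hu
  obtain ⟨m, hm⟩ := c.exists_isMorphismAt c' hu hu'
  obtain ⟨m', hm'⟩ := c'.exists_isMorphismAt c (c'.chart.map_source hu') hus
  exact ⟨fun k i => m k i u, fun ξ => Glued.mk_eq_mk_of_isMorphismAt _ hu (hm ξ) (hm' _)⟩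

end LogChart

namespace LogCotangent

theorem exists_point (p : LogCotangent κ N) :
    ∃ (c : LogChart (κ := κ) N) (u : κ → ℂ) (hu : u ∈ c.chart.target) (ξ : κ → ℂ),
      p = c.point hu ξ := by
  obtain ⟨c, y, rfl⟩ := Glued.exists_mk _ p
  exact ⟨c, _, y.2, _, LogChart.mk_eq_point c y⟩

theorem dense_proj_notMem : Dense {p : LogCotangent κ N | proj κ N p ∉ N} :=
  Glued.dense_proj_notMem_center (logCotangentPatches κ N)

theorem exists_point_of_mem_source (c : LogChart (κ := κ) N) {p : LogCotangent κ N}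
    (hp : proj κ N p ∈ c.chart.source) : ∃ ξ, p = c.point (c.chart.map_source hp) ξ := by
  obtain ⟨c₀, u, hu, ξ, rfl⟩ := exists_point p
  obtain ⟨A, hA⟩ := c₀.exists_point_eq c hu hp
  exact ⟨_, hA ξ⟩

theorem exists_eq_point (c : LogChart (κ := κ) N) {p : LogCotangent κ N}
    (hp : proj κ N p ∈ c.chart.source) :
    ∃ (u : κ → ℂ) (hu : u ∈ c.chart.target) (ξ : κ → ℂ), p = c.point hu ξ := by
  obtain ⟨ξ, hξ⟩ := exists_point_of_mem_source c hp
  exact ⟨_, _, ξ, hξ⟩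

theorem eq_of_covector_eq {p q : LogCotangent κ N} (h : proj κ N p = proj κ N q)
    (hN : proj κ N p ∉ N)
    (hcovector : (covector κ N p : (κ → ℂ) →L[ℂ] ℂ) = covector κ N q) : p = q := by
  obtain ⟨c, u, hu, ξ, rfl⟩ := exists_point p
  obtain ⟨u', hu', ξ', rfl⟩ := exists_eq_point c (p := q) (by
    rw [← h]
    exact c.chart.map_target hu)
  have hN' : c.chart.symm u' ∉ N := by
    rwa [h] at hN
  obtain ⟨rfl, rfl⟩ := c.inj hu hu' hN h
    (((c.covector_point hu ξ hN).symm.trans hcovector).trans (c.covector_point hu' ξ' hN'))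
  rfl

theorem contMDiff_proj : ContMDiff 𝓘(ℂ, κ ⊕ κ → ℂ) 𝓘(ℂ, κ → ℂ) ω (proj κ N) := by
  refine Glued.contMDiff_proj (G := logCotangentPatches κ N) fun c y hy => ?_
  have hinl : ContMDiffAt 𝓘(ℂ, κ ⊕ κ → ℂ) 𝓘(ℂ, κ → ℂ) ω (fun w : κ ⊕ κ → ℂ => w ∘ Sum.inl) y :=
    contMDiffAt_iff_contDiffAt.2 (contDiffAt_pi.2 fun i =>
      (analyticAt_coord (Sum.inl i) y).contDiffAt)
  have hsymm : ContMDiffAt 𝓘(ℂ, κ → ℂ) 𝓘(ℂ, κ → ℂ) ω c.chart.symm (y ∘ Sum.inl) :=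
    (isCoordinateChart_iff.1 c.isChart).2.contMDiffAt (c.chart.open_target.mem_nhds hy)
  exact ContMDiffAt.comp (f := fun w : κ ⊕ κ → ℂ => w ∘ Sum.inl) y hsymm hinl

theorem continuous_proj : Continuous (proj κ N) := contMDiff_proj.continuous

theorem t2Space [T2Space M] : T2Space (LogCotangent κ N) := by
  rw [t2_iff_nhds]
  intro p q hpq
  have hproj : proj κ N p = proj κ N q :=
    tendsto_nhds_unique ((continuous_proj.tendsto p).mono_left (inf_le_left (b := 𝓝 q)))
      ((continuous_proj.tendsto q).mono_left inf_le_right)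
  obtain ⟨c, u, hu, ξ, rfl⟩ := exists_point p
  obtain ⟨u', hu', ξ', rfl⟩ := exists_eq_point c (p := q) (by
    rw [← hproj]
    exact c.chart.map_target hu)
  have hcoord : Sum.elim u ξ = Sum.elim u' ξ' := tendsto_nhds_unique
    (l := 𝓝 (c.point hu ξ) ⊓ 𝓝 (c.point hu' ξ'))
    ((Glued.tendsto_patchChart (logCotangentPatches κ N) (i := c) (x₀ := c.point hu ξ)
      ⟨Sum.elim u ξ, hu⟩).mono_left (inf_le_left (b := 𝓝 (c.point hu' ξ'))))
    ((Glued.tendsto_patchChart (logCotangentPatches κ N) (i := c) (x₀ := c.point hu ξ)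
      ⟨Sum.elim u' ξ', hu'⟩).mono_left inf_le_right)
  exact c.point_congr hu hu' (congrArg (· ∘ Sum.inl) hcoord) (congrArg (· ∘ Sum.inr) hcoord)

variable (c : LogChart (κ := κ) N) (p₀ : LogCotangent κ N)

/-- The coordinates `(x, ξ)` of the logarithmic cotangent bundle over the coordinates `x` of the
logarithmic chart `c`; the value of the inverse outside its target is the arbitrary point `p₀`. -/
def bundleChart : OpenPartialHomeomorph (LogCotangent κ N) (κ ⊕ κ → ℂ) :=
  Glued.patchChart (logCotangentPatches κ N) c p₀

theorem isCoordinateChart_bundleChart : IsCoordinateChart (κ ⊕ κ) (bundleChart c p₀) :=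
  Glued.isCoordinateChart_patchChart _

variable {c p₀} {p : LogCotangent κ N}

theorem mem_bundleChart_target {w : κ ⊕ κ → ℂ} :
    w ∈ (bundleChart c p₀).target ↔ w ∘ Sum.inl ∈ c.chart.target := Iff.rfl

theorem bundleChart_point {u : κ → ℂ} (hu : u ∈ c.chart.target) (ξ : κ → ℂ) :
    bundleChart c p₀ (c.point hu ξ) = Sum.elim u ξ :=
  Glued.patchChart_mk (logCotangentPatches κ N) _

theorem bundleChart_symm {w : κ ⊕ κ → ℂ} (hw : w ∘ Sum.inl ∈ c.chart.target) :
    (bundleChart c p₀).symm w = c.point hw (w ∘ Sum.inr) :=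
  (Glued.patchChart_symm (logCotangentPatches κ N) hw).trans (c.mk_eq_point _)

theorem mem_bundleChart_source :
    p ∈ (bundleChart c p₀).source ↔ proj κ N p ∈ c.chart.source := by
  constructor
  · rintro ⟨y, rfl⟩
    exact c.chart.map_target y.2
  · intro h
    obtain ⟨u, hu, ξ, rfl⟩ := exists_eq_point c h
    exact ⟨_, rfl⟩

theorem bundleChart_comp_inl (hp : proj κ N p ∈ c.chart.source) :
    bundleChart c p₀ p ∘ Sum.inl = c.chart (proj κ N p) := by
  obtain ⟨ξ, hξ⟩ := exists_point_of_mem_source c hp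
  conv_lhs => rw [hξ]
  rw [bundleChart_point, Sum.elim_comp_inl]

theorem bundleChart_inl (hp : proj κ N p ∈ c.chart.source) (i : κ) :
    bundleChart c p₀ p (Sum.inl i) = c.chart (proj κ N p) i :=
  congrFun (bundleChart_comp_inl hp) i

theorem eq_point_bundleChart (hp : proj κ N p ∈ c.chart.source) :
    p = c.point (c.chart.map_source hp) (bundleChart c p₀ p ∘ Sum.inr) := by
  obtain ⟨ξ, hξ⟩ := exists_point_of_mem_source c hp
  have hinr : bundleChart c p₀ p ∘ Sum.inr = ξ := by
    conv_lhs => rw [hξ]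
    rw [bundleChart_point, Sum.elim_comp_inr]
  rwa [hinr]

theorem isCoordinateDivisor_bundleChart :
    IsCoordinateDivisor (bundleChart c p₀) (c.poles.map Function.Embedding.inl)
      (proj κ N ⁻¹' N) := by
  intro p hp
  rw [mem_bundleChart_source] at hp
  rw [mem_preimage, c.divisor _ hp, Finset.prod_map]
  simp only [Function.Embedding.inl_apply, bundleChart_inl hp]

theorem isCoordinateSubspace_bundleChart {L : Set M} {J : Finset κ}
    (hL : IsCoordinateSubspace c.chart J L) :
    IsCoordinateSubspace (bundleChart c p₀) (J.map Function.Embedding.inl) (proj κ N ⁻¹' L) := by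
  intro p hp
  rw [mem_bundleChart_source] at hp
  rw [mem_preimage, hL _ hp]
  simp only [Finset.forall_mem_map, Function.Embedding.inl_apply, bundleChart_inl hp]

theorem covector_eq_logCovector (hp : proj κ N p ∈ c.chart.source) (hN : proj κ N p ∉ N) :
    (covector κ N p : (κ → ℂ) →L[ℂ] ℂ) =
      logCovector c.chart c.poles (bundleChart c p₀ p ∘ Sum.inr) (proj κ N p) := by
  have hleft : c.chart.symm (c.chart (proj κ N p)) = proj κ N p := c.chart.left_inv hp
  have hpoint := c.covector_point (c.chart.map_source hp) (bundleChart c p₀ p ∘ Sum.inr)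
    (by rwa [hleft])
  rw [← eq_point_bundleChart hp] at hpoint
  have htransport : ∀ x, x = proj κ N p →
      (logCovector c.chart c.poles (bundleChart c p₀ p ∘ Sum.inr) x : (κ → ℂ) →L[ℂ] ℂ) =
        logCovector c.chart c.poles (bundleChart c p₀ p ∘ Sum.inr) (proj κ N p) := by
    rintro x rfl
    rfl
  exact hpoint.trans (htransport _ hleft)

theorem mfderiv_chart_mfderiv_proj (hp : proj κ N p ∈ c.chart.source)
    (v : TangentSpace 𝓘(ℂ, κ ⊕ κ → ℂ) p) :
    (mfderiv 𝓘(ℂ, κ → ℂ) 𝓘(ℂ, κ → ℂ) c.chart (proj κ N p)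
        (mfderiv 𝓘(ℂ, κ ⊕ κ → ℂ) 𝓘(ℂ, κ → ℂ) (proj κ N) p v) : κ → ℂ) =
      (mfderiv 𝓘(ℂ, κ ⊕ κ → ℂ) 𝓘(ℂ, κ ⊕ κ → ℂ) (bundleChart c p₀) p v : κ ⊕ κ → ℂ) ∘ Sum.inl := by
  let R : (κ ⊕ κ → ℂ) →L[ℂ] (κ → ℂ) :=
    ContinuousLinearMap.pi fun i => ContinuousLinearMap.proj (Sum.inl i)
  have hpsource : p ∈ (bundleChart c p₀).source := mem_bundleChart_source.2 hp
  have hcomp : c.chart ∘ proj κ N =ᶠ[𝓝 p] R ∘ bundleChart c p₀ := by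
    filter_upwards [(bundleChart c p₀).open_source.mem_nhds hpsource] with q hq
    exact (bundleChart_comp_inl (p₀ := p₀) (mem_bundleChart_source.1 hq)).symm
  have hderiv := hcomp.mfderiv_eq (I := 𝓘(ℂ, κ ⊕ κ → ℂ)) (I' := 𝓘(ℂ, κ → ℂ))
  rw [mfderiv_comp p ((isCoordinateChart_iff.1 c.isChart).mdifferentiableAt hp)
      (contMDiff_proj.mdifferentiableAt (by simp)),
    mfderiv_comp (I' := 𝓘(ℂ, κ ⊕ κ → ℂ)) p R.differentiableAt.mdifferentiableAt
      ((isCoordinateChart_iff.1 (isCoordinateChart_bundleChart c p₀)).mdifferentiableAt hpsource),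
    mfderiv_eq_fderiv, R.fderiv] at hderiv
  exact DFunLike.congr_fun hderiv v

theorem canonicalForm_eq (hp : proj κ N p ∈ c.chart.source) (hN : proj κ N p ∉ N) :
    canonicalForm κ N p = logCovector (bundleChart c p₀) (c.poles.map Function.Embedding.inl)
      (Sum.elim (bundleChart c p₀ p ∘ Sum.inr) 0) p := by
  ext v
  have hcanonical : canonicalForm κ N p v =
      logCovector c.chart c.poles (bundleChart c p₀ p ∘ Sum.inr) (proj κ N p)
        (mfderiv 𝓘(ℂ, κ ⊕ κ → ℂ) 𝓘(ℂ, κ → ℂ) (proj κ N) p v) :=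
    DFunLike.congr_fun (covector_eq_logCovector hp hN) _
  rw [hcanonical, logCovector_apply, logCovector_apply, Fintype.sum_sum_type,
    mfderiv_chart_mfderiv_proj (p₀ := p₀) hp]
  simp only [Sum.elim_inl, Sum.elim_inr, Pi.zero_apply, zero_div, zero_mul, Finset.sum_const_zero,
    add_zero, Function.comp_apply, logDenominator_map_inl, bundleChart_comp_inl hp]
  rfl

theorem isNormalCrossings_preimage_proj (hN : IsNormalCrossings κ N) :
    IsNormalCrossings (κ ⊕ κ) (proj κ N ⁻¹' N) := by
  intro p
  obtain ⟨c, hc⟩ := hN.exists_logChart (proj κ N p)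
  obtain ⟨e, K, -, he, hp, hzero, -, hK, -⟩ :=
    (isCoordinateDivisor_bundleChart (c := c) (p₀ := p)).exists_centered
      (isCoordinateChart_bundleChart c p) (mem_bundleChart_source.2 hc) Filter.univ_mem
  exact ⟨e, K, he, hp, hzero, hK⟩

theorem isLogSymplecticPotential (hN : IsNormalCrossings κ N) :
    IsLogSymplecticPotential (κ ⊕ κ) (proj κ N ⁻¹' N) (canonicalForm κ N) := by
  classical
  refine ⟨isNormalCrossings_preimage_proj hN, fun p => ?_⟩
  obtain ⟨c, hc⟩ := hN.exists_logChart (proj κ N p)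
  refine ⟨bundleChart c p, c.poles.map Function.Embedding.inl,
    Sum.elim (fun i w => w (Sum.inr i)) 0, isCoordinateChart_bundleChart c p,
    mem_bundleChart_source.2 hc, isCoordinateDivisor_bundleChart, ?_, fun x hx hxN => ?_,
    fun u _ => ?_⟩
  · rintro (_ | _) _ -
    · exact analyticAt_coord _ _
    · exact analyticAt_const
  · rw [canonicalForm_eq (c := c) (p₀ := p) (mem_bundleChart_source.1 hx) hxN]
    congr 1
    funext i
    cases i <;> rfl
  · convert (Matrix.isUnit_det_J κ ℂ).ne_zero
    exact frameDeriv_sub_frameDeriv_eq_J c.poles u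

end LogCotangent

end LogCotangentManifold

/-! ### Gluing local biholomorphisms -/

section Gluing

theorem eqOn_of_dense_of_rel {X T : Type*} [TopologicalSpace X] [TopologicalSpace T] [T2Space T]
    {A : X → T → Prop} {D : Set X} (hD : Dense D)
    (hA : ∀ x ∈ D, ∀ p p', A x p → A x p' → p = p') {U : Set X} (hU : IsOpen U) {f g : X → T}
    (hf : ContinuousOn f U) (hg : ContinuousOn g U) (hfA : ∀ x ∈ U, A x (f x))
    (hgA : ∀ x ∈ U, A x (g x)) : EqOn f g U := by
  have heq : EqOn f g (U ∩ D) := fun x hx => hA x hx.2 _ _ (hfA x hx.1) (hgA x hx.1)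
  exact heq.of_subset_closure hf hg inter_subset_left (hD.open_subset_closure_inter hU)

variable {κ : Type} [Fintype κ]
  {X : Type*} [TopologicalSpace X] [ChartedSpace (κ → ℂ) X] [T2Space X]
  {T : Type*} [TopologicalSpace T] [ChartedSpace (κ → ℂ) T] [T2Space T]

theorem exists_diffeomorph_of_rel {A : X → T → Prop}
    {D : Set X} (hD : Dense D) (hA : ∀ x ∈ D, ∀ p p', A x p → A x p' → p = p')
    {D' : Set T} (hD' : Dense D') (hA' : ∀ p ∈ D', ∀ x x', A x p → A x' p → x = x')
    (hsource : ∀ x, ∃ φ : OpenPartialHomeomorph X T, IsBiholomorphic κ φ ∧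
      (∀ z ∈ φ.source, A z (φ z)) ∧ x ∈ φ.source)
    (htarget : ∀ p, ∃ φ : OpenPartialHomeomorph X T, IsBiholomorphic κ φ ∧
      (∀ z ∈ φ.source, A z (φ z)) ∧ p ∈ φ.target) :
    ∃ Φ : X ≃ₘ^ω⟮𝓘(ℂ, κ → ℂ), 𝓘(ℂ, κ → ℂ)⟯ T, (∀ x, A x (Φ x)) ∧
      ∀ φ : OpenPartialHomeomorph X T, (∀ z ∈ φ.source, A z (φ z)) → EqOn Φ φ φ.source := by
  choose f hf hfA hfmem using hsource
  choose g hg hgA hgmem using htarget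
  have hsymm (φ : OpenPartialHomeomorph X T) (hφ : ∀ z ∈ φ.source, A z (φ z)) :
      ∀ p ∈ φ.target, A (φ.symm p) p := fun p hp => by
    simpa only [φ.right_inv hp] using hφ _ (φ.map_target hp)
  have heq (φ : OpenPartialHomeomorph X T) (hφ : ∀ z ∈ φ.source, A z (φ z)) :
      EqOn (fun x => f x x) φ φ.source := fun x hx =>
    eqOn_of_dense_of_rel hD hA ((f x).open_source.inter φ.open_source)
      ((f x).continuousOn.mono inter_subset_left) (φ.continuousOn.mono inter_subset_right)
      (fun z hz => hfA x z hz.1) (fun z hz => hφ z hz.2) ⟨hfmem x, hx⟩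
  have heq_symm (φ : OpenPartialHomeomorph X T) (hφ : ∀ z ∈ φ.source, A z (φ z)) :
      EqOn (fun p => (g p).symm p) φ.symm φ.target := fun p hp =>
    eqOn_of_dense_of_rel (A := fun p x => A x p) hD' hA'
      ((g p).open_target.inter φ.open_target)
      ((g p).continuousOn_symm.mono inter_subset_left)
      (φ.continuousOn_symm.mono inter_subset_right)
      (fun q hq => hsymm _ (hgA p) q hq.1) (fun q hq => hsymm φ hφ q hq.2) ⟨hgmem p, hp⟩
  refine ⟨{ toFun := fun x => f x x
            invFun := fun p => (g p).symm p
            left_inv := fun x => ?_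
            right_inv := fun p => ?_
            contMDiff_toFun := fun x => ?_
            contMDiff_invFun := fun p => ?_ }, fun x => hfA x x (hfmem x), heq⟩
  · exact (heq_symm (f x) (hfA x) ((f x).map_source (hfmem x))).trans ((f x).left_inv (hfmem x))
  · exact (heq (g p) (hgA p) ((g p).map_target (hgmem p))).trans ((g p).right_inv (hgmem p))
  · have hnhds := (f x).open_source.mem_nhds (hfmem x)
    exact ((hf x).1.contMDiffAt hnhds).congr_of_eventuallyEq
      (Filter.eventuallyEq_of_mem hnhds (heq (f x) (hfA x)))
  · have hnhds := (g p).open_target.mem_nhds (hgmem p)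
    exact ((hg p).2.contMDiffAt hnhds).congr_of_eventuallyEq
      (Filter.eventuallyEq_of_mem hnhds (heq_symm (g p) (hgA p)))

end Gluing

/-! ### Adapted coordinates of the blow ups -/

section BlowDown

theorem blowDown_map_inl {κ κ' : Type} (J : Finset κ) (j : κ) (w : κ ⊕ κ' → ℂ) :
    blowDown (κ ⊕ κ') (J.map Function.Embedding.inl) (Sum.inl j) w =
      Sum.elim (blowDown κ J j (w ∘ Sum.inl)) (w ∘ Sum.inr) := by
  funext i
  cases i with
  | inl i => by_cases hi : i ∈ J ∧ i ≠ j <;> simp [blowDown, hi]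
  | inr i => simp [blowDown]

variable {κ : Type} {J K : Finset κ} {j : κ}

theorem prod_blowDown_eq_zero_iff (hJ : J ⊆ K) (hj : j ∈ J) {y : κ → ℂ} :
    ∏ i ∈ K, blowDown κ J j y i = 0 ↔ ∏ i ∈ K, y i = 0 := by
  simp only [Finset.prod_eq_zero_iff]
  constructor
  · rintro ⟨i, hi, hzero⟩
    by_cases hij : i ∈ J ∧ i ≠ j
    · rw [blowDown_of_mem hij.1 hij.2] at hzero
      rcases mul_eq_zero.1 hzero with hyi | hyj
      · exact ⟨i, hi, hyi⟩
      · exact ⟨j, hJ hj, hyj⟩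
    · exact ⟨i, hi, by rwa [blowDown_of_not hij] at hzero⟩
  · rintro ⟨i, hi, hzero⟩
    refine ⟨i, hi, ?_⟩
    by_cases hij : i ∈ J ∧ i ≠ j
    · rw [blowDown_of_mem hij.1 hij.2, hzero, zero_mul]
    · rwa [blowDown_of_not hij]

open Classical in
theorem fderiv_blowDown_apply [Finite κ] (y V : κ → ℂ) (i : κ) :
    fderiv ℂ (blowDown κ J j) y V i = if i ∈ J ∧ i ≠ j then y i * V j + y j * V i else V i := by
  cases nonempty_fintype κ
  have hcoord := hasFDerivAt_pi'.1 (analyticAt_blowDown J j y).differentiableAt.hasFDerivAt i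
  have hproj (k : κ) : HasFDerivAt (fun x : κ → ℂ => x k)
      (ContinuousLinearMap.proj k : (κ → ℂ) →L[ℂ] ℂ) y :=
    (ContinuousLinearMap.proj k : (κ → ℂ) →L[ℂ] ℂ).hasFDerivAt
  split_ifs with hi
  · have hproduct : HasFDerivAt (fun x : κ → ℂ => blowDown κ J j x i)
        (y i • (ContinuousLinearMap.proj j : (κ → ℂ) →L[ℂ] ℂ) +
          y j • (ContinuousLinearMap.proj i : (κ → ℂ) →L[ℂ] ℂ)) y := by
      simp only [blowDown, if_pos hi]
      exact (hproj i).mul (hproj j)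
    exact DFunLike.congr_fun (hcoord.unique hproduct) V
  · have hlinear : HasFDerivAt (fun x : κ → ℂ => blowDown κ J j x i)
        (ContinuousLinearMap.proj i : (κ → ℂ) →L[ℂ] ℂ) y := by
      simp only [blowDown, if_neg hi]
      exact hproj i
    exact DFunLike.congr_fun (hcoord.unique hlinear) V

open Classical in
/-- If `x_i = y_i y_j`, then `dx_i / x_i = dy_i / y_i + dy_j / y_j`. -/
theorem div_logDenominator_blowDown_mul_fderiv [Finite κ] (hJ : J ⊆ K) (ξ y V : κ → ℂ) (i : κ)
    (hi : logDenominator K (blowDown κ J j y) i ≠ 0) :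
    ξ i / logDenominator K (blowDown κ J j y) i * fderiv ℂ (blowDown κ J j) y V i =
      ξ i / logDenominator K y i * V i + if i ∈ J.erase j then ξ i * (V j / y j) else 0 := by
  rw [fderiv_blowDown_apply]
  by_cases hij : i ∈ J ∧ i ≠ j
  · have hiK := hJ hij.1
    rw [logDenominator, if_pos hiK, blowDown_of_mem hij.1 hij.2] at hi
    have hyi : y i ≠ 0 := left_ne_zero_of_mul hi
    have hyj : y j ≠ 0 := right_ne_zero_of_mul hi
    rw [if_pos hij, if_pos (Finset.mem_erase.2 hij.symm), logDenominator, logDenominator,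
      if_pos hiK, if_pos hiK, blowDown_of_mem hij.1 hij.2]
    field_simp
    ring
  · have hij' : i ∉ J.erase j := fun h => hij (Finset.mem_erase.1 h).symm
    rw [if_neg hij, if_neg hij', add_zero, logDenominator, logDenominator, blowDown_of_not hij]

end BlowDown

section Adapted

open PatchFamily

variable {κ : Type} [Fintype κ] {M : Type*} [TopologicalSpace M] [ChartedSpace (κ → ℂ) M]

/-- Coordinates in which both the divisor `N` and the center `L` are given by coordinate functions,
together with an affine patch of the blow up along `L`. -/
inductive AdaptedPatch (N L : Set M) : Type _
  | off (c : LogChart (κ := κ) N) (hL : Disjoint c.chart.source L) : AdaptedPatch N L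
  | along (c : LogChart (κ := κ) N) (J : Finset κ) (hL : IsCoordinateSubspace c.chart J L)
      (hJ : J ⊆ c.poles) (j : κ) (hj : j ∈ J) : AdaptedPatch N L

namespace AdaptedPatch

variable {N L : Set M}

/-- The logarithmic coordinates of `M` of an adapted patch. -/
def logChart : AdaptedPatch (κ := κ) N L → LogChart (κ := κ) N
  | off c _ => c
  | along c _ _ _ _ _ => c

/-- The patch of the blow up of `M` along `L` of an adapted patch. -/
def patch : AdaptedPatch (κ := κ) N L → BlowUpPatch (κ := κ) L
  | off c hL => .off c.chart c.isChart hL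
  | along c J hL _ j hj => .along c.chart c.isChart J hL j hj

theorem patch_chart (P : AdaptedPatch (κ := κ) N L) : P.patch.chart = P.logChart.chart := by
  cases P <;> rfl

open Classical in
/-- The difference of the fibre coordinates of the two logarithmic cotangent bundles.  Since
`dx_l / x_l = dy_l / y_l + dy_j / y_j` for `l ∈ J`, `l ≠ j`, the coefficient of `dy_j / y_j` is
`∑_{l ∈ J} ξ_l` instead of `ξ_j`. -/
def fibreShift : AdaptedPatch (κ := κ) N L → (κ → ℂ) →L[ℂ] (κ → ℂ)
  | off _ _ => 0
  | along _ J _ _ j _ => (∑ l ∈ J.erase j,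
      (ContinuousLinearMap.proj l : (κ → ℂ) →L[ℂ] ℂ)).smulRight (Pi.single j (1 : ℂ))

open Classical in
theorem fibreShift_along (c : LogChart (κ := κ) N) {J : Finset κ}
    (hL : IsCoordinateSubspace c.chart J L) (hJ : J ⊆ c.poles) {j : κ} (hj : j ∈ J) (ξ : κ → ℂ) :
    (along c J hL hJ j hj).fibreShift ξ = Pi.single j (∑ l ∈ J.erase j, ξ l) := by
  rw [fibreShift, ContinuousLinearMap.smulRight_apply, sum_apply, ← Pi.single_smul, smul_eq_mul,
    mul_one]
  rfl

theorem fibreShift_fibreShift (P : AdaptedPatch (κ := κ) N L) (ξ : κ → ℂ) :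
    P.fibreShift (P.fibreShift ξ) = 0 := by
  classical
  cases P with
  | off c hL => rfl
  | along c J hL hJ j hj =>
    rw [fibreShift_along, fibreShift_along, Pi.single_eq_zero_iff]
    exact Finset.sum_eq_zero fun l hl => Pi.single_eq_of_ne (Finset.ne_of_mem_erase hl) _

theorem sum_div_logDenominator_mul (P : AdaptedPatch (κ := κ) N L) (y V ξ : κ → ℂ)
    (hy : ∀ i, logDenominator P.logChart.poles (P.patch.toCoord y) i ≠ 0) :
    ∑ i, (ξ + P.fibreShift ξ) i / logDenominator P.logChart.poles y i * V i =
      ∑ i, ξ i / logDenominator P.logChart.poles (P.patch.toCoord y) i *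
        fderiv ℂ P.patch.toCoord y V i := by
  classical
  cases P with
  | off c hL => simp [fibreShift, patch, BlowUpPatch.toCoord]
  | along c J hL hJ j hj =>
    simp only [logChart, patch, BlowUpPatch.toCoord] at hy ⊢
    rw [Finset.sum_congr rfl fun i _ =>
        div_logDenominator_blowDown_mul_fderiv hJ ξ y V i (hy i),
      Finset.sum_add_distrib, Finset.sum_ite_mem, Finset.univ_inter, fibreShift_along]
    simp only [Pi.add_apply, add_div, add_mul, Finset.sum_add_distrib]
    congr 1
    rw [Finset.sum_eq_single j (fun i _ hij => by rw [Pi.single_eq_of_ne hij, zero_div, zero_mul])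
      (fun h => absurd (Finset.mem_univ j) h), Pi.single_eq_same, logDenominator,
      if_pos (hJ hj), ← Finset.sum_mul, div_mul_eq_mul_div, mul_div_assoc]

theorem prod_toCoord_eq_zero_iff (P : AdaptedPatch (κ := κ) N L) {y : κ → ℂ} :
    ∏ i ∈ P.logChart.poles, P.patch.toCoord y i = 0 ↔ ∏ i ∈ P.logChart.poles, y i = 0 := by
  cases P with
  | off c hL => rfl
  | along c J hL hJ j hj => exact prod_blowDown_eq_zero_iff hJ hj

/-- The logarithmic coordinates of the blow up of `M` of an adapted patch. -/
def blowUpChart (P : AdaptedPatch (κ := κ) N L) (x₀ : BlowUp κ L) :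
    LogChart (κ := κ) (BlowUp.proj κ L ⁻¹' N) where
  chart := P.patch.affineChart x₀
  poles := P.logChart.poles
  isChart := P.patch.isCoordinateChart_affineChart x₀
  divisor := by
    intro x hx
    have hchart := BlowUpPatch.chart_proj hx
    have hsource := BlowUpPatch.proj_mem_source hx
    rw [patch_chart] at hchart hsource
    rw [mem_preimage, P.logChart.divisor _ hsource, hchart, prod_toCoord_eq_zero_iff]

variable [IsManifold 𝓘(ℂ, κ → ℂ) ω M]

/-- The patch of the blow up of the logarithmic cotangent bundle of an adapted patch. -/
def bundlePatch (p₀ : LogCotangent κ N) : AdaptedPatch (κ := κ) N L →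
    BlowUpPatch (κ := κ ⊕ κ) (LogCotangent.proj κ N ⁻¹' L)
  | off c hL => .off (LogCotangent.bundleChart c p₀)
      (LogCotangent.isCoordinateChart_bundleChart c p₀) (Set.disjoint_left.2 fun _ hp hp' =>
        hL.le_bot ⟨LogCotangent.mem_bundleChart_source.1 hp, hp'⟩)
  | along c J hL _ j hj => .along (LogCotangent.bundleChart c p₀)
      (LogCotangent.isCoordinateChart_bundleChart c p₀) (J.map Function.Embedding.inl)
      (LogCotangent.isCoordinateSubspace_bundleChart hL) (Sum.inl j)
      (Finset.mem_map_of_mem Function.Embedding.inl hj)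

variable (P : AdaptedPatch (κ := κ) N L) (p₀ : LogCotangent κ N)

theorem bundlePatch_chart :
    (P.bundlePatch p₀).chart = LogCotangent.bundleChart P.logChart p₀ := by
  cases P <;> rfl

theorem bundlePatch_toCoord (w : κ ⊕ κ → ℂ) :
    (P.bundlePatch p₀).toCoord w = Sum.elim (P.patch.toCoord (w ∘ Sum.inl)) (w ∘ Sum.inr) := by
  cases P with
  | off c hL => exact (Sum.elim_comp_inl_inr w).symm
  | along c J hL hJ j hj => exact blowDown_map_inl J j w

theorem mem_bundlePatch_dom {w : κ ⊕ κ → ℂ} :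
    (P.bundlePatch p₀).toCoord w ∈ (P.bundlePatch p₀).chart.target ↔
      P.patch.toCoord (w ∘ Sum.inl) ∈ P.patch.chart.target := by
  rw [bundlePatch_chart, bundlePatch_toCoord, LogCotangent.mem_bundleChart_target, patch_chart]
  rfl

end AdaptedPatch

end Adapted

/-! ### The isomorphism of the two blow ups -/

section Isomorphism

open PatchFamily

variable {κ : Type} [Fintype κ] {M : Type*} [TopologicalSpace M] [ChartedSpace (κ → ℂ) M]
  {N L : Set M}

theorem IsTrivialCenter.subset (hL : IsTrivialCenter κ N L) : L ⊆ N := by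
  intro o ho
  obtain ⟨e, I, J, -, hoe, hzero, hI, -, hJI, hcard⟩ := hL.2 o ho
  obtain ⟨j, hj⟩ := Finset.card_pos.1 (by omega : 0 < J.card)
  exact (hI o hoe).2 (Finset.prod_eq_zero (hJI hj) (by rw [hzero, Pi.zero_apply]))

namespace AdaptedPatch

variable (P : AdaptedPatch (κ := κ) N L)

/-- The linear map between the coordinates of the two bundles which adds the `fibreShift` to the
fibre coordinates. -/
def shift : (κ ⊕ κ → ℂ) ≃L[ℂ] (κ ⊕ κ → ℂ) :=
  LinearEquiv.toContinuousLinearEquiv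
    { toFun := fun w => Sum.elim (w ∘ Sum.inl) (w ∘ Sum.inr + P.fibreShift (w ∘ Sum.inr))
      invFun := fun w => Sum.elim (w ∘ Sum.inl) (w ∘ Sum.inr - P.fibreShift (w ∘ Sum.inr))
      map_add' := fun v w => by
        funext k
        cases k <;> simp [Pi.add_comp, add_add_add_comm]
      map_smul' := fun a w => by
        funext k
        cases k <;> simp [Pi.smul_comp, mul_add]
      left_inv := fun w => by
        funext k
        cases k <;> simp [P.fibreShift_fibreShift]
      right_inv := fun w => by
        funext k
        cases k <;> simp [P.fibreShift_fibreShift] }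

theorem shift_apply (w : κ ⊕ κ → ℂ) :
    P.shift w = Sum.elim (w ∘ Sum.inl) (w ∘ Sum.inr + P.fibreShift (w ∘ Sum.inr)) := rfl

end AdaptedPatch

variable [IsManifold 𝓘(ℂ, κ → ℂ) ω M]

local notation "ρ" => BlowUp.proj κ L
local notation "π" => LogCotangent.proj κ N
local notation "ϖ" => LogCotangent.proj κ (BlowUp.proj κ L ⁻¹' N)
local notation "τ" => BlowUp.proj (κ ⊕ κ) (LogCotangent.proj κ N ⁻¹' L)

theorem IsNormalCrossings.exists_logChart_disjoint (hN : IsNormalCrossings κ N) (hL : IsClosed L)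
    {o : M} (ho : o ∉ L) :
    ∃ c : LogChart (κ := κ) N, o ∈ c.chart.source ∧ Disjoint c.chart.source L := by
  obtain ⟨c, hc⟩ := hN.exists_logChart o
  exact ⟨⟨c.chart.restrOpen Lᶜ hL.isOpen_compl, c.poles,
    isCoordinateChart_iff.2 ((isCoordinateChart_iff.1 c.isChart).restrOpen _),
    fun x hx => c.divisor x hx.1⟩, ⟨hc, ho⟩, disjoint_left.2 fun _ hx => hx.2⟩

theorem AdaptedPatch.exists_mem_affineChart_source (hN : IsNormalCrossings κ N)
    (hL : IsTrivialCenter κ N L) (x : BlowUp κ L) :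
    ∃ P : AdaptedPatch (κ := κ) N L, x ∈ (P.patch.affineChart x).source := by
  by_cases hx : ρ x ∈ L
  · obtain ⟨e, I, J, he, hoe, -, hI, hJ, hJI, -⟩ := hL.2 _ hx
    obtain ⟨j, hj, y, hy, hxy⟩ := BlowUp.exists_mk_along hx he hoe hJ
    exact ⟨.along ⟨e, I, he, hI⟩ J hJ hJI j hj, BlowUpPatch.mem_affineChart_source.2 ⟨y, hy, hxy⟩⟩
  · obtain ⟨c, hoc, hc⟩ := hN.exists_logChart_disjoint hL.1 hx
    obtain ⟨y, hy, hxy⟩ := BlowUp.exists_mk_off hx c.isChart hoc hc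
    exact ⟨.off c hc, BlowUpPatch.mem_affineChart_source.2 ⟨y, hy, hxy⟩⟩

theorem IsTrivialCenter.isNormalCrossings_preimage (hN : IsNormalCrossings κ N)
    (hL : IsTrivialCenter κ N L) : IsNormalCrossings κ (ρ ⁻¹' N) := by
  intro x
  obtain ⟨P, hx⟩ := AdaptedPatch.exists_mem_affineChart_source hN hL x
  obtain ⟨e, K, -, he, hxe, hzero, -, hK, -⟩ :=
    (P.blowUpChart x).divisor.exists_centered (P.blowUpChart x).isChart hx Filter.univ_mem
  exact ⟨e, K, he, hxe, hzero, hK⟩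

theorem AdaptedPatch.exists_mem_bundlePatch_source (hN : IsNormalCrossings κ N)
    (hL : IsTrivialCenter κ N L) (p₀ : LogCotangent κ N) (x : BlowUp (κ ⊕ κ) (π ⁻¹' L)) :
    ∃ P : AdaptedPatch (κ := κ) N L, x ∈ ((P.bundlePatch p₀).affineChart x).source := by
  by_cases hx : τ x ∈ π ⁻¹' L
  · obtain ⟨e, I, J, he, hoe, -, hI, hJ, hJI, -⟩ := hL.2 _ hx
    let c : LogChart (κ := κ) N := ⟨e, I, he, hI⟩
    obtain ⟨j', hj', y, hy, hxy⟩ := BlowUp.exists_mk_along hx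
      (LogCotangent.isCoordinateChart_bundleChart c p₀)
      (LogCotangent.mem_bundleChart_source.2 hoe)
      (LogCotangent.isCoordinateSubspace_bundleChart (c := c) hJ)
    obtain ⟨j, hj, rfl⟩ := Finset.mem_map.1 hj'
    exact ⟨.along c J hJ hJI j hj, BlowUpPatch.mem_affineChart_source.2 ⟨y, hy, hxy⟩⟩
  · obtain ⟨c, hoc, hc⟩ := hN.exists_logChart_disjoint hL.1 hx
    obtain ⟨y, hy, hxy⟩ := BlowUp.exists_mk_off hx (LogCotangent.isCoordinateChart_bundleChart c p₀)
      (LogCotangent.mem_bundleChart_source.2 hoc) (disjoint_left.2 fun _ hp hp' =>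
        hc.le_bot ⟨LogCotangent.mem_bundleChart_source.1 hp, hp'⟩)
    exact ⟨.off c hc, BlowUpPatch.mem_affineChart_source.2 ⟨y, hy, hxy⟩⟩

variable (N L) in
/-- The relation whose graph is the isomorphism: `x` and `p` lie over the same point of `M` and,
outside `N`, the covector of `p` is the pull back of the covector of `τ x` under `ρ`. -/
structure IsCorresponding (x : BlowUp (κ ⊕ κ) (π ⁻¹' L)) (p : LogCotangent κ (ρ ⁻¹' N)) : Prop where
  proj_eq : π (τ x) = ρ (ϖ p)
  covector_eq : π (τ x) ∉ N → (LogCotangent.covector κ (ρ ⁻¹' N) p : (κ → ℂ) →L[ℂ] ℂ) =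
    (LogCotangent.covector κ N (τ x) : (κ → ℂ) →L[ℂ] ℂ).comp
      (mfderiv 𝓘(ℂ, κ → ℂ) 𝓘(ℂ, κ → ℂ) ρ (ϖ p) : (κ → ℂ) →L[ℂ] (κ → ℂ))

namespace AdaptedPatch

variable (P : AdaptedPatch (κ := κ) N L)

theorem logCovector_add_fibreShift {x₀ x : BlowUp κ L}
    (hx : x ∈ (P.patch.affineChart x₀).source) (hN : ρ x ∉ N) (ξ : κ → ℂ) :
    logCovector (P.patch.affineChart x₀) P.logChart.poles (ξ + P.fibreShift ξ) x =
      (logCovector P.logChart.chart P.logChart.poles ξ (ρ x)).comp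
        (mfderiv 𝓘(ℂ, κ → ℂ) 𝓘(ℂ, κ → ℂ) ρ x) := by
  have hchart := BlowUpPatch.chart_proj hx
  have hsource := BlowUpPatch.proj_mem_source hx
  have hderiv := BlowUpPatch.mfderiv_chart_comp_mfderiv_proj hx
  rw [patch_chart] at hchart hsource hderiv
  have hpoles (i : κ) : logDenominator P.logChart.poles
      (P.patch.toCoord (P.patch.affineChart x₀ x)) i ≠ 0 := by
    rw [← hchart]
    exact P.logChart.logDenominator_ne_zero hsource hN i
  ext v
  have hcomp : ((logCovector P.logChart.chart P.logChart.poles ξ (ρ x)).comp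
      (mfderiv 𝓘(ℂ, κ → ℂ) 𝓘(ℂ, κ → ℂ) ρ x)) v =
      logCovector P.logChart.chart P.logChart.poles ξ (ρ x)
        (mfderiv 𝓘(ℂ, κ → ℂ) 𝓘(ℂ, κ → ℂ) ρ x v) := rfl
  rw [hcomp, logCovector_apply, logCovector_apply, hchart]
  refine (P.sum_div_logDenominator_mul (P.patch.affineChart x₀ x)
    (mfderiv 𝓘(ℂ, κ → ℂ) 𝓘(ℂ, κ → ℂ) (P.patch.affineChart x₀) x v) ξ hpoles).trans ?_
  exact Finset.sum_congr rfl fun i _ =>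
    congrArg _ (congrFun (DFunLike.congr_fun hderiv v) i).symm

theorem isCorresponding_of_bundleChart {x : BlowUp (κ ⊕ κ) (π ⁻¹' L)}
    {p : LogCotangent κ (ρ ⁻¹' N)} {p₀ : LogCotangent κ N} {x₀ : BlowUp κ L}
    {p₁ : LogCotangent κ (ρ ⁻¹' N)} (hp : ϖ p ∈ (P.patch.affineChart x₀).source)
    (hbase : π (τ x) = ρ (ϖ p)) {ξ : κ → ℂ}
    (hx : LogCotangent.bundleChart P.logChart p₀ (τ x) ∘ Sum.inr = ξ)
    (hfibre : LogCotangent.bundleChart (P.blowUpChart x₀) p₁ p ∘ Sum.inr = ξ + P.fibreShift ξ) :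
    IsCorresponding N L x p := by
  refine ⟨hbase, fun hN => ?_⟩
  have hsource : π (τ x) ∈ P.logChart.chart.source := by
    rw [hbase, ← patch_chart]
    exact BlowUpPatch.proj_mem_source hp
  have hN' : ρ (ϖ p) ∉ N := hbase ▸ hN
  have hcovector := LogCotangent.covector_eq_logCovector (p₀ := p₀) hsource hN
  have hcovector' := LogCotangent.covector_eq_logCovector (p₀ := p₁) (c := P.blowUpChart x₀) hp hN'
  rw [hx, hbase] at hcovector
  rw [hfibre] at hcovector'
  rw [hcovector]
  exact hcovector'.trans (P.logCovector_add_fibreShift hp hN' ξ)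

variable (p₀ : LogCotangent κ N) (x₀ : BlowUp κ L)
  (x₁ : BlowUp (κ ⊕ κ) (LogCotangent.proj κ N ⁻¹' L))
  (p₁ : LogCotangent κ (BlowUp.proj κ L ⁻¹' N))

/-- The isomorphism in adapted coordinates; the values of the inverses of the charts outside their
targets are the arbitrary points `p₀`, `x₀`, `x₁` and `p₁`. -/
def localIso : OpenPartialHomeomorph (BlowUp (κ ⊕ κ) (π ⁻¹' L)) (LogCotangent κ (ρ ⁻¹' N)) :=
  (((P.bundlePatch p₀).affineChart x₁).trans P.shift.toHomeomorph.toOpenPartialHomeomorph).trans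
    (LogCotangent.bundleChart (P.blowUpChart x₀) p₁).symm

theorem isBiholomorphic_localIso : IsBiholomorphic (κ ⊕ κ) (P.localIso p₀ x₀ x₁ p₁) := by
  have hshift : IsBiholomorphic (κ ⊕ κ) P.shift.toHomeomorph.toOpenPartialHomeomorph :=
    ⟨P.shift.contDiff.contMDiff.contMDiffOn, P.shift.symm.contDiff.contMDiff.contMDiffOn⟩
  exact ((isCoordinateChart_iff.1 ((P.bundlePatch p₀).isCoordinateChart_affineChart x₁)).trans
    hshift).trans (isCoordinateChart_iff.1
      (LogCotangent.isCoordinateChart_bundleChart (P.blowUpChart x₀) p₁)).symm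

variable {p₀ x₀ x₁ p₁}

theorem localIso_point {w : κ ⊕ κ → ℂ}
    (hw : (P.bundlePatch p₀).toCoord w ∈ (P.bundlePatch p₀).chart.target)
    (hw' : w ∘ Sum.inl ∈ (P.blowUpChart x₀).chart.target) :
    P.localIso p₀ x₀ x₁ p₁ ((P.bundlePatch p₀).point hw) =
      (P.blowUpChart x₀).point hw' (w ∘ Sum.inr + P.fibreShift (w ∘ Sum.inr)) := by
  change (LogCotangent.bundleChart (P.blowUpChart x₀) p₁).symm
    (P.shift ((P.bundlePatch p₀).affineChart x₁ ((P.bundlePatch p₀).point hw))) = _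
  rw [BlowUpPatch.affineChart_point, P.shift_apply]
  exact LogCotangent.bundleChart_symm
    (w := Sum.elim (w ∘ Sum.inl) (w ∘ Sum.inr + P.fibreShift (w ∘ Sum.inr))) hw'

theorem localIso_source :
    (P.localIso p₀ x₀ x₁ p₁).source = ((P.bundlePatch p₀).affineChart x₁).source := by
  refine Subset.antisymm (fun x hx => hx.1.1) fun x hx => ⟨⟨hx, trivial⟩, ?_⟩
  obtain ⟨w, hw, rfl⟩ := BlowUpPatch.mem_affineChart_source.1 hx
  change P.shift ((P.bundlePatch p₀).affineChart x₁ ((P.bundlePatch p₀).point hw)) ∘ Sum.inl ∈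
    (P.blowUpChart x₀).chart.target
  rw [BlowUpPatch.affineChart_point]
  exact (P.mem_bundlePatch_dom (w := w) p₀).1 hw

theorem point_mem_localIso_source {w : κ ⊕ κ → ℂ}
    (hw : (P.bundlePatch p₀).toCoord w ∈ (P.bundlePatch p₀).chart.target) :
    (P.bundlePatch p₀).point hw ∈ (P.localIso p₀ x₀ x₁ p₁).source := by
  rw [localIso_source]
  exact BlowUpPatch.point_mem_affineChart_source hw

theorem proj_bundlePatch_point {w : κ ⊕ κ → ℂ}
    (hw : (P.bundlePatch p₀).toCoord w ∈ (P.bundlePatch p₀).chart.target)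
    (hw' : P.patch.toCoord (w ∘ Sum.inl) ∈ P.logChart.chart.target) :
    τ ((P.bundlePatch p₀).point hw) = P.logChart.point hw' (w ∘ Sum.inr) := by
  have hsymm : (P.bundlePatch p₀).chart.symm ((P.bundlePatch p₀).toCoord w) =
      (LogCotangent.bundleChart P.logChart p₀).symm
        (Sum.elim (P.patch.toCoord (w ∘ Sum.inl)) (w ∘ Sum.inr)) := by
    rw [bundlePatch_chart, bundlePatch_toCoord]
  rw [BlowUpPatch.proj_point, hsymm]
  exact LogCotangent.bundleChart_symm
    (w := Sum.elim (P.patch.toCoord (w ∘ Sum.inl)) (w ∘ Sum.inr)) hw'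

theorem isCorresponding_localIso {x : BlowUp (κ ⊕ κ) (π ⁻¹' L)}
    (hx : x ∈ (P.localIso p₀ x₀ x₁ p₁).source) :
    IsCorresponding N L x (P.localIso p₀ x₀ x₁ p₁ x) := by
  rw [localIso_source] at hx
  obtain ⟨w, hw, rfl⟩ := BlowUpPatch.mem_affineChart_source.1 hx
  have hdom := (P.mem_bundlePatch_dom p₀).1 hw
  have hmem : w ∘ Sum.inl ∈ (P.blowUpChart x₀).chart.target := hdom
  have hmem' : P.patch.toCoord (w ∘ Sum.inl) ∈ P.logChart.chart.target := by
    rw [← patch_chart]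
    exact hdom
  have hproj := P.proj_bundlePatch_point hw hmem'
  have hsymm : (P.blowUpChart x₀).chart.symm (w ∘ Sum.inl) = P.patch.point hdom :=
    BlowUpPatch.affineChart_symm hdom
  have hbase : ρ (P.patch.point hdom) = P.logChart.chart.symm (P.patch.toCoord (w ∘ Sum.inl)) := by
    rw [BlowUpPatch.proj_point, patch_chart]
  rw [P.localIso_point hw hmem]
  refine P.isCorresponding_of_bundleChart (x₀ := x₀) (p₀ := p₀) (p₁ := p₁) (ξ := w ∘ Sum.inr)
    ((P.blowUpChart x₀).chart.map_target hmem) ?_ ?_ ?_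
  · rw [hproj]
    exact (congrArg ρ hsymm).trans hbase |>.symm
  · rw [hproj, LogCotangent.bundleChart_point, Sum.elim_comp_inr]
  · rw [LogCotangent.bundleChart_point, Sum.elim_comp_inr]

variable {u : κ → ℂ} (hu : u ∈ (P.blowUpChart x₀).chart.target) (η : κ → ℂ)

theorem localIso_bundlePatch_point :
    P.localIso p₀ x₀ x₁ p₁ ((P.bundlePatch p₀).point (y := Sum.elim u (η - P.fibreShift η))
        ((P.mem_bundlePatch_dom p₀).2 hu)) =
      (P.blowUpChart x₀).point hu η := by
  refine (P.localIso_point _ hu).trans ?_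
  refine LogChart.point_congr _ _ _ rfl ?_
  rw [Sum.elim_comp_inr, map_sub, fibreShift_fibreShift, sub_zero, sub_add_cancel]

theorem point_mem_localIso_target :
    (P.blowUpChart x₀).point hu η ∈ (P.localIso p₀ x₀ x₁ p₁).target := by
  rw [← P.localIso_bundlePatch_point (p₀ := p₀) (x₁ := x₁) (p₁ := p₁)]
  exact OpenPartialHomeomorph.map_source _ (P.point_mem_localIso_source _)

theorem proj_localIso_symm_point (hu' : P.patch.toCoord u ∈ P.logChart.chart.target) :
    τ ((P.localIso p₀ x₀ x₁ p₁).symm ((P.blowUpChart x₀).point hu η)) =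
      P.logChart.point hu' (η - P.fibreShift η) := by
  rw [← P.localIso_bundlePatch_point (p₀ := p₀) (x₁ := x₁) (p₁ := p₁),
    OpenPartialHomeomorph.left_inv _ (P.point_mem_localIso_source _)]
  exact P.proj_bundlePatch_point (w := Sum.elim u (η - P.fibreShift η)) _ hu'

end AdaptedPatch

theorem BlowUp.mfderiv_proj_surjective (hL : IsClosed L) {x : BlowUp κ L} (hx : ρ x ∉ L) :
    Function.Surjective (mfderiv 𝓘(ℂ, κ → ℂ) 𝓘(ℂ, κ → ℂ) ρ x) := by
  obtain ⟨φ, hφ, hxφ, -, hφρ⟩ := BlowUp.exists_isBiholomorphic hL hx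
  have hderiv : mfderiv 𝓘(ℂ, κ → ℂ) 𝓘(ℂ, κ → ℂ) ρ x = mfderiv 𝓘(ℂ, κ → ℂ) 𝓘(ℂ, κ → ℂ) φ x :=
    (Filter.eventuallyEq_of_mem (φ.open_source.mem_nhds hxφ) fun z hz =>
      (hφρ z hz).symm).mfderiv_eq
  intro v
  refine ⟨mfderiv 𝓘(ℂ, κ → ℂ) 𝓘(ℂ, κ → ℂ) φ.symm (φ x) v, ?_⟩
  rw [hderiv]
  exact DFunLike.congr_fun (hφ.mfderiv_symm_comp hxφ) v

namespace IsCorresponding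

variable {x x' : BlowUp (κ ⊕ κ) (LogCotangent.proj κ N ⁻¹' L)}
  {p p' : LogCotangent κ (BlowUp.proj κ L ⁻¹' N)}

theorem eq_right (hLN : L ⊆ N) (h : IsCorresponding N L x p) (h' : IsCorresponding N L x p')
    (hx : π (τ x) ∉ N) : p = p' := by
  have hp : ρ (ϖ p) ∉ N := h.proj_eq ▸ hx
  have hbase : ϖ p = ϖ p' :=
    BlowUp.eq_of_proj_eq (h.proj_eq.symm.trans h'.proj_eq) fun hpL => hp (hLN hpL)
  have hcovector := h.covector_eq hx
  rw [hbase] at hcovector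
  exact LogCotangent.eq_of_covector_eq hbase hp (hcovector.trans (h'.covector_eq hx).symm)

theorem eq_left (hL : IsClosed L) (hLN : L ⊆ N) (h : IsCorresponding N L x p)
    (h' : IsCorresponding N L x' p) (hp : ρ (ϖ p) ∉ N) : x = x' := by
  have hx : π (τ x) ∉ N := by rwa [h.proj_eq]
  have hx' : π (τ x') ∉ N := by rwa [h'.proj_eq]
  refine BlowUp.eq_of_proj_eq (LogCotangent.eq_of_covector_eq (h.proj_eq.trans h'.proj_eq.symm) hx
    (ContinuousLinearMap.ext fun v => ?_)) fun hxL => hx (hLN hxL)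
  obtain ⟨w, rfl⟩ := BlowUp.mfderiv_proj_surjective hL (fun hpL => hp (hLN hpL)) v
  exact DFunLike.congr_fun ((h.covector_eq hx).symm.trans (h'.covector_eq hx')) w

end IsCorresponding

namespace AdaptedPatch

theorem exists_mem_localIso_source (hN : IsNormalCrossings κ N) (hL : IsTrivialCenter κ N L)
    (x : BlowUp (κ ⊕ κ) (π ⁻¹' L)) :
    ∃ (P : AdaptedPatch (κ := κ) N L) (p₀ : LogCotangent κ N) (x₀ : BlowUp κ L)
      (p₁ : LogCotangent κ (ρ ⁻¹' N)), x ∈ (P.localIso p₀ x₀ x p₁).source := by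
  obtain ⟨P, hx⟩ := exists_mem_bundlePatch_source hN hL (τ x) x
  obtain ⟨w, hw, -⟩ := BlowUpPatch.mem_affineChart_source.1 hx
  have hdom := (P.mem_bundlePatch_dom _).1 hw
  refine ⟨P, τ x, P.patch.point hdom,
    (P.blowUpChart (P.patch.point hdom)).point (u := w ∘ Sum.inl) hdom 0, ?_⟩
  rwa [localIso_source]

theorem exists_mem_localIso_target (hN : IsNormalCrossings κ N) (hL : IsTrivialCenter κ N L)
    (p : LogCotangent κ (ρ ⁻¹' N)) :
    ∃ (P : AdaptedPatch (κ := κ) N L) (p₀ : LogCotangent κ N)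
      (x₁ : BlowUp (κ ⊕ κ) (π ⁻¹' L)), ϖ p ∈ (P.blowUpChart (ϖ p)).chart.source ∧
      p ∈ (P.localIso p₀ (ϖ p) x₁ p).target := by
  obtain ⟨P, hp⟩ := exists_mem_affineChart_source hN hL (ϖ p)
  obtain ⟨u, hu, η, hpη⟩ := LogCotangent.exists_eq_point (P.blowUpChart (ϖ p)) hp
  let p₀ : LogCotangent κ N := P.logChart.point (u := P.patch.toCoord u)
    (by rw [← patch_chart]; exact hu) 0
  let x₁ := (P.bundlePatch p₀).point (y := Sum.elim u 0) ((P.mem_bundlePatch_dom p₀).2 hu)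
  have hmem := P.point_mem_localIso_target (p₀ := p₀) (x₁ := x₁) (p₁ := p) hu η
  rw [← hpη] at hmem
  exact ⟨P, p₀, x₁, hp, hmem⟩

end AdaptedPatch

theorem dense_proj_proj_notMem (hN : IsNormalCrossings κ N) (hL : IsTrivialCenter κ N L) :
    Dense {x : BlowUp (κ ⊕ κ) (π ⁻¹' L) | π (τ x) ∉ N} := by
  intro x
  obtain ⟨P, p₀, x₀, p₁, hx⟩ := AdaptedPatch.exists_mem_localIso_source hN hL x
  set φ := P.localIso p₀ x₀ x p₁
  have himage : φ.IsImage {x | π (τ x) ∉ N} {p | ϖ p ∉ ρ ⁻¹' N} := fun z hz =>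
    not_congr (iff_of_eq (congrArg (· ∈ N) (P.isCorresponding_localIso hz).proj_eq.symm))
  exact (himage.closure hx).1 (LogCotangent.dense_proj_notMem _)

theorem exists_diffeomorph [T2Space M] (hN : IsNormalCrossings κ N) (hL : IsTrivialCenter κ N L) :
    ∃ Φ : BlowUp (κ ⊕ κ) (π ⁻¹' L) ≃ₘ^ω⟮𝓘(ℂ, κ ⊕ κ → ℂ), 𝓘(ℂ, κ ⊕ κ → ℂ)⟯ LogCotangent κ (ρ ⁻¹' N),
      (∀ x, IsCorresponding N L x (Φ x)) ∧
      ∀ φ : OpenPartialHomeomorph (BlowUp (κ ⊕ κ) (π ⁻¹' L)) (LogCotangent κ (ρ ⁻¹' N)),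
        (∀ z ∈ φ.source, IsCorresponding N L z (φ z)) → EqOn Φ φ φ.source := by
  have : T2Space (LogCotangent κ N) := LogCotangent.t2Space
  have : T2Space (BlowUp (κ ⊕ κ) (π ⁻¹' L)) := BlowUp.t2Space
  have : T2Space (BlowUp κ L) := BlowUp.t2Space
  have : T2Space (LogCotangent κ (ρ ⁻¹' N)) := LogCotangent.t2Space
  refine exists_diffeomorph_of_rel (dense_proj_proj_notMem hN hL)
    (fun x hx p p' h h' => h.eq_right hL.subset h' hx)
    (LogCotangent.dense_proj_notMem (κ := κ) (N := ρ ⁻¹' N))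
    (fun p hp x x' h h' => h.eq_left hL.1 hL.subset h' hp) (fun x => ?_) (fun p => ?_)
  · obtain ⟨P, p₀, x₀, p₁, hx⟩ := AdaptedPatch.exists_mem_localIso_source hN hL x
    exact ⟨_, P.isBiholomorphic_localIso _ _ _ _, fun _ => P.isCorresponding_localIso, hx⟩
  · obtain ⟨P, p₀, x₁, -, hp⟩ := AdaptedPatch.exists_mem_localIso_target hN hL p
    exact ⟨_, P.isBiholomorphic_localIso _ _ _ _, fun _ => P.isCorresponding_localIso, hp⟩

namespace IsCorresponding

variable {Φ : BlowUp (κ ⊕ κ) (LogCotangent.proj κ N ⁻¹' L)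
    ≃ₘ^ω⟮𝓘(ℂ, κ ⊕ κ → ℂ), 𝓘(ℂ, κ ⊕ κ → ℂ)⟯ LogCotangent κ (BlowUp.proj κ L ⁻¹' N)}

theorem mfderiv_proj_mfderiv_proj (h : ∀ x, IsCorresponding N L x (Φ x))
    (x : BlowUp (κ ⊕ κ) (π ⁻¹' L)) (v : TangentSpace 𝓘(ℂ, κ ⊕ κ → ℂ) x) :
    (mfderiv 𝓘(ℂ, κ → ℂ) 𝓘(ℂ, κ → ℂ) ρ (ϖ (Φ x)) (mfderiv 𝓘(ℂ, κ ⊕ κ → ℂ) 𝓘(ℂ, κ → ℂ) ϖ (Φ x)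
      (mfderiv 𝓘(ℂ, κ ⊕ κ → ℂ) 𝓘(ℂ, κ ⊕ κ → ℂ) Φ x v)) : κ → ℂ) =
    mfderiv 𝓘(ℂ, κ ⊕ κ → ℂ) 𝓘(ℂ, κ → ℂ) π (τ x)
      (mfderiv 𝓘(ℂ, κ ⊕ κ → ℂ) 𝓘(ℂ, κ ⊕ κ → ℂ) τ x v) := by
  have hω : (ω : WithTop ℕ∞) ≠ 0 := by simp
  have hΦ := Φ.contMDiff_toFun.mdifferentiable hω
  have hϖ := (LogCotangent.contMDiff_proj (κ := κ) (N := ρ ⁻¹' N)).mdifferentiable hω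
  have hρ := (BlowUp.contMDiff_proj (κ := κ) (L := L)).mdifferentiable hω
  have hτ := (BlowUp.contMDiff_proj (κ := κ ⊕ κ) (L := π ⁻¹' L)).mdifferentiable hω
  have hπ := (LogCotangent.contMDiff_proj (κ := κ) (N := N)).mdifferentiable hω
  have hcomp : ρ ∘ ϖ ∘ Φ = π ∘ τ := funext fun z => (h z).proj_eq.symm
  have hcongr (f g : BlowUp (κ ⊕ κ) (π ⁻¹' L) → M) (hfg : f = g) :
      (mfderiv 𝓘(ℂ, κ ⊕ κ → ℂ) 𝓘(ℂ, κ → ℂ) f x v : κ → ℂ) =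
        mfderiv 𝓘(ℂ, κ ⊕ κ → ℂ) 𝓘(ℂ, κ → ℂ) g x v := by
    subst hfg
    rfl
  have hleft := mfderiv_comp_apply x (hρ _) ((hϖ.comp hΦ) x) v
  rw [mfderiv_comp_apply x (hϖ _) (hΦ x) v] at hleft
  exact hleft.symm.trans ((hcongr _ _ hcomp).trans (mfderiv_comp_apply x (hπ _) (hτ x) v))

theorem pullbackForm_eq (h : ∀ x, IsCorresponding N L x (Φ x)) {x : BlowUp (κ ⊕ κ) (π ⁻¹' L)}
    (hx : π (τ x) ∉ N) :
    pullbackForm (κ ⊕ κ) (κ ⊕ κ) Φ (LogCotangent.canonicalForm κ (ρ ⁻¹' N)) x =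
      pullbackForm (κ ⊕ κ) (κ ⊕ κ) τ (LogCotangent.canonicalForm κ N) x := by
  refine ContinuousLinearMap.ext fun v => ?_
  exact (DFunLike.congr_fun ((h x).covector_eq hx) _).trans
    (congrArg (LogCotangent.covector κ N (τ x) : (κ → ℂ) →L[ℂ] ℂ) (mfderiv_proj_mfderiv_proj h x v))

theorem isLogSymplecticPotential (hN : IsNormalCrossings κ N) (hL : IsTrivialCenter κ N L)
    (h : ∀ x, IsCorresponding N L x (Φ x)) :
    IsLogSymplecticPotential (κ ⊕ κ) (τ ⁻¹' (π ⁻¹' N))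
      (pullbackForm (κ ⊕ κ) (κ ⊕ κ) τ (LogCotangent.canonicalForm κ N)) := by
  have hpreimage : τ ⁻¹' (π ⁻¹' N) = Φ ⁻¹' (ϖ ⁻¹' (ρ ⁻¹' N)) := by
    ext x
    simp only [mem_preimage, (h x).proj_eq]
  rw [hpreimage]
  refine (LogCotangent.isLogSymplecticPotential (hL.isNormalCrossings_preimage hN)).pullback Φ
    fun x hx => (pullbackForm_eq h ?_).symm
  rw [(h x).proj_eq]
  exact hx

end IsCorresponding

namespace LogCotangent

theorem isMultiple_iff_point {t : ℂ} {p q : LogCotangent κ N} :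
    IsMultiple κ N t p q ↔ ∃ (c : LogChart (κ := κ) N) (u : κ → ℂ)
      (hu : u ∈ c.chart.target) (ξ : κ → ℂ), p = c.point hu ξ ∧ q = c.point hu (t • ξ) := by
  constructor
  · rintro ⟨c, y, z, rfl, rfl, hbase, hfibre⟩
    exact ⟨c, y.1 ∘ Sum.inl, y.2, y.1 ∘ Sum.inr, c.mk_eq_point y,
      (c.mk_eq_point z).trans (c.point_congr _ _ (funext hbase) (funext hfibre))⟩
  · rintro ⟨c, u, hu, ξ, rfl, rfl⟩
    exact ⟨c, ⟨Sum.elim u ξ, hu⟩, ⟨Sum.elim u (t • ξ), hu⟩, rfl, rfl, fun _ => rfl, fun _ => rfl⟩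

theorem IsMultiple.exists_point {t : ℂ} {p q : LogCotangent κ N}
    (h : IsMultiple κ N t p q) (c : LogChart (κ := κ) N) (hc : π p ∈ c.chart.source) :
    ∃ (u : κ → ℂ) (hu : u ∈ c.chart.target) (ξ : κ → ℂ),
      p = c.point hu ξ ∧ q = c.point hu (t • ξ) := by
  obtain ⟨c', u, hu, ξ, rfl, rfl⟩ := isMultiple_iff_point.1 h
  obtain ⟨A, hA⟩ := c'.exists_point_eq c hu hc
  refine ⟨_, c.chart.map_source hc, _, hA ξ, (hA (t • ξ)).trans (c.point_congr _ _ rfl ?_)⟩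
  funext k
  simp [Finset.mul_sum, mul_assoc]

end LogCotangent

theorem isMultiple_proj_symm (hN : IsNormalCrossings κ N) (hL : IsTrivialCenter κ N L)
    {Φ : BlowUp (κ ⊕ κ) (π ⁻¹' L)
      ≃ₘ^ω⟮𝓘(ℂ, κ ⊕ κ → ℂ), 𝓘(ℂ, κ ⊕ κ → ℂ)⟯ LogCotangent κ (ρ ⁻¹' N)}
    (hΦ : ∀ φ : OpenPartialHomeomorph (BlowUp (κ ⊕ κ) (π ⁻¹' L)) (LogCotangent κ (ρ ⁻¹' N)),
      (∀ z ∈ φ.source, IsCorresponding N L z (φ z)) → EqOn Φ φ φ.source)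
    {t : ℂ} {p q : LogCotangent κ (ρ ⁻¹' N)} (h : LogCotangent.IsMultiple κ (ρ ⁻¹' N) t p q) :
    LogCotangent.IsMultiple κ N t (τ (Φ.symm p)) (τ (Φ.symm q)) := by
  obtain ⟨P, p₀, x₁, hp, -⟩ := AdaptedPatch.exists_mem_localIso_target hN hL p
  obtain ⟨u, hu, η, hpη, hqη⟩ := h.exists_point _ hp
  set φ := P.localIso p₀ (ϖ p) x₁ p
  have hdom : P.patch.toCoord u ∈ P.logChart.chart.target := by
    rw [← AdaptedPatch.patch_chart]
    exact hu
  have hsymm (η : κ → ℂ) : τ (Φ.symm ((P.blowUpChart (ϖ p)).point hu η)) =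
      P.logChart.point hdom (η - P.fibreShift η) := by
    have htarget : (P.blowUpChart (ϖ p)).point hu η ∈ φ.target := P.point_mem_localIso_target hu η
    have heq : Φ (φ.symm ((P.blowUpChart (ϖ p)).point hu η)) = (P.blowUpChart (ϖ p)).point hu η :=
      (hΦ φ (fun _ => P.isCorresponding_localIso) (φ.map_target htarget)).trans
        (φ.right_inv htarget)
    rw [← P.proj_localIso_symm_point (p₀ := p₀) (x₁ := x₁) (p₁ := p) hu η hdom]
    exact congrArg τ (Φ.toEquiv.symm_apply_eq.2 heq.symm)
  refine LogCotangent.isMultiple_iff_point.2 ⟨P.logChart, _, hdom, η - P.fibreShift η,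
    (congrArg (fun r => τ (Φ.symm r)) hpη).trans (hsymm η),
    (congrArg (fun r => τ (Φ.symm r)) hqη).trans ((hsymm (t • η)).trans ?_)⟩
  rw [map_smul, smul_sub]

end Isomorphism

/-! ### Proper inverse images of hypersurfaces -/

section Hypersurfaces

open PatchFamily

variable {κ : Type} [Fintype κ] {M : Type*} [TopologicalSpace M] [ChartedSpace (κ → ℂ) M]
  {N L S : Set M}

theorem IsHypersurface.isClosed (hS : IsHypersurface κ S) : IsClosed S := by
  rw [← isOpen_compl_iff, isOpen_iff_mem_nhds]
  intro o ho
  obtain ⟨U, hU, hoU, f, hf, hfS⟩ := hS.2 o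
  have hcont : ContinuousAt f o := hf.continuousOn.continuousAt (hU.mem_nhds hoU)
  filter_upwards [hU.mem_nhds hoU, hcont.eventually_ne fun h0 => ho ((hfS o hoU).2 h0)]
    with x hx hx0
  exact fun hxS => hx0 ((hfS x hx).1 hxS)

local notation "ρ" => BlowUp.proj κ L
local notation "π" => LogCotangent.proj κ N
local notation "ϖ" => LogCotangent.proj κ (BlowUp.proj κ L ⁻¹' N)
local notation "τ" => BlowUp.proj (κ ⊕ κ) (LogCotangent.proj κ N ⁻¹' L)

theorem BlowUpPatch.mem_properInverseImage_along_iff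
    {e : OpenPartialHomeomorph M (κ → ℂ)} {J : Finset κ} {j : κ} (he : IsCoordinateChart κ e)
    (hJ : IsCoordinateSubspace e J L) (hj : j ∈ J) {V : Set (κ → ℂ)} (hV : IsOpen V)
    {F : (κ → ℂ) → ℂ} (hF : ∀ w ∈ V, blowDown κ J j w ∈ e.target ∧
      (e.symm (blowDown κ J j w) ∈ S ↔ F w = 0)) {x₀ x : BlowUp κ L}
    (hx : x ∈ ((along e he J hJ j hj).affineChart x₀).source)
    (hxV : (along e he J hJ j hj).affineChart x₀ x ∈ V) :
    x ∈ properInverseImage ρ L S ↔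
      (along e he J hJ j hj).affineChart x₀ x ∈ closure {w | w ∈ V ∧ w j ≠ 0 ∧ F w = 0} := by
  set c := (along e he J hJ j hj).affineChart x₀
  have himage : (c.trans (OpenPartialHomeomorph.ofSet V hV)).IsImage (ρ ⁻¹' (S \ L))
      {w | w ∈ V ∧ w j ≠ 0 ∧ F w = 0} := by
    rintro z ⟨hz, hzV⟩
    obtain ⟨hdom, hzero⟩ := hF (c z) hzV
    change c z ∈ V ∧ c z j ≠ 0 ∧ F (c z) = 0 ↔ ρ z ∈ S ∧ ρ z ∉ L
    have hproj : ρ z = e.symm (blowDown κ J j (c z)) := proj_eq_symm hz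
    rw [hproj, along_mem_iff hJ hj hdom, hzero]
    exact ⟨fun h => ⟨h.2.2, h.2.1⟩, fun h => ⟨hzV, h.2, h.1⟩⟩
  exact (himage.closure (x := x) ⟨hx, hxV⟩).symm

variable [IsManifold 𝓘(ℂ, κ → ℂ) ω M]

theorem properInverseImage_subset (hS : IsClosed S) : properInverseImage ρ L S ⊆ ρ ⁻¹' S :=
  closure_minimal (fun _ hx => hx.1) (hS.preimage BlowUp.continuous_proj)

theorem mem_properInverseImage_iff (hS : IsClosed S) {x : BlowUp κ L} (hx : ρ x ∉ L) :
    x ∈ properInverseImage ρ L S ↔ ρ x ∈ S :=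
  ⟨fun h => properInverseImage_subset hS h, fun h => subset_closure ⟨h, hx⟩⟩

theorem BlowUp.interior_preimage_proj (hL : IsClosed L) (hS : interior S = ∅) :
    interior (ρ ⁻¹' S) = ∅ := by
  rw [eq_empty_iff_forall_notMem]
  intro x hx
  obtain ⟨z, hz, hzL⟩ := mem_closure_iff.1 (BlowUp.dense_proj_notMem (κ := κ) (L := L) x) _
    isOpen_interior hx
  obtain ⟨φ, -, hzφ, -, hφρ⟩ := BlowUp.exists_isBiholomorphic hL hzL
  have himage : φ '' (φ.source ∩ interior (ρ ⁻¹' S)) ⊆ interior S := by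
    refine interior_maximal ?_ (φ.isOpen_image_source_inter isOpen_interior)
    rintro _ ⟨w, ⟨hw, hwS⟩, rfl⟩
    rw [hφρ w hw]
    exact mem_preimage.1 (interior_subset hwS)
  rw [hS] at himage
  exact himage ⟨z, ⟨hzφ, hz⟩, rfl⟩

namespace BlowUpPatch

variable (P : BlowUpPatch (κ := κ) L)

theorem frequently_notMem (hL : IsClosed L) (hS : interior S = ∅) {y : κ → ℂ}
    (hy : P.toCoord y ∈ P.chart.target) : ∃ᶠ w in 𝓝 y, P.chart.symm (P.toCoord w) ∉ S := by
  refine fun hmem => notMem_empty (P.point hy) ?_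
  rw [← BlowUp.interior_preimage_proj hL hS, mem_interior_iff_mem_nhds]
  have hsource := P.point_mem_affineChart_source (x₀ := P.point hy) hy
  have htendsto := ((P.affineChart (P.point hy)).continuousAt hsource).tendsto
  rw [affineChart_point] at htendsto
  filter_upwards [(P.affineChart (P.point hy)).open_source.mem_nhds hsource,
    htendsto.eventually hmem] with x hx hxS
  rw [mem_preimage, proj_eq_symm hx]
  exact not_not.1 hxS

variable {e : OpenPartialHomeomorph M (κ → ℂ)} {J : Finset κ} {j : κ}

theorem exists_equation_properInverseImage (hL : IsClosed L) (hS : IsHypersurface κ S)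
    (he : IsCoordinateChart κ e) (hJ : IsCoordinateSubspace e J L) (hj : j ∈ J) {y : κ → ℂ}
    (hy : blowDown κ J j y ∈ e.target) (hyj : y j = 0) :
    ∃ U : Set (BlowUp κ L), IsOpen U ∧ (along e he J hJ j hj).point hy ∈ U ∧
      ∃ f : BlowUp κ L → ℂ, ContMDiffOn 𝓘(ℂ, κ → ℂ) 𝓘(ℂ, ℂ) ω f U ∧
        ∀ x ∈ U, x ∈ properInverseImage ρ L S ↔ f x = 0 := by
  obtain ⟨U, hU, hoU, f, hf, hfS⟩ := hS.2 (e.symm (blowDown κ J j y))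
  set P := along e he J hJ j hj
  let c := P.affineChart (P.point hy)
  let F : (κ → ℂ) → ℂ := fun w => f (e.symm (blowDown κ J j w))
  have hF : AnalyticAt ℂ F y := (he.analyticAt_comp_symm_of_contMDiffAt hy
    (hf.contMDiffAt (hU.mem_nhds hoU))).fun_comp (analyticAt_blowDown J j y)
  have hmem := P.eventually_base_mem hy (hU.mem_nhds hoU)
  have hne : ∃ᶠ w in 𝓝 y, F w ≠ 0 := ((P.frequently_notMem hL hS.1 hy).and_eventually hmem).mono
    fun w hw hw0 => hw.1 ((hfS _ hw.2.2).2 hw0)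
  obtain ⟨V, h, hV, hyV, hVW, hh, hzero⟩ := exists_zero_iff_mem_closure hF hyj hne hmem
  have hVS (w : κ → ℂ) (hw : w ∈ V) :
      blowDown κ J j w ∈ e.target ∧ (e.symm (blowDown κ J j w) ∈ S ↔ F w = 0) :=
    ⟨(hVW hw).1, hfS _ (hVW hw).2⟩
  refine ⟨c.source ∩ c ⁻¹' V, c.isOpen_inter_preimage hV,
    ⟨point_mem_affineChart_source (P := P) hy, ?_⟩, h ∘ c, ?_, fun x hx => ?_⟩
  · have hcy : c (P.point hy) = y := affineChart_point (P := P) hy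
    rwa [mem_preimage, hcy]
  · have hhV : ContMDiffOn 𝓘(ℂ, κ → ℂ) 𝓘(ℂ, ℂ) ω h V :=
      contMDiffOn_iff_contDiffOn.2 (hh.contDiffOn hV.uniqueDiffOn)
    exact hhV.comp ((isCoordinateChart_iff.1 (P.isCoordinateChart_affineChart _)).1.mono
      inter_subset_left) inter_subset_right
  · exact (mem_properInverseImage_along_iff he hJ hj hV hVS hx.1 hx.2).trans (hzero _ hx.2).symm

end BlowUpPatch

theorem isHypersurface_properInverseImage (hL : IsTrivialCenter κ N L) (hS : IsHypersurface κ S) :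
    IsHypersurface κ (properInverseImage ρ L S) := by
  refine ⟨?_, fun o => ?_⟩
  · rw [← subset_empty_iff, ← BlowUp.interior_preimage_proj (κ := κ) hL.1 hS.1]
    exact interior_mono (properInverseImage_subset hS.isClosed)
  · by_cases ho : ρ o ∈ L
    · obtain ⟨e, I, J, he, hoe, -, -, hJ, -, -⟩ := hL.2 _ ho
      obtain ⟨j, hj, y, hy, rfl⟩ := BlowUp.exists_mk_along ho he hoe hJ
      exact BlowUpPatch.exists_equation_properInverseImage hL.1 hS he hJ hj hy
        ((BlowUpPatch.along_mem_iff hJ hj hy).1 ho)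
    · obtain ⟨U, hU, hoU, f, hf, hfS⟩ := hS.2 (ρ o)
      refine ⟨ρ ⁻¹' (U \ L), (hU.sdiff hL.1).preimage BlowUp.continuous_proj, ⟨hoU, ho⟩, f ∘ ρ,
        hf.comp BlowUp.contMDiff_proj.contMDiffOn fun x hx => hx.1, fun x hx => ?_⟩
      rw [mem_properInverseImage_iff hS.isClosed hx.2]
      exact hfS _ hx.1

theorem isNatural_properInverseImage (hL : IsClosed L) (hS : IsHypersurface κ S)
    (hnat : IsNatural κ N S) : IsNatural κ (ρ ⁻¹' N) (properInverseImage ρ L S) := by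
  rintro o ho ⟨e, K, I, he, hoe, -, hK, hIK, hI, hIS⟩
  obtain ⟨z, hze, hzS, hzL⟩ := mem_closure_iff.1 ho _ e.open_source hoe
  obtain ⟨φ, hφ, hzφ, hφL, hφρ⟩ := BlowUp.exists_isBiholomorphic hL hzL
  have hsymm : φ.symm (ρ z) = z := by rw [← hφρ z hzφ, φ.left_inv hzφ]
  have hproj (x : M) (hx : x ∈ φ.target) : ρ (φ.symm x) = x := by
    rw [← hφρ _ (φ.map_target hx), φ.right_inv hx]
  let e₁ := φ.symm.trans e
  have he₁ : IsCoordinateChart κ e₁ := hφ.symm.isCoordinateChart_trans he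
  have hsource (x : M) : x ∈ e₁.source ↔ x ∈ φ.target ∧ φ.symm x ∈ e.source := Iff.rfl
  have hze₁ : ρ z ∈ e₁.source := by
    rw [hsource, hsymm, ← hφρ z hzφ]
    exact ⟨φ.map_source hzφ, hze⟩
  have hK₁ : IsCoordinateDivisor e₁ K N := by
    intro x hx
    obtain ⟨hxφ, hxe⟩ := (hsource x).1 hx
    have hxN := hK _ hxe
    rwa [mem_preimage, hproj x hxφ] at hxN
  have hzI (i : κ) (hi : i ∈ I) : e₁ (ρ z) i = 0 := by
    change e (φ.symm (ρ z)) i = 0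
    rw [hsymm]
    exact (hIS z hze).1 (subset_closure ⟨hzS, hzL⟩) i hi
  obtain ⟨e', K', -, he', hze', hzero, hsub, hK', hKK', heq⟩ :=
    hK₁.exists_centered he₁ hze₁ Filter.univ_mem
  refine hnat _ hzS ⟨e', K', I, he', hze', hzero, hK', fun i hi => hKK' i (hIK hi) (hzI i hi), hI,
    fun x hx => ?_⟩
  obtain ⟨hxφ, hxe⟩ := (hsource x).1 (hsub hx).1
  have hxS := hIS _ hxe
  rw [mem_properInverseImage_iff hS.isClosed (hφL _ (φ.map_target hxφ)), hproj x hxφ] at hxS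
  rw [hxS]
  exact forall₂_congr fun i hi => by
    rw [heq x i (hzI i hi)]
    rfl

theorem properInverseImage_closure (hL : IsClosed L) {A : Set M} (hA : Disjoint A L) :
    properInverseImage ρ L (closure A) = closure (ρ ⁻¹' A) := by
  refine subset_antisymm (closure_minimal ?_ isClosed_closure)
    (closure_mono fun x hx => ⟨subset_closure hx, disjoint_left.1 hA hx⟩)
  rintro x ⟨hx, hxL⟩
  obtain ⟨φ, -, hxφ, -, hφρ⟩ := BlowUp.exists_isBiholomorphic hL hxL
  have himage : φ.IsImage (ρ ⁻¹' A) A := fun z hz => by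
    rw [hφρ z hz]
    rfl
  refine (himage.closure hxφ).1 ?_
  rwa [hφρ x hxφ]

theorem isConormalCovector_properInverseImage_iff (hL : IsClosed L) (hS : IsClosed S)
    {b : BlowUp κ L} (hb : ρ b ∉ L) {m : M} (hm : m = ρ b) (β : (κ → ℂ) →L[ℂ] ℂ) :
    IsConormalCovector κ (properInverseImage ρ L S) b
      (β.comp (mfderiv 𝓘(ℂ, κ → ℂ) 𝓘(ℂ, κ → ℂ) ρ b : (κ → ℂ) →L[ℂ] (κ → ℂ))) ↔
      IsConormalCovector κ S m β := by
  obtain ⟨φ, hφ, hbφ, hφL, hφρ⟩ := BlowUp.exists_isBiholomorphic hL hb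
  have hderiv : (mfderiv 𝓘(ℂ, κ → ℂ) 𝓘(ℂ, κ → ℂ) ρ b : (κ → ℂ) →L[ℂ] (κ → ℂ)) =
      mfderiv 𝓘(ℂ, κ → ℂ) 𝓘(ℂ, κ → ℂ) φ b :=
    (Filter.eventuallyEq_of_mem (φ.open_source.mem_nhds hbφ) fun z hz =>
      (hφρ z hz).symm).mfderiv_eq
  obtain rfl : m = φ b := hm.trans (hφρ b hbφ).symm
  refine (iff_of_eq (congrArg (fun A : (κ → ℂ) →L[ℂ] (κ → ℂ) =>
    IsConormalCovector κ (properInverseImage ρ L S) b (β.comp A)) hderiv)).trans ?_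
  exact hφ.isConormalCovector_comp_iff hbφ fun z hz => by
    rw [mem_properInverseImage_iff hS (hφL z hz), hφρ z hz]

theorem IsCorresponding.isConormalCovector_iff (hL : IsClosed L) (hLN : L ⊆ N) (hS : IsClosed S)
    {x : BlowUp (κ ⊕ κ) (π ⁻¹' L)} {p : LogCotangent κ (ρ ⁻¹' N)} (h : IsCorresponding N L x p)
    (hx : π (τ x) ∉ N) :
    IsConormalCovector κ S (π (τ x)) (LogCotangent.covector κ N (τ x)) ↔
      IsConormalCovector κ (properInverseImage ρ L S) (ϖ p)
        (LogCotangent.covector κ (ρ ⁻¹' N) p) := by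
  have hp : ρ (ϖ p) ∉ L := fun hpL => hx (h.proj_eq ▸ hLN hpL)
  refine (isConormalCovector_properInverseImage_iff hL hS hp h.proj_eq _).symm.trans
    (iff_of_eq (congrArg (IsConormalCovector κ (properInverseImage ρ L S) (ϖ p)) ?_))
  exact (h.covector_eq hx).symm

theorem image_properInverseImage_conormal (hL : IsTrivialCenter κ N L) (hS : IsClosed S)
    {Φ : BlowUp (κ ⊕ κ) (π ⁻¹' L)
      ≃ₘ^ω⟮𝓘(ℂ, κ ⊕ κ → ℂ), 𝓘(ℂ, κ ⊕ κ → ℂ)⟯ LogCotangent κ (ρ ⁻¹' N)}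
    (h : ∀ x, IsCorresponding N L x (Φ x)) :
    Φ '' properInverseImage τ (π ⁻¹' L) (LogCotangent.conormal κ N S) =
      LogCotangent.conormal κ (ρ ⁻¹' N) (properInverseImage ρ L S) := by
  rw [LogCotangent.conormal, properInverseImage_closure
    (hL.1.preimage LogCotangent.continuous_proj)
    (disjoint_left.2 fun p hp hpL => hp.1 (hL.subset hpL)), LogCotangent.conormal]
  refine (Φ.toHomeomorph.image_closure _).trans (congrArg closure ?_)
  rw [Φ.toHomeomorph.image_eq_preimage_symm]
  ext p
  obtain ⟨x, rfl⟩ := Φ.toHomeomorph.surjective p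
  rw [mem_preimage, Homeomorph.symm_apply_apply]
  have hN : π (τ x) ∉ N ↔ ϖ (Φ x) ∉ ρ ⁻¹' N := by
    rw [(h x).proj_eq]
    rfl
  change π (τ x) ∉ N ∧ _ ↔ ϖ (Φ x) ∉ ρ ⁻¹' N ∧ _
  rw [← hN]
  exact and_congr_right fun hx => (h x).isConormalCovector_iff hL.1 hL.subset hS hx

end Hypersurfaces

end

theorem mainTheorem5 {n : ℕ} {M : Type*} [TopologicalSpace M] [T2Space M]
    [ChartedSpace (Fin n → ℂ) M] [IsManifold 𝓘(ℂ, Fin n → ℂ) ω M] (N L : Set M)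
    (hN : IsNormalCrossings (Fin n) N) (hL : IsTrivialCenter (Fin n) N L)
    -- the blow up `ρ` of `M` along `L`, and the inverse image of `N`
    (ρ : BlowUp (Fin n) L → M) (hρ : ρ = BlowUp.proj (Fin n) L)
    (N' : Set (BlowUp (Fin n) L)) (hN' : N' = ρ ⁻¹' N)
    -- the projections of the two logarithmic cotangent bundles
    (π : LogCotangent (Fin n) N → M) (hπ : π = LogCotangent.proj (Fin n) N)
    (π' : LogCotangent (Fin n) N' → BlowUp (Fin n) L) (hπ' : π' = LogCotangent.proj (Fin n) N')
    -- the center in the logarithmic cotangent bundle, and the blow up `τ` along it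
    (C : Set (LogCotangent (Fin n) N)) (hC : C = π ⁻¹' L)
    (τ : BlowUp (Fin n ⊕ Fin n) C → LogCotangent (Fin n) N)
    (hτ : τ = BlowUp.proj (Fin n ⊕ Fin n) C) :
    IsNormalCrossings (Fin n) N' ∧
    -- the blow up is a logarithmic symplectic manifold
    T2Space (BlowUp (Fin n ⊕ Fin n) C) ∧
    IsLogSymplecticPotential (Fin n ⊕ Fin n) (τ ⁻¹' (π ⁻¹' N))
      (pullbackForm (Fin n ⊕ Fin n) (Fin n ⊕ Fin n) τ (LogCotangent.canonicalForm (Fin n) N)) ∧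
    -- it is isomorphic to the logarithmic cotangent bundle of the blow up of `M`
    ∃ Φ : BlowUp (Fin n ⊕ Fin n) C
        ≃ₘ^ω⟮𝓘(ℂ, Fin n ⊕ Fin n → ℂ), 𝓘(ℂ, Fin n ⊕ Fin n → ℂ)⟯ LogCotangent (Fin n) N',
      (∀ x, π (τ x) = ρ (π' (Φ x))) ∧
      (∀ x, π (τ x) ∉ N → pullbackForm (Fin n ⊕ Fin n) (Fin n ⊕ Fin n) Φ (LogCotangent.canonicalForm (Fin n) N') x =
        pullbackForm (Fin n ⊕ Fin n) (Fin n ⊕ Fin n) τ (LogCotangent.canonicalForm (Fin n) N) x) ∧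
      (∀ (t : ℂ) (p q : LogCotangent (Fin n) N'), LogCotangent.IsMultiple (Fin n) N' t p q →
        LogCotangent.IsMultiple (Fin n) N t (τ (Φ.symm p)) (τ (Φ.symm q))) ∧
      -- conormals of natural hypersurfaces
      ∀ S : Set M, IsHypersurface (Fin n) S → IsNatural (Fin n) N S →
        IsHypersurface (Fin n) (properInverseImage ρ L S) ∧
        IsNatural (Fin n) N' (properInverseImage ρ L S) ∧
        Φ '' properInverseImage τ C (LogCotangent.conormal (Fin n) N S) =
          LogCotangent.conormal (Fin n) N' (properInverseImage ρ L S) := by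
  subst hρ hN' hπ hπ' hC hτ
  have : T2Space (LogCotangent (Fin n) N) := LogCotangent.t2Space
  obtain ⟨Φ, hcorr, hlocal⟩ := exists_diffeomorph hN hL
  exact ⟨hL.isNormalCrossings_preimage hN, BlowUp.t2Space,
    IsCorresponding.isLogSymplecticPotential hN hL hcorr, Φ, fun x => (hcorr x).proj_eq,
    fun x hx => IsCorresponding.pullbackForm_eq hcorr hx,
    fun t p q h => isMultiple_proj_symm hN hL hlocal h, fun S hS hnat =>
      ⟨isHypersurface_properInverseImage hL hS, isNatural_properInverseImage hL.1 hS hnat,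
        image_properInverseImage_conormal hL hS.isClosed hcorr⟩⟩
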